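/- **Setting.** Let $x_0>0$ and let $U_0$, $U_{x_0}$ be open disks centered at $0$ and $x_0$ with disjoint closures. All arcs below are compact, simple, regular, oriented $C^2$ arcs. Let $L_\Gamma, L_\Delta$ be two arcs (the conductors) such that each of $0$ and $x_0$ is an endpoint of at least one of them, and let $\Sigma_\Gamma^\pm,\Sigma_\Delta^\pm$ be four arcs (the lens lips), with union $\Sigma_{\rm lens}$. The lips are disjoint from the conductors. Apart from their endpoints, which may lie on the circles, the lips lie outside $\overline{U_0}\cup\overline{U_{x_0}}$. The conductors meet the circles $\partial U_0,\partial U_{x_0}$ in finitely many points. Let $\Sigma_S$ be the union of the conductors, the lips and possibly finitely many further arcs which, apart from their endpoints, lie inside the disks. Distinct arcs of $\Sigma_S$ meet at most at common endpoints. Put $$\Sigma_R=\Sigma_{\rm lens}\cup\partial U_0\cup\partial U_{x_0},$$ where the circles are oriented clockwise. Different pieces of $\Sigma_R$ (the two circles and the four lips) are nowhere tangent where they meet. The $+$ side is on the left and the $-$ side on the right of an oriented curve, and boundary values are nontangential. The following data are given. * *Phases.* Functions $\phi_\Gamma,\phi_\Delta$, analytic on the lips of the corresponding conductor, with $\operatorname{Re}\phi\ge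 c_0>0$ there. * *Jumps of $S$.* Matrices $J_S=J_{S,n}(z)\in\mathbb C^{3\times3}$ for $n\in\mathbb N$, with $J_S=I$ off $\Sigma_S$. Outside $\overline{U_0}\cup\overline{U_{x_0}}$, at interior points of the conductors, $J_S=P_{13}$ on $L_\Gamma$ and $J_S=P_{12}$ on $L_\Delta$ (permutation matrices). At interior points of the lips, $J_S$ is continuous and, for large $n$, differs from $I$ in one entry only. On the lips of $L_\Gamma$ this is the $(1,3)$ or the $(3,1)$ entry, on the lips of $L_\Delta$ the $(1,2)$ or the $(2,1)$ entry, and it is bounded by $A|e^{-n\phi_\Gamma}|$, respectively $A|e^{-n\phi_\Delta}|$, with $A$ independent of $n$ and $z$. * *Outer parametrix.* $N$ is analytic and invertible on $\mathbb C\setminus(L_\Gamma\cup L_\Delta)$. At interior points of the conductors $N_+=N_-P_{13}$ on $L_\Gamma$ and $N_+=N_-P_{12}$ on $L_\Delta$. Moreover $N(z)=I+O(1/z)$ as $z\to\infty$. * *Local parametrices.* $P^{(0)}=P^{(0)}_n$ is analytic in $U_0\setminus\Sigma_S$ and continuous on $\overline{U_0}\setminus\Sigma_S$. It satisfies $P^{(0)}_+=P^{(0)}_-J_S$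 at the interior points of the arcs of $\Sigma_S$ that lie in $U_0$. It satisfies the matching condition $P^{(0)}N^{-1}=I+O(1/n)$ as $n\to\infty$, uniformly on $\partial U_0\setminus\Sigma_S$. The matrix $P^{(x_0)}$ has the same properties with respect to $U_{x_0}$. Let $P=P^{(0)}$ in $U_0$, $P=P^{(x_0)}$ in $U_{x_0}$, $P=N$ elsewhere, and define on $\Sigma_R$ $$J_R=P_-J_SP_+^{-1},\qquad W_R=J_R-I .$$ Thus $J_R=P^{(0)}N^{-1}$ on $\partial U_0$, $J_R=P^{(x_0)}N^{-1}$ on $\partial U_{x_0}$ (off the finitely many points of $\Sigma_S$) and $J_R=NJ_SN^{-1}$ on the lips. The *error RHP* asks for $R$ analytic in $\mathbb C\setminus\Sigma_R$ with boundary values $R_\pm\in L^2(\Sigma_R)$, $R_+=R_-J_R$ a.e. on $\Sigma_R$, and $R(z)=I+O(1/z)$ as $z\to\infty$. It is understood in the usual $L^2$ sense: $R-I$ is the Cauchy transform $\frac1{2\pi i}\int_{\Sigma_R}\frac{h(s)}{s-z}\,ds$ of some $h\in L^2(\Sigma_R)$. Let $\mathcal C_-h$ denote the boundary value of this transform from the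 $-$ side. **Proposition 7.1 (small-norm solvability).** 1. There are constants $C,c>0$ such that for all large $n$ one has $\|J_R-I\|\le C/n$ on $(\partial U_0\cup\partial U_{x_0})\setminus\Sigma_S$ and $\|J_R-I\|\le Ce^{-cn}$ at all interior points of the lens lips. 2. For all sufficiently large $n$ the error RHP has a unique solution $R$. The operator $\mathcal C_{W_R}f=\mathcal C_-(fW_R)$ is bounded on $L^2(\Sigma_R)$ with norm $O(1/n)$. The singular integral equation $$R_-=I+\mathcal C_-(R_-W_R)$$ has a unique solution $R_-\in L^2(\Sigma_R)$. This solution is given by the $L^2$-convergent Neumann series $R_-=\sum_{k\ge0}\mathcal C_{W_R}^k I$, it is the boundary value of $R$ from the $-$ side, and $$R(z)=I+\frac1{2\pi i}\int_{\Sigma_R}\frac{R_-(s)W_R(s)}{s-z}\,ds,\qquad z\in\mathbb C\setminus\Sigma_R .$$ 3. For every compact $K\subset\mathbb C\setminus\Sigma_R$ there is a constant $C_K$ such that $\|R(z)-I\|\le C_K/n$ for all $z\in K$ and all sufficiently large $n$. -/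

import Mathlib

open MeasureTheory Filter Topology Set
open scoped Matrix.Norms.Operator

/-- Complex `3 × 3` matrices, with the operator norm for the sup norm on `ℂ³`. -/
abbrev Mat3 : Type := Matrix (Fin 3) (Fin 3) ℂ

/-- A simple, regular, oriented `C²` arc, parametrized over `[0,1]`. -/
structure SmoothArc where
  toFun : ℝ → ℂ
  contDiff : ContDiff ℝ 2 toFun
  deriv_ne_zero : ∀ t ∈ Icc (0 : ℝ) 1, deriv toFun t ≠ 0
  injOn : InjOn toFun (Icc 0 1)

/-- The point set of an arc, endpoints included. -/
def SmoothArc.carrier (a : SmoothArc) : Set ℂ := a.toFun '' Icc 0 1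

/-- `F` has the nontangential limit `w` at `z` from the left of the direction `τ`: it tends to `w`
in every cone with vertex `z`, axis `i τ` and opening smaller than a half plane. -/
def HasLeftLimit (F : ℂ → Mat3) (z τ : ℂ) (w : Mat3) : Prop :=
  ∀ a : ℝ, 0 < a → a < 1 →
    Tendsto F (𝓝[{ζ | a * (‖ζ - z‖ * ‖τ‖) < ((ζ - z) * (starRingEnd ℂ) τ).im}] z) (𝓝 w)

/-- Nontangential limit from the right of the direction `τ`. -/
def HasRightLimit (F : ℂ → Mat3) (z τ : ℂ) (w : Mat3) : Prop := HasLeftLimit F z (-τ) w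

/-- The two active channels: `Gamma` couples the indices 1 and 3, `Delta` the indices 1 and 2. -/
inductive Channel where
  | Gamma
  | Delta
  deriving DecidableEq

instance : Fintype Channel := ⟨{.Gamma, .Delta}, by intro x; cases x <;> simp⟩

/-- The index coupled to the first one in a channel (indices of `Fin 3` start at `0`). -/
def Channel.partner : Channel → Fin 3
  | .Gamma => 2
  | .Delta => 1

/-- The permutation matrix of a channel, `P₁₃` or `P₁₂`. -/
def Channel.perm : Channel → Mat3
  | .Gamma => !![0, 0, 1; 0, 1, 0; 1, 0, 0]
  | .Delta => !![0, 1, 0; 1, 0, 0; 0, 0, 1]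

/-- The upper and the lower lip of a lens. -/
inductive Side where
  | upper
  | lower
  deriving DecidableEq

instance : Fintype Side := ⟨{.upper, .lower}, by intro x; cases x <;> simp⟩

/-- Labels of the arcs of the contour of `S`: the conductors, the lens lips outside the disks, and
`m` further arcs inside the disks. -/
inductive SLabel (m : ℕ) where
  | conductor (ch : Channel)
  | lip (ch : Channel) (s : Side)
  | inner (k : Fin m)

/-- Labels of the pieces of the error contour: two circles and four lens lips. -/
inductive Piece where
  | hardCircle
  | softCircle
  | lip (ch : Channel) (s : Side)
  deriving DecidableEq, Fintype

/-- The parametrized oriented arcs and circles of the regular two-edge geometry. -/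
structure ContourData where
  /-- the soft edge; the hard edge is `0` -/
  x₀ : ℝ
  /-- radius of the disk around `0` -/
  r₀ : ℝ
  /-- radius of the disk around `x₀` -/
  r₁ : ℝ
  conductor : Channel → SmoothArc
  lip : Channel → Side → SmoothArc
  /-- number of further arcs (continuations of the lips) on which `S` jumps inside the disks -/
  m : ℕ
  inner : Fin m → SmoothArc

namespace ContourData

variable (Γ : ContourData)

/-- The arcs of the contour of `S`. -/
def sArc : SLabel Γ.m → SmoothArc
  | .conductor ch => Γ.conductor ch
  | .lip ch s => Γ.lip ch s
  | .inner k => Γ.inner k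

/-- The contour of `S`. -/
def sigmaS : Set ℂ := ⋃ l, (Γ.sArc l).carrier

/-- The union of the two conductors. -/
def conductors : Set ℂ := ⋃ ch, (Γ.conductor ch).carrier

/-- Parametrizations over `[0,1]` of the pieces of the error contour. The circles are run through
clockwise, so that the outside is on the left, the `+` side. -/
noncomputable def param : Piece → ℝ → ℂ
  | .hardCircle => fun t => circleMap 0 Γ.r₀ (-(2 * Real.pi * t))
  | .softCircle => fun t => circleMap Γ.x₀ Γ.r₁ (-(2 * Real.pi * t))
  | .lip ch s => (Γ.lip ch s).toFun

/-- The error contour: the lens lips together with the boundaries of the two disks. -/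
def sigmaR : Set ℂ :=
  (⋃ ch, ⋃ s, (Γ.lip ch s).carrier) ∪ Metric.sphere 0 Γ.r₀ ∪ Metric.sphere (Γ.x₀ : ℂ) Γ.r₁

/-- Arc length on the error contour. -/
noncomputable def arcLength : Measure ℂ :=
  ∑ p : Piece,
    ((volume.restrict (Icc (0 : ℝ) 1)).withDensity (fun t => ‖deriv (Γ.param p) t‖ₑ)).map
      (Γ.param p)

/-- The Cauchy transform `(1 / 2πi) ∫ h(s) / (s - z) ds` over the oriented error contour. -/
noncomputable def cauchy (h : ℂ → Mat3) (z : ℂ) : Mat3 :=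
  (2 * Real.pi * Complex.I)⁻¹ •
    ∑ p : Piece, ∫ t in (0 : ℝ)..1,
      (deriv (Γ.param p) t / (Γ.param p t - z)) • h (Γ.param p t)

/-- `g` is, almost everywhere on the error contour, the nontangential boundary value of `F` from
the left (`+`) side. -/
def IsPlusValue (F g : ℂ → Mat3) : Prop :=
  ∀ p : Piece, ∀ᵐ t ∂volume.restrict (Icc (0 : ℝ) 1),
    HasLeftLimit F (Γ.param p t) (deriv (Γ.param p) t) (g (Γ.param p t))

/-- `g` is, almost everywhere on the error contour, the nontangential boundary value of `F` from
the right (`-`) side. -/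
def IsMinusValue (F g : ℂ → Mat3) : Prop :=
  ∀ p : Piece, ∀ᵐ t ∂volume.restrict (Icc (0 : ℝ) 1),
    HasRightLimit F (Γ.param p t) (deriv (Γ.param p) t) (g (Γ.param p t))

/-- The geometric assumptions of the regular hard/soft two-edge regime. -/
structure IsRegular : Prop where
  r₀_pos : 0 < Γ.r₀
  r₁_pos : 0 < Γ.r₁
  /-- the soft edge is positive and the closed disks are disjoint -/
  disks_disjoint : Γ.r₀ + Γ.r₁ < Γ.x₀
  /-- `0` is an endpoint of a conductor -/
  hard_edge : ∃ ch, (Γ.conductor ch).toFun 0 = 0 ∨ (Γ.conductor ch).toFun 1 = 0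
  /-- `x₀` is an endpoint of a conductor -/
  soft_edge : ∃ ch, (Γ.conductor ch).toFun 0 = Γ.x₀ ∨ (Γ.conductor ch).toFun 1 = Γ.x₀
  /-- distinct arcs meet at most at endpoints -/
  arcs_meet : ∀ l l' : SLabel Γ.m, l ≠ l' → ∀ s ∈ Ioo (0 : ℝ) 1, ∀ t ∈ Icc (0 : ℝ) 1,
    (Γ.sArc l).toFun s ≠ (Γ.sArc l').toFun t
  /-- the lips keep away from the conductors -/
  lips_conductors : ∀ ch s, Disjoint (Γ.lip ch s).carrier Γ.conductors
  /-- the lips do not enter the disks; their endpoints may lie on the circles -/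
  lips_outside : ∀ ch s, ∀ t ∈ Ioo (0 : ℝ) 1,
    (Γ.lip ch s).toFun t ∉ Metric.closedBall (0 : ℂ) Γ.r₀ ∪ Metric.closedBall (Γ.x₀ : ℂ) Γ.r₁
  inner_inside : ∀ k, ∀ t ∈ Ioo (0 : ℝ) 1,
    (Γ.inner k).toFun t ∈ Metric.ball (0 : ℂ) Γ.r₀ ∪ Metric.ball (Γ.x₀ : ℂ) Γ.r₁
  /-- the circles are crossed by the conductors at finitely many points only -/
  conductors_circles :
    (Γ.conductors ∩ (Metric.sphere (0 : ℂ) Γ.r₀ ∪ Metric.sphere (Γ.x₀ : ℂ) Γ.r₁)).Finite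
  /-- no tangential contact between different pieces of the error contour -/
  transversal : ∀ p q : Piece, p ≠ q → ∀ s ∈ Icc (0 : ℝ) 1, ∀ t ∈ Icc (0 : ℝ) 1,
    Γ.param p s = Γ.param q t →
      ((starRingEnd ℂ) (deriv (Γ.param p) s) * deriv (Γ.param q) t).im ≠ 0

/-- Sign chart: the phases are analytic on the lips of their channel and their real parts have a
uniform positive lower bound there. -/
structure IsPhase (φ : Channel → ℂ → ℂ) : Prop where
  analytic : ∀ ch s, AnalyticOnNhd ℂ (φ ch) (Γ.lip ch s).carrier
  lower_bound : ∃ c : ℝ, 0 < c ∧ ∀ ch s, ∀ z ∈ (Γ.lip ch s).carrier, c ≤ (φ ch z).re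

/-- The jump matrices of `S` after the opening of the lenses (no condition is put on them inside
the disks). -/
structure IsPostLensJump (φ : Channel → ℂ → ℂ) (JS : ℕ → ℂ → Mat3) : Prop where
  /-- there is no jump off the contour of `S` -/
  off : ∀ n, ∀ z ∉ Γ.sigmaS, JS n z = 1
  /-- permutation jumps on the conductors outside the disks -/
  conductor : ∀ n ch, ∀ t ∈ Ioo (0 : ℝ) 1,
    (Γ.conductor ch).toFun t ∉
        Metric.closedBall (0 : ℂ) Γ.r₀ ∪ Metric.closedBall (Γ.x₀ : ℂ) Γ.r₁ →
      JS n ((Γ.conductor ch).toFun t) = ch.perm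
  lip_continuous : ∀ n ch s, ContinuousOn (JS n) ((Γ.lip ch s).toFun '' Ioo 0 1)
  /-- on a lip the jump is unipotent triangular in the channel, with an off-diagonal entry
  controlled by `exp (-n φ)` -/
  lip : ∃ A : ℝ, ∀ᶠ n : ℕ in atTop, ∀ ch s, ∀ z ∈ (Γ.lip ch s).toFun '' Ioo 0 1, ∃ w : ℂ,
    ‖w‖ ≤ A * ‖Complex.exp (-(n * φ ch z))‖ ∧
      (JS n z = 1 + Matrix.single 0 ch.partner w ∨ JS n z = 1 + Matrix.single ch.partner 0 w)

/-- Outer parametrix: an invertible solution of the Riemann-Hilbert problem with permutation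
jumps on the conductors, normalized at infinity. -/
structure IsOuterParametrix (N : ℂ → Mat3) : Prop where
  analytic : DifferentiableOn ℂ N Γ.conductorsᶜ
  invertible : ∀ z ∉ Γ.conductors, (N z).det ≠ 0
  jump : ∀ ch, ∀ t ∈ Ioo (0 : ℝ) 1, ∃ Np Nm : Mat3,
    HasLeftLimit N ((Γ.conductor ch).toFun t) (deriv (Γ.conductor ch).toFun t) Np ∧
    HasRightLimit N ((Γ.conductor ch).toFun t) (deriv (Γ.conductor ch).toFun t) Nm ∧
    Np = Nm * ch.perm
  normalized : (fun z => N z - 1) =O[Bornology.cobounded ℂ] fun z => z⁻¹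

/-- Local parametrix in the disk with center `c` and radius `r`: it is analytic off the contour of
`S`, has the jumps of `S` inside the disk, and its boundary values on the circle (which `P n` takes
there) match the outer parametrix up to `O(1/n)`. The behaviour at the center, which is of Bessel
or of Airy type, is left free. -/
structure IsLocalParametrix (JS : ℕ → ℂ → Mat3) (N : ℂ → Mat3) (c : ℂ) (r : ℝ)
    (P : ℕ → ℂ → Mat3) : Prop where
  analytic : ∀ n, DifferentiableOn ℂ (P n) (Metric.ball c r \ Γ.sigmaS)
  continuous : ∀ n, ContinuousOn (P n) (Metric.closedBall c r \ Γ.sigmaS)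
  jump : ∀ n l, ∀ t ∈ Ioo (0 : ℝ) 1, (Γ.sArc l).toFun t ∈ Metric.ball c r →
    ∃ Pp Pm : Mat3,
      HasLeftLimit (P n) ((Γ.sArc l).toFun t) (deriv (Γ.sArc l).toFun t) Pp ∧
      HasRightLimit (P n) ((Γ.sArc l).toFun t) (deriv (Γ.sArc l).toFun t) Pm ∧
      Pp = Pm * JS n ((Γ.sArc l).toFun t)
  matching : ∃ C : ℝ, ∀ᶠ n : ℕ in atTop, ∀ z ∈ Metric.sphere c r \ Γ.sigmaS,
    ‖P n z * (N z)⁻¹ - 1‖ ≤ C / n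

/-- The value on the error contour of the global parametrix from the `-` side: the local
parametrices on the circles, the outer one on the lips. -/
noncomputable def globalMinus (N : ℂ → Mat3) (P₀ P₁ : ℕ → ℂ → Mat3) (n : ℕ) (z : ℂ) : Mat3 :=
  open Classical in
  if z ∈ Metric.sphere (0 : ℂ) Γ.r₀ then P₀ n z
  else if z ∈ Metric.sphere (Γ.x₀ : ℂ) Γ.r₁ then P₁ n z
  else N z

/-- The jump matrix `J_R = P₋ J_S P₊⁻¹` of the error problem; on the whole error contour the global
parametrix from the `+` side is the outer one. -/
noncomputable def errorJump (JS : ℕ → ℂ → Mat3) (N : ℂ → Mat3) (P₀ P₁ : ℕ → ℂ → Mat3)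
    (n : ℕ) (z : ℂ) : Mat3 :=
  Γ.globalMinus N P₀ P₁ n z * JS n z * (N z)⁻¹

/-- `R` solves, in the `L²` sense, the Riemann-Hilbert problem on the error contour with jump
matrix `J`, normalized to `I` at infinity. As usual in the `L²` theory, `R - I` is required to be
the Cauchy transform of a square integrable density. -/
structure IsErrorSolution (J : ℂ → Mat3) (R : ℂ → Mat3) : Prop where
  analytic : DifferentiableOn ℂ R Γ.sigmaRᶜ
  jump : ∃ Rp Rm : ℂ → Mat3, MemLp Rp 2 Γ.arcLength ∧ MemLp Rm 2 Γ.arcLength ∧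
    Γ.IsPlusValue R Rp ∧ Γ.IsMinusValue R Rm ∧ ∀ᵐ z ∂Γ.arcLength, Rp z = Rm z * J z
  normalized : (fun z => R z - 1) =O[Bornology.cobounded ℂ] fun z => z⁻¹
  square_integrable : ∃ h : ℂ → Mat3, MemLp h 2 Γ.arcLength ∧
    ∀ z ∉ Γ.sigmaR, R z = 1 + Γ.cauchy h z

/-- `u ∈ L²` solves the singular integral equation `u = I + C₋(u W)`. -/
def SolvesSingularEquation (W u : ℂ → Mat3) : Prop :=
  MemLp u 2 Γ.arcLength ∧ Γ.IsMinusValue (Γ.cauchy fun z => u z * W z) fun z => u z - 1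

/-- `T` is the operator `f ↦ C₋(f W)` on `L²` of the error contour. -/
def IsCauchyOperator (W : ℂ → Mat3)
    (T : Lp Mat3 2 Γ.arcLength →L[ℂ] Lp Mat3 2 Γ.arcLength) : Prop :=
  ∀ f : Lp Mat3 2 Γ.arcLength, Γ.IsMinusValue (Γ.cauchy fun z => f z * W z) (T f)

end ContourData

/-!
Once the Cauchy operator `C₋` of the error contour is known to be bounded on `L²` and the Plemelj
formula `C₊ h = C₋ h + h` is available, the result is a perturbation argument. The jump
`J_R = I + W` is within `O(1/n)` of the identity: on the circles this is the matching condition; on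
the lips `J_R - I` is `N (J_S - I) N⁻¹` with `N` and `N⁻¹` bounded there, since the lips stay away
from the conductors, so it is exponentially small (`ContourData.exists_errorJump_bounds`). Hence
`f ↦ C₋(f W)` has norm `O(1/n)`, the equation `u = I + C₋(u W)` is solved by a Neumann series, and
`R = I + C(u W)` solves the error problem. Conversely, if `R = I + C h` is any solution, the
Plemelj formula gives `h = R₊ - R₋ = R₋ W`, so that `R₋` solves the same equation
(`ContourData.IsErrorSolution.exists_singular`). The estimate on compact sets is Cauchy-Schwarz in
the Cauchy integral.

The substance is therefore the `L²` theory of the Cauchy integral on a contour made of two circles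
and four `C²` arcs, `ContourData.IsRegular.exists_cauchy_boundary`. It is reduced to a model case.

* On the unit circle, boundary values are given by the Hardy projection, an orthogonal projection
  in Fourier space: a density without negative frequencies has vanishing Cauchy integral outside,
  and one without nonnegative frequencies has vanishing Cauchy integral inside
  (`exists_hardy_projection`). One-sided limits then follow from the symmetric jump relation
  between mirror points, which is the convergence of the Poisson integral at Lebesgue points
  (`ae_tendsto_line_jump`, `ae_tendsto_curve_jump`).
* Along a `C²` curve, the Cauchy kernel seen from a nontangential cone differs from the kernel of
  the tangent line by a bounded quantity (`tendsto_curve_sub_line`). So the Cauchy integral along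
  the curve differs from that along the model circle by an integral operator with bounded kernel,
  which gives nontangential limits and an `L²` bound together (`exists_boundary_self`).
* Between two different pieces, which are nowhere tangent, the kernel is dominated by finitely many
  Hilbert kernels `1 / (|t - t₀| + |s - s₀|)` (`exists_meeting_bound`), bounded on `L²` by the
  Schur test with the weights `|t - t₀| ^ (-1/2)` (`memLp_hilbert`).
-/

/-! ### Tangential comparison of Cauchy kernels -/

/-- First order Taylor estimate along a `C²` curve, uniform on a compact parameter interval. -/
lemma exists_taylor_bound {γ : ℝ → ℂ} (hγ : ContDiff ℝ 2 γ) (b : ℝ) :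
    ∃ C : ℝ, 0 ≤ C ∧ ∀ s ∈ Icc 0 b, ∀ t ∈ Icc 0 b,
      ‖deriv γ t - deriv γ s‖ ≤ C * |t - s| ∧
      ‖γ t - γ s - deriv γ s * ((t : ℂ) - s)‖ ≤ C * |t - s| ^ 2 := by
  have h1 : ContDiff ℝ 1 (deriv γ) := ((contDiff_succ_iff_deriv (n := 1)).1 hγ).2.2
  have hd : Differentiable ℝ γ := hγ.differentiable (by norm_num)
  have hd1 : Differentiable ℝ (deriv γ) := h1.differentiable (by norm_num)
  have h2 : Continuous (deriv (deriv γ)) := h1.continuous_deriv (by norm_num)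
  obtain ⟨C, hC⟩ := (isCompact_Icc (a := (0 : ℝ)) (b := b)).exists_bound_of_continuousOn
    h2.continuousOn
  have key : ∀ s ∈ Icc 0 b, ∀ t ∈ Icc 0 b, ‖deriv γ t - deriv γ s‖ ≤ max C 0 * |t - s| := by
    intro s hs t ht
    have := (convex_Icc (0 : ℝ) b).norm_image_sub_le_of_norm_deriv_le (f := deriv γ)
      (fun x _ => hd1 x) (fun x hx => (hC x hx).trans (le_max_left C 0)) hs ht
    simpa [Real.norm_eq_abs] using this
  refine ⟨max C 0, le_max_right _ _, fun s hs t ht => ⟨key s hs t ht, ?_⟩⟩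
  have hder : ∀ x : ℝ, HasDerivAt (fun u : ℝ => γ u - deriv γ s * (u : ℂ))
      (deriv γ x - deriv γ s) x := by
    intro x
    have := ((hd x).hasDerivAt).fun_sub
      ((Complex.ofRealCLM.hasDerivAt (x := x)).const_mul (deriv γ s))
    simpa using this
  have hsub : uIcc s t ⊆ Icc 0 b := uIcc_subset_Icc hs ht
  have := (convex_uIcc s t).norm_image_sub_le_of_norm_hasDerivWithin_le
    (C := max C 0 * |t - s|) (f := fun u : ℝ => γ u - deriv γ s * (u : ℂ))
    (fun x _ => (hder x).hasDerivWithinAt)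
    (fun x hx => (key s hs x (hsub hx)).trans (by
      gcongr ?_ * ?_
      exact abs_sub_left_of_mem_uIcc hx)) left_mem_uIcc right_mem_uIcc
  rw [Real.norm_eq_abs] at this
  calc _ = ‖γ t - deriv γ s * (t : ℂ) - (γ s - deriv γ s * (s : ℂ))‖ := by congr 1; ring
    _ ≤ _ := this
    _ = _ := by ring

/-- The union of the two open cones with real vertex `s` and vertical axis, of aperture `a`. -/
def doubleCone (s a : ℝ) : Set ℂ := {w | a * ‖w - s‖ < |w.im|}

/-- In the double cone, the distance to a real point controls the distance to the vertex. -/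
lemma doubleCone_bounds {s a : ℝ} (ha : 0 < a) {w : ℂ} (hw : w ∈ doubleCone s a) (t : ℝ) :
    0 < ‖(t : ℂ) - w‖ ∧ a * ‖w - s‖ ≤ ‖(t : ℂ) - w‖ ∧
      |t - s| ≤ (1 + a⁻¹) * ‖(t : ℂ) - w‖ := by
  have h1 : |w.im| ≤ ‖(t : ℂ) - w‖ := by
    have := Complex.abs_im_le_norm ((t : ℂ) - w)
    simpa using this
  have h0 : a * ‖w - s‖ < |w.im| := hw
  have h2 : ‖w - s‖ ≤ a⁻¹ * ‖(t : ℂ) - w‖ := by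
    rw [inv_mul_eq_div, le_div_iff₀ ha]; linarith
  refine ⟨lt_of_le_of_lt (by positivity) (h0.trans_le h1), by linarith, ?_⟩
  have h3 : |t - s| = ‖((t : ℂ) - w) + (w - s)‖ := by
    rw [sub_add_sub_cancel, ← Complex.ofReal_sub, Complex.norm_real, Real.norm_eq_abs]
  rw [h3]
  calc _ ≤ _ := norm_add_le _ _
    _ ≤ _ := by linarith

/-- Near `γ s` and away from the tangent direction, a curve keeps a distance from the point with
tangential coordinate `w` that is comparable with `|t - w|`, uniformly in the parameter `t`. -/
lemma eventually_lower_bound {γ : ℝ → ℂ} (hγ : ContDiff ℝ 2 γ) {b s a : ℝ} (hs : s ∈ Icc 0 b)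
    (h' : deriv γ s ≠ 0) (hinj : ∀ t ∈ Icc 0 b, t ≠ s → γ t ≠ γ s) (ha : 0 < a) :
    ∃ c : ℝ, 0 < c ∧ ∀ᶠ w in 𝓝[doubleCone s a] (s : ℂ), ∀ t ∈ Icc 0 b,
      c * ‖(t : ℂ) - w‖ ≤ ‖γ t - (γ s + deriv γ s * (w - s))‖ := by
  obtain ⟨C, hC0, hC⟩ := exists_taylor_bound hγ b
  have hb : 0 ≤ b := hs.1.trans hs.2
  set d := ‖deriv γ s‖ with hd
  have hd0 : 0 < d := norm_pos_iff.2 h'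
  set k := 1 + a⁻¹ with hk
  have hk0 : 0 < k := by positivity
  set δ := d / (2 * (C * k + 1)) with hδ
  have hCk : 0 < C * k + 1 := by positivity
  have hδ0 : 0 < δ := by positivity
  -- the part of the curve at parameter distance at least `δ` keeps a positive distance from `γ s`
  obtain ⟨m, hm0, hm⟩ : ∃ m : ℝ, 0 < m ∧ ∀ t ∈ Icc 0 b, δ ≤ |t - s| → m ≤ ‖γ t - γ s‖ := by
    have hK : IsCompact (Icc 0 b ∩ {t : ℝ | δ ≤ |t - s|}) :=
      isCompact_Icc.inter_right (isClosed_le continuous_const (by fun_prop))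
    obtain ⟨m, hm0, hm⟩ := hK.exists_forall_le' (f := fun t => ‖γ t - γ s‖) (a := 0)
      ((hγ.continuous.sub continuous_const).norm.continuousOn) (by
        rintro t ⟨ht, hts⟩
        exact norm_pos_iff.2 (sub_ne_zero.2 (hinj t ht (by
          rintro rfl; simp at hts; linarith))))
    exact ⟨m, hm0, fun t ht hts => hm t ⟨ht, hts⟩⟩
  refine ⟨min (d / 2) (m / 2 / (b + 1)), by positivity, ?_⟩
  have hball : ∀ᶠ w : ℂ in 𝓝[doubleCone s a] (s : ℂ), ‖w - s‖ < min 1 (m / 2 / d) := by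
    have := nhdsWithin_le_nhds (a := (s : ℂ)) (s := doubleCone s a)
      (Metric.ball_mem_nhds (s : ℂ) (show 0 < min 1 (m / 2 / d) by positivity))
    filter_upwards [this] with w hw
    simpa [dist_eq_norm] using hw
  filter_upwards [hball, self_mem_nhdsWithin] with w hw hwc t ht
  obtain ⟨h0, -, h2⟩ := doubleCone_bounds ha hwc t
  rcases lt_or_ge |t - s| δ with h | h
  · have e : γ t - (γ s + deriv γ s * (w - s)) =
        deriv γ s * ((t : ℂ) - w) + (γ t - γ s - deriv γ s * ((t : ℂ) - s)) := by ring
    have e1 := norm_sub_le_norm_add (deriv γ s * ((t : ℂ) - w))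
      (γ t - γ s - deriv γ s * ((t : ℂ) - s))
    rw [norm_mul] at e1
    have e2 := (hC s hs t ht).2
    have e3 : C * |t - s| ^ 2 ≤ d / 2 * ‖(t : ℂ) - w‖ := by
      calc C * |t - s| ^ 2 = C * |t - s| * |t - s| := by ring
        _ ≤ C * δ * (k * ‖(t : ℂ) - w‖) := by gcongr
        _ = (C * k * δ) * ‖(t : ℂ) - w‖ := by ring
        _ ≤ _ := by
          gcongr
          calc C * k * δ ≤ (C * k + 1) * δ := by gcongr; linarith
            _ = d / 2 := by rw [hδ]; field_simp
    rw [e]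
    calc _ ≤ d / 2 * ‖(t : ℂ) - w‖ := by gcongr; exact min_le_left _ _
      _ ≤ _ := by linarith
  · have h3 := hm t ht h
    have h4 : ‖deriv γ s * (w - s)‖ ≤ m / 2 := by
      rw [norm_mul, mul_comm]
      exact (le_div_iff₀ hd0).1 (hw.le.trans (min_le_right _ _))
    have h5 : ‖(t : ℂ) - w‖ ≤ b + 1 := by
      calc ‖(t : ℂ) - w‖ = ‖((t - s : ℝ) : ℂ) - (w - s)‖ := by congr 1; push_cast; ring
        _ ≤ |t - s| + ‖w - s‖ := by
          refine (norm_sub_le _ _).trans ?_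
          rw [Complex.norm_real, Real.norm_eq_abs]
        _ ≤ b + 1 := by
          gcongr
          · rw [abs_le]; constructor <;> linarith [hs.1, hs.2, ht.1, ht.2]
          · exact hw.le.trans (min_le_left _ _)
    calc _ ≤ m / 2 / (b + 1) * (b + 1) := by gcongr; exact min_le_right _ _
      _ = m / 2 := by field_simp
      _ ≤ ‖γ t - γ s‖ - ‖deriv γ s * (w - s)‖ := by linarith
      _ ≤ ‖(γ t - γ s) - deriv γ s * (w - s)‖ := norm_sub_norm_le _ _
      _ = _ := by congr 1; ring

/-- Subtracting the Cauchy kernel of the tangent line leaves a quantity with controlled numerator: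
the common bound behind the comparison of the Cauchy kernel of a curve with that of a line. -/
lemma norm_kernel_sub_le {γ : ℝ → ℂ} {C k c : ℝ} (hC0 : 0 ≤ C) (hc : 0 < c) {s t : ℝ} {w : ℂ}
    (h1 : ‖deriv γ t - deriv γ s‖ ≤ C * |t - s|)
    (h2 : ‖γ t - γ s - deriv γ s * ((t : ℂ) - s)‖ ≤ C * |t - s| ^ 2)
    (hk : |t - s| ≤ k * ‖(t : ℂ) - w‖) (htw : 0 < ‖(t : ℂ) - w‖)
    (hcw : c * ‖(t : ℂ) - w‖ ≤ ‖γ t - (γ s + deriv γ s * (w - s))‖) :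
    ‖deriv γ t / (γ t - (γ s + deriv γ s * (w - s))) - 1 / ((t : ℂ) - w)‖ ≤
      C * (k + k ^ 2) / c := by
  have hD : 0 < ‖γ t - (γ s + deriv γ s * (w - s))‖ := lt_of_lt_of_le (by positivity) hcw
  have hne : γ t - (γ s + deriv γ s * (w - s)) ≠ 0 := norm_pos_iff.1 hD
  have hne' : (t : ℂ) - w ≠ 0 := norm_pos_iff.1 htw
  have e : deriv γ t / (γ t - (γ s + deriv γ s * (w - s))) - 1 / ((t : ℂ) - w) =
      ((deriv γ t - deriv γ s) * ((t : ℂ) - w) - (γ t - γ s - deriv γ s * ((t : ℂ) - s))) /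
        ((γ t - (γ s + deriv γ s * (w - s))) * ((t : ℂ) - w)) := by
    rw [div_sub_div _ _ hne hne']; congr 1; ring
  rw [e, norm_div, norm_mul, div_le_div_iff₀ (by positivity) hc]
  set x := ‖(t : ℂ) - w‖
  have hnum : ‖(deriv γ t - deriv γ s) * ((t : ℂ) - w) -
      (γ t - γ s - deriv γ s * ((t : ℂ) - s))‖ ≤ C * (k + k ^ 2) * x ^ 2 := by
    calc _ ≤ ‖(deriv γ t - deriv γ s) * ((t : ℂ) - w)‖ +
          ‖γ t - γ s - deriv γ s * ((t : ℂ) - s)‖ := norm_sub_le _ _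
      _ ≤ C * (k * x) * x + C * (k * x) ^ 2 := by
        rw [norm_mul]
        refine add_le_add ?_ (h2.trans (by gcongr))
        exact mul_le_mul_of_nonneg_right (h1.trans (by gcongr)) (by positivity)
      _ = _ := by ring
  have hk' : 0 ≤ C * (k + k ^ 2) := by
    have : 0 ≤ k := by
      by_contra! h
      nlinarith [abs_nonneg (t - s)]
    positivity
  calc _ ≤ C * (k + k ^ 2) * x ^ 2 * c := by gcongr
    _ = C * (k + k ^ 2) * (c * x * x) := by ring
    _ ≤ _ := by gcongr

/-- The Cauchy integral of a density along a curve, as seen in the tangential coordinate `w` at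
`γ s`, differs from the one along the real line by a quantity with a nontangential limit. -/
lemma tendsto_curve_sub_line {γ : ℝ → ℂ} (hγ : ContDiff ℝ 2 γ) {b s a : ℝ} (hs : s ∈ Icc 0 b)
    (h' : deriv γ s ≠ 0) (hinj : ∀ t ∈ Icc 0 b, t ≠ s → γ t ≠ γ s) (ha : 0 < a)
    {f : ℝ → ℂ} (hf : IntervalIntegrable f volume 0 b) :
    Tendsto (fun w : ℂ =>
        (∫ t in (0 : ℝ)..b, deriv γ t / (γ t - (γ s + deriv γ s * (w - s))) * f t) -
          ∫ t in (0 : ℝ)..b, 1 / ((t : ℂ) - w) * f t)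
      (𝓝[doubleCone s a] (s : ℂ))
      (𝓝 (∫ t in (0 : ℝ)..b, (deriv γ t / (γ t - γ s) - 1 / ((t : ℂ) - s)) * f t)) := by
  have hb : 0 ≤ b := hs.1.trans hs.2
  obtain ⟨C, hC0, hC⟩ := exists_taylor_bound hγ b
  obtain ⟨c, hc, hlow⟩ := eventually_lower_bound hγ hs h' hinj ha
  have hcd : Continuous (deriv γ) := hγ.continuous_deriv (by norm_num)
  have hIoc : uIoc 0 b ⊆ Icc 0 b := by rw [uIoc_of_le hb]; exact Ioc_subset_Icc_self
  have hlim : Tendsto (fun w : ℂ => ∫ t in (0 : ℝ)..b,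
        (deriv γ t / (γ t - (γ s + deriv γ s * (w - s))) - 1 / ((t : ℂ) - w)) * f t)
      (𝓝[doubleCone s a] (s : ℂ))
      (𝓝 (∫ t in (0 : ℝ)..b, (deriv γ t / (γ t - γ s) - 1 / ((t : ℂ) - s)) * f t)) := by
    refine intervalIntegral.tendsto_integral_filter_of_dominated_convergence
      (fun t => C * ((1 + a⁻¹) + (1 + a⁻¹) ^ 2) / c * ‖f t‖) ?_ ?_ (hf.norm.const_mul _) ?_
    · refine Eventually.of_forall fun w => ?_
      refine AEStronglyMeasurable.mul ?_ hf.def'.aestronglyMeasurable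
      have hc' := hγ.continuous
      exact Measurable.aestronglyMeasurable (by
        have := hcd.measurable
        have := hc'.measurable
        fun_prop)
    · filter_upwards [hlow, self_mem_nhdsWithin] with w hw hwc
      refine Eventually.of_forall fun t ht => ?_
      have ht' := hIoc ht
      obtain ⟨h0, -, h2⟩ := doubleCone_bounds ha hwc t
      rw [norm_mul]
      gcongr
      exact norm_kernel_sub_le hC0 hc (hC s hs t ht').1 (hC s hs t ht').2 h2 h0 (hw t ht')
    · have hnull : ∀ᵐ t ∂(volume : Measure ℝ), t ≠ s := by
        simp [ae_iff, measure_singleton]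
      filter_upwards [hnull] with t hts ht
      refine Tendsto.mul_const _ (tendsto_nhdsWithin_of_tendsto_nhds ?_)
      have hne := sub_ne_zero.2 (hinj t (hIoc ht) hts)
      have hne' : (t : ℂ) - s ≠ 0 := by
        rw [sub_ne_zero]; exact_mod_cast hts
      have : ContinuousAt (fun w : ℂ => deriv γ t / (γ t - (γ s + deriv γ s * (w - s))) -
          1 / ((t : ℂ) - w)) s := by
        refine ContinuousAt.sub (ContinuousAt.div (by fun_prop) (by fun_prop) (by simpa using hne))
          (ContinuousAt.div (by fun_prop) (by fun_prop) hne')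
      have h3 := this.tendsto
      simpa using h3
  refine hlim.congr' ?_
  filter_upwards [hlow, self_mem_nhdsWithin] with w hw hwc
  have hi1 : IntervalIntegrable (fun t : ℝ =>
      deriv γ t / (γ t - (γ s + deriv γ s * (w - s))) * f t) volume 0 b := by
    refine hf.continuousOn_mul (ContinuousOn.div hcd.continuousOn
      (hγ.continuous.continuousOn.sub continuousOn_const) fun t ht => ?_)
    rw [uIcc_of_le hb] at ht
    have := (doubleCone_bounds ha hwc t).1
    exact norm_pos_iff.1 (lt_of_lt_of_le (by positivity) (hw t ht))
  have hi2 : IntervalIntegrable (fun t : ℝ => 1 / ((t : ℂ) - w) * f t) volume 0 b := by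
    refine hf.continuousOn_mul (ContinuousOn.div continuousOn_const
      (by fun_prop) fun t ht => ?_)
    exact norm_pos_iff.1 (doubleCone_bounds ha hwc t).1
  rw [← intervalIntegral.integral_sub hi1 hi2]
  simp only [sub_mul]

/-! ### Nontangential convergence of the Poisson kernel at Lebesgue points -/

/-- Dyadic estimate of a Poisson integral by averages over intervals centered at `s`. -/
lemma lintegral_poisson_le {ψ : ℝ → ENNReal} (hψ : AEMeasurable ψ) {s δ y : ℝ} (hδ : 0 < δ)
    (hy : 0 < y) {ε : ENNReal} (h : ∀ r : ℝ, 0 < r → r ≤ δ →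
      ∫⁻ t in Metric.closedBall s r, ψ t ≤ ε * ENNReal.ofReal r) :
    ∫⁻ t in Metric.closedBall s δ, ENNReal.ofReal (y / ((t - s) ^ 2 + y ^ 2)) * ψ t ≤
      8 * ε := by
  set B : ℕ → Set ℝ := fun k => Metric.closedBall s (min (2 ^ k * y) δ) with hB
  set c : ℕ → ENNReal := fun k => ENNReal.ofReal (4 * (1 / 4) ^ k / y) with hc
  have hpt : ∀ t ∈ Metric.closedBall s δ,
      ENNReal.ofReal (y / ((t - s) ^ 2 + y ^ 2)) * ψ t ≤
        ∑' k, c k * (B k).indicator ψ t := by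
    intro t ht
    have ht' : |t - s| ≤ δ := by simpa [Real.dist_eq] using ht
    -- the dyadic shell of `t`: the least `k` with `|t - s| ≤ 2 ^ k * y`
    have hex : ∃ k : ℕ, |t - s| ≤ 2 ^ k * y := by
      obtain ⟨k, hk⟩ := pow_unbounded_of_one_lt (|t - s| / y) (by norm_num : (1 : ℝ) < 2)
      exact ⟨k, ((div_lt_iff₀ hy).1 hk).le⟩
    classical
    set k := Nat.find hex with hk
    have hk1 : |t - s| ≤ 2 ^ k * y := Nat.find_spec hex
    have hmem : t ∈ B k := by
      simp only [hB, Metric.mem_closedBall, Real.dist_eq]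
      exact le_min hk1 ht'
    refine le_trans ?_ (ENNReal.le_tsum k)
    rw [indicator_of_mem hmem]
    gcongr
    refine ENNReal.ofReal_le_ofReal ?_
    rw [← sq_abs (t - s)]
    rcases Nat.eq_zero_or_pos k with h0 | h0
    · rw [h0, div_le_div_iff₀ (by positivity) hy]
      nlinarith [sq_nonneg (|t - s|), sq_nonneg y]
    · have hk2 : 2 ^ (k - 1) * y < |t - s| := not_le.1 (Nat.find_min hex (by omega))
      have e : (2 : ℝ) ^ k = 2 * 2 ^ (k - 1) := by
        rw [← pow_succ']; congr 1; omega
      have h5 : 2 ^ k * y ≤ 2 * |t - s| := by rw [e]; linarith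
      have h6 : (2 ^ k * y) ^ 2 ≤ (2 * |t - s|) ^ 2 := by gcongr
      have e4 : (4 : ℝ) ^ k = (2 ^ k) ^ 2 := by rw [← pow_mul, mul_comm, pow_mul]; norm_num
      rw [one_div, inv_pow, ← div_eq_mul_inv, div_div, div_le_div_iff₀ (by positivity)
        (by positivity), e4]
      nlinarith [sq_nonneg y]
  calc _ ≤ ∫⁻ t in Metric.closedBall s δ, ∑' k, c k * (B k).indicator ψ t :=
        setLIntegral_mono' Metric.isClosed_closedBall.measurableSet hpt
    _ = ∑' k, ∫⁻ t in Metric.closedBall s δ, c k * (B k).indicator ψ t :=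
        lintegral_tsum fun k => ((hψ.restrict.indicator
          Metric.isClosed_closedBall.measurableSet).const_mul _)
    _ ≤ ∑' k : ℕ, 4 * ε * ENNReal.ofReal ((1 / 2) ^ k) := by
        refine ENNReal.tsum_le_tsum fun k => ?_
        rw [lintegral_const_mul' _ _ ENNReal.ofReal_ne_top,
          lintegral_indicator Metric.isClosed_closedBall.measurableSet]
        have h1 : ∫⁻ t in B k, ψ t ∂(volume.restrict (Metric.closedBall s δ)) ≤
            ε * ENNReal.ofReal (2 ^ k * y) := by
          calc _ ≤ ∫⁻ t in B k, ψ t :=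
                lintegral_mono' (Measure.restrict_mono_measure Measure.restrict_le_self _) le_rfl
            _ ≤ ε * ENNReal.ofReal (min (2 ^ k * y) δ) :=
                h _ (lt_min (by positivity) hδ) (min_le_right _ _)
            _ ≤ _ := by gcongr; exact min_le_left _ _
        calc _ ≤ c k * (ε * ENNReal.ofReal (2 ^ k * y)) := by gcongr
          _ = ε * (c k * ENNReal.ofReal (2 ^ k * y)) := by ring
          _ = ε * ENNReal.ofReal (4 * (1 / 2) ^ k) := by
            rw [hc, ← ENNReal.ofReal_mul (by positivity)]
            congr 2
            have : (1 / 4 : ℝ) ^ k * 2 ^ k = (1 / 2) ^ k := by rw [← mul_pow]; norm_num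
            field_simp
            linarith
          _ = 4 * ε * ENNReal.ofReal ((1 / 2) ^ k) := by
            rw [ENNReal.ofReal_mul (by norm_num)]
            norm_num
            ring
          _ ≤ _ := le_rfl
    _ = 8 * ε := by
        rw [ENNReal.tsum_mul_left, ← ENNReal.ofReal_tsum_of_nonneg (fun k => by positivity)
          summable_geometric_two, tsum_geometric_two]
        norm_num
        ring

/-- At almost every point, the Poisson integral of the oscillation of an integrable function
tends to zero. -/
lemma ae_tendsto_poisson {H : ℝ → ℂ} (hH : Integrable H) (b : ℝ) :
    ∀ᵐ s : ℝ, Tendsto (fun y : ℝ =>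
      ∫ t in Ioc 0 b, y / ((t - s) ^ 2 + y ^ 2) * ‖H t - H s‖) (𝓝[>] 0) (𝓝 0) := by
  filter_upwards [IsUnifLocDoublingMeasure.ae_tendsto_average_norm_sub (μ := volume)
    hH.locallyIntegrable 1] with s hs
  have hleb : Tendsto (fun r : ℝ => ⨍ t in Metric.closedBall s r, ‖H t - H s‖) (𝓝[>] 0) (𝓝 0) :=
    hs (fun _ => s) id tendsto_id (by
      filter_upwards [self_mem_nhdsWithin] with r hr
      simpa using (le_of_lt hr : (0 : ℝ) ≤ r))
  have hli : LocallyIntegrable (fun t => ‖H t - H s‖) :=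
    by
    have h := hH.locallyIntegrable.sub (locallyIntegrable_const (H s))
    exact fun x => (h x).norm
  have hψm : AEMeasurable (fun t => ‖H t - H s‖ₑ) :=
    (hH.aestronglyMeasurable.sub aestronglyMeasurable_const).enorm
  set ψ : ℝ → ENNReal := fun t => ‖H t - H s‖ₑ with hψ
  have hfin : ∫⁻ t in Ioc 0 b, ψ t ≠ ⊤ := by
    have : IntegrableOn (fun t => H t - H s) (Ioc 0 b) :=
      hH.integrableOn.sub (integrableOn_const (by simp))
    exact this.2.ne
  -- the same convergence for the lower integral
  have key : Tendsto (fun y : ℝ => ∫⁻ t in Ioc 0 b,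
      ENNReal.ofReal (y / ((t - s) ^ 2 + y ^ 2)) * ψ t) (𝓝[>] 0) (𝓝 0) := by
    rw [ENNReal.tendsto_nhds_zero]
    intro ε hε
    rcases eq_or_ne ε ⊤ with rfl | hεt
    · simp
    set η := ε.toReal / 32 with hη
    have hη0 : 0 < η := by have := ENNReal.toReal_pos hε.ne' hεt; positivity
    obtain ⟨δ, hδ0, hδ⟩ : ∃ δ : ℝ, 0 < δ ∧ ∀ r : ℝ, 0 < r → r ≤ δ →
        ∫⁻ t in Metric.closedBall s r, ψ t ≤ ENNReal.ofReal (2 * η) * ENNReal.ofReal r := by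
      have := (tendsto_order.1 hleb).2 η hη0
      rw [eventually_nhdsWithin_iff, Metric.eventually_nhds_iff] at this
      obtain ⟨δ, hδ0, hδ⟩ := this
      refine ⟨δ / 2, by positivity, fun r hr hrδ => ?_⟩
      have h1 := hδ (y := r) (by rw [Real.dist_eq, sub_zero, abs_of_pos hr]; linarith) hr
      rw [setAverage_eq, measureReal_def, Real.volume_closedBall,
        ENNReal.toReal_ofReal (by positivity), smul_eq_mul, inv_mul_eq_div,
        div_lt_iff₀ (by positivity)] at h1
      have hi : IntegrableOn (fun t => ‖H t - H s‖) (Metric.closedBall s r) :=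
        hli.integrableOn_isCompact (isCompact_closedBall s r)
      have h2 := ofReal_integral_eq_lintegral_ofReal hi (Eventually.of_forall fun t => norm_nonneg _)
      simp only [ofReal_norm] at h2
      rw [← ENNReal.ofReal_mul (by positivity), hψ, ← h2]
      apply ENNReal.ofReal_le_ofReal
      linarith
    have hlim : Tendsto (fun y : ℝ => ENNReal.ofReal (y / δ ^ 2) * ∫⁻ t in Ioc 0 b, ψ t)
        (𝓝[>] 0) (𝓝 0) := by
      have h1 : Tendsto (fun y : ℝ => ENNReal.ofReal (y / δ ^ 2)) (𝓝[>] 0) (𝓝 0) := by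
        have : ContinuousAt (fun y : ℝ => ENNReal.ofReal (y / δ ^ 2)) 0 :=
          (ENNReal.continuous_ofReal.comp (by fun_prop)).continuousAt
        have h3 := this.tendsto
        simp only [zero_div, ENNReal.ofReal_zero] at h3
        exact h3.mono_left nhdsWithin_le_nhds
      simpa using ENNReal.Tendsto.mul_const h1 (Or.inr hfin)
    have hε2 : 0 < ε / 2 := ENNReal.half_pos hε.ne'
    filter_upwards [ENNReal.tendsto_nhds_zero.1 hlim _ hε2, self_mem_nhdsWithin] with y hy hy0
    have hy0' : 0 < y := hy0
    have hsub : Ioc 0 b ⊆ Metric.closedBall s δ ∪ (Ioc 0 b \ Metric.closedBall s δ) := by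
      intro t ht; by_cases h : t ∈ Metric.closedBall s δ
      · exact Or.inl h
      · exact Or.inr ⟨ht, h⟩
    calc _ ≤ ∫⁻ t in Metric.closedBall s δ ∪ (Ioc 0 b \ Metric.closedBall s δ),
          ENNReal.ofReal (y / ((t - s) ^ 2 + y ^ 2)) * ψ t := lintegral_mono_set hsub
      _ ≤ _ := lintegral_union_le _ _ _
      _ ≤ 8 * ENNReal.ofReal (2 * η) + ε / 2 := by
        refine add_le_add (lintegral_poisson_le hψm hδ0 hy0 hδ) (le_trans ?_ hy)
        calc _ ≤ ∫⁻ t in Ioc 0 b \ Metric.closedBall s δ, ENNReal.ofReal (y / δ ^ 2) * ψ t := by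
              refine setLIntegral_mono' (measurableSet_Ioc.diff
                Metric.isClosed_closedBall.measurableSet) fun t ht => ?_
              gcongr
              have : δ < |t - s| := by simpa [Real.dist_eq] using ht.2
              rw [← sq_abs (t - s)]
              nlinarith
          _ ≤ ∫⁻ t in Ioc 0 b, ENNReal.ofReal (y / δ ^ 2) * ψ t := lintegral_mono_set sdiff_subset
          _ = _ := lintegral_const_mul' _ _ ENNReal.ofReal_ne_top
      _ = ε := by
        have : (8 : ENNReal) * ENNReal.ofReal (2 * η) = ε / 2 := by
          rw [show (8 : ENNReal) = ENNReal.ofReal 8 by norm_num,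
            ← ENNReal.ofReal_mul (by norm_num), hη,
            show 8 * (2 * (ε.toReal / 32)) = ε.toReal / 2 by ring,
            ENNReal.ofReal_div_of_pos (by norm_num), ENNReal.ofReal_toReal hεt]
          norm_num
        rw [this, ENNReal.add_halves]
  have := (ENNReal.tendsto_toReal ENNReal.zero_ne_top).comp key
  refine (this.congr' ?_)
  filter_upwards [self_mem_nhdsWithin] with y hy
  have hy0 : 0 < y := hy
  rw [integral_eq_lintegral_of_nonneg_ae (Eventually.of_forall fun t => by positivity)]
  · simp only [Function.comp_apply]
    congr 1
    refine lintegral_congr fun t => ?_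
    rw [ENNReal.ofReal_mul (by positivity), ofReal_norm]
  · refine AEStronglyMeasurable.mul (Measurable.aestronglyMeasurable (by fun_prop)) ?_
    exact hli.aestronglyMeasurable.restrict

/-- The open cone with real vertex `s` and axis `i`, of aperture `a`. -/
def upperCone (s a : ℝ) : Set ℂ := {w | a * ‖w - s‖ < w.im}

lemma upperCone_subset (s : ℝ) (a : ℝ) : upperCone s a ⊆ doubleCone s a :=
  fun w hw => lt_of_lt_of_le (show a * ‖w - s‖ < w.im from hw) (le_abs_self _)

lemma im_pos_of_mem_upperCone {s a : ℝ} (ha : 0 < a) {w : ℂ} (hw : w ∈ upperCone s a) :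
    0 < w.im := lt_of_le_of_lt (by positivity) (show a * ‖w - s‖ < w.im from hw)

lemma conj_mem_doubleCone {s a : ℝ} {w : ℂ} (hw : w ∈ doubleCone s a) :
    (starRingEnd ℂ) w ∈ doubleCone s a := by
  have h : a * ‖w - s‖ < |w.im| := hw
  have : ‖(starRingEnd ℂ) w - s‖ = ‖w - s‖ := by
    rw [← Complex.norm_conj (w - s), map_sub, Complex.conj_ofReal]
  simpa [doubleCone, this] using h

lemma tendsto_conj_doubleCone (s a : ℝ) :
    Tendsto (starRingEnd ℂ) (𝓝[upperCone s a] (s : ℂ)) (𝓝[doubleCone s a] (s : ℂ)) := by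
  refine tendsto_nhdsWithin_iff.2 ⟨?_, ?_⟩
  · have : Tendsto (starRingEnd ℂ) (𝓝 (s : ℂ)) (𝓝 ((starRingEnd ℂ) (s : ℂ))) :=
      Complex.continuous_conj.continuousAt
    rw [Complex.conj_ofReal] at this
    exact this.mono_left nhdsWithin_le_nhds
  · filter_upwards [self_mem_nhdsWithin] with w hw
    exact conj_mem_doubleCone (upperCone_subset s a hw)

/-- The imaginary part tends to `0` from above in an upper cone. -/
lemma tendsto_im_upperCone {s a : ℝ} (ha : 0 < a) :
    Tendsto Complex.im (𝓝[upperCone s a] (s : ℂ)) (𝓝[>] 0) := by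
  refine tendsto_nhdsWithin_iff.2 ⟨?_, ?_⟩
  · have := (Complex.continuous_im.continuousAt (x := (s : ℂ))).tendsto
    rw [Complex.ofReal_im] at this
    exact this.mono_left nhdsWithin_le_nhds
  · filter_upwards [self_mem_nhdsWithin] with w hw
    exact im_pos_of_mem_upperCone ha hw

/-- The Cauchy kernels at mirror points differ by a multiple of the Poisson kernel. -/
lemma line_kernel_sub (t : ℝ) {w : ℂ} (hw : w.im ≠ 0) :
    1 / ((t : ℂ) - w) - 1 / ((t : ℂ) - (starRingEnd ℂ) w) =
      ((w.im / ((t - w.re) ^ 2 + w.im ^ 2) : ℝ) : ℂ) * (2 * Complex.I) := by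
  have h1 : (t : ℂ) - w ≠ 0 := fun h => hw (by simpa using congrArg Complex.im h)
  have h2 : (t : ℂ) - (starRingEnd ℂ) w ≠ 0 := fun h => hw (by simpa using congrArg Complex.im h)
  have h3 : (((t - w.re) ^ 2 + w.im ^ 2 : ℝ) : ℂ) = ((t : ℂ) - w) * (t - (starRingEnd ℂ) w) := by
    push_cast
    apply Complex.ext
    · simp [pow_two]
    · simp [pow_two]; ring
  rw [div_sub_div _ _ h1 h2, Complex.ofReal_div, h3, div_mul_eq_mul_div]
  congr 1
  apply Complex.ext <;> simp <;> ring

/-- The Poisson integral of the constant function over an interval, in closed form. -/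
lemma integral_poisson_one {b y : ℝ} (x : ℝ) (hy : 0 < y) :
    ∫ t in (0 : ℝ)..b, y / ((t - x) ^ 2 + y ^ 2) =
      Real.arctan ((b - x) / y) + Real.arctan (x / y) := by
  have hd : ∀ t : ℝ, HasDerivAt (fun t => Real.arctan ((t - x) / y))
      (y / ((t - x) ^ 2 + y ^ 2)) t := by
    intro t
    have := (((hasDerivAt_id t).sub_const x).div_const y).arctan
    convert this using 1
    simp only [id]
    have : y ^ 2 + (t - x) ^ 2 ≠ 0 := by positivity
    field_simp
    simp only [id]
    ring
  rw [intervalIntegral.integral_eq_sub_of_hasDerivAt (fun t _ => hd t)]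
  · simp only [zero_sub, neg_div, Real.arctan_neg, sub_neg_eq_add]
  · apply Continuous.intervalIntegrable
    refine Continuous.div continuous_const (by fun_prop) fun t => by positivity

/-- **Plemelj jump relation on a segment**, in symmetric form, at Lebesgue points. -/
lemma ae_tendsto_line_jump {H : ℝ → ℂ} (hH : Integrable H) (b : ℝ) :
    ∀ᵐ s : ℝ, s ∈ Ioo 0 b → ∀ a : ℝ, 0 < a → Tendsto (fun w : ℂ =>
        (∫ t in (0 : ℝ)..b, 1 / ((t : ℂ) - w) * H t) -
          ∫ t in (0 : ℝ)..b, 1 / ((t : ℂ) - (starRingEnd ℂ) w) * H t)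
      (𝓝[upperCone s a] (s : ℂ)) (𝓝 (2 * Real.pi * Complex.I * H s)) := by
  filter_upwards [ae_tendsto_poisson hH b] with s hs hsb a ha
  have hb : 0 ≤ b := (hsb.1.trans hsb.2).le
  have hone : Tendsto (fun w : ℂ => ((∫ t in (0 : ℝ)..b,
      w.im / ((t - w.re) ^ 2 + w.im ^ 2) : ℝ) : ℂ)) (𝓝[upperCone s a] (s : ℂ))
      (𝓝 (Real.pi : ℂ)) := by
    refine (Complex.continuous_ofReal.tendsto _).comp ?_
    have hre : Tendsto Complex.re (𝓝[upperCone s a] (s : ℂ)) (𝓝 s) := by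
      have := (Complex.continuous_re.continuousAt (x := (s : ℂ))).tendsto
      rw [Complex.ofReal_re] at this
      exact this.mono_left nhdsWithin_le_nhds
    have hinv := tendsto_inv_nhdsGT_zero.comp (tendsto_im_upperCone (s := s) ha)
    have h1 : Tendsto (fun w : ℂ => (b - w.re) / w.im) (𝓝[upperCone s a] (s : ℂ)) atTop :=
      Tendsto.pos_mul_atTop (sub_pos.2 hsb.2) (hre.const_sub b) hinv
    have h2 : Tendsto (fun w : ℂ => w.re / w.im) (𝓝[upperCone s a] (s : ℂ)) atTop :=
      Tendsto.pos_mul_atTop hsb.1 hre hinv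
    have h3 := (tendsto_nhds_of_tendsto_nhdsWithin (Real.tendsto_arctan_atTop.comp h1)).add
      (tendsto_nhds_of_tendsto_nhdsWithin (Real.tendsto_arctan_atTop.comp h2))
    rw [add_halves] at h3
    refine h3.congr' ?_
    filter_upwards [self_mem_nhdsWithin] with w hw
    exact (integral_poisson_one w.re (im_pos_of_mem_upperCone ha hw)).symm
  -- in the cone, the Poisson kernel at `w` is dominated by the one at `s + i w.im`
  have hker : ∀ w ∈ upperCone s a, ∀ t : ℝ,
      w.im / ((t - w.re) ^ 2 + w.im ^ 2) ≤
        ((1 + a⁻¹) ^ 2 + 1) * (w.im / ((t - s) ^ 2 + w.im ^ 2)) := by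
    intro w hw t
    have hy := im_pos_of_mem_upperCone ha hw
    obtain ⟨-, -, h2⟩ := doubleCone_bounds ha (upperCone_subset s a hw) t
    have e : ‖(t : ℂ) - w‖ ^ 2 = (t - w.re) ^ 2 + w.im ^ 2 := by
      rw [← Complex.normSq_eq_norm_sq, Complex.normSq_apply]
      simp; ring
    have h3 : |t - s| ^ 2 ≤ (1 + a⁻¹) ^ 2 * ((t - w.re) ^ 2 + w.im ^ 2) := by
      rw [← e, ← mul_pow]; gcongr
    rw [sq_abs] at h3
    rw [mul_div_assoc', div_le_div_iff₀ (by positivity) (by positivity)]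
    have : (t - s) ^ 2 + w.im ^ 2 ≤ ((1 + a⁻¹) ^ 2 + 1) * ((t - w.re) ^ 2 + w.im ^ 2) := by
      nlinarith [sq_nonneg (t - w.re)]
    nlinarith
  have hosc : Tendsto (fun w : ℂ => ∫ t in (0 : ℝ)..b,
      ((w.im / ((t - w.re) ^ 2 + w.im ^ 2) : ℝ) : ℂ) * (H t - H s))
      (𝓝[upperCone s a] (s : ℂ)) (𝓝 0) := by
    have h0 := (hs.comp (tendsto_im_upperCone (s := s) ha)).const_mul ((1 + a⁻¹) ^ 2 + 1)
    rw [mul_zero] at h0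
    refine squeeze_zero_norm' ?_ h0
    filter_upwards [self_mem_nhdsWithin] with w hw
    have hy := im_pos_of_mem_upperCone ha hw
    rw [intervalIntegral.integral_of_le hb, Function.comp_apply, ← integral_const_mul]
    refine norm_integral_le_of_norm_le ?_ (Eventually.of_forall fun t => ?_)
    · have hi : Integrable (fun t => ‖H t - H s‖) (volume.restrict (Ioc 0 b)) :=
        (hH.integrableOn.sub (integrableOn_const (by simp))).norm
      refine Integrable.const_mul (Integrable.bdd_mul (c := w.im / w.im ^ 2) hi
        (Measurable.aestronglyMeasurable (by fun_prop)) (Eventually.of_forall fun t => ?_)) _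
      rw [Real.norm_of_nonneg (by positivity)]
      gcongr
      nlinarith [sq_nonneg (t - s)]
    · rw [norm_mul, Complex.norm_real, Real.norm_of_nonneg (by positivity), ← mul_assoc]
      gcongr
      exact hker w hw t
  have hsum := (hosc.add (hone.mul_const (H s))).mul_const (2 * Complex.I)
  have e : (0 + (Real.pi : ℂ) * H s) * (2 * Complex.I) = 2 * Real.pi * Complex.I * H s := by ring
  rw [e] at hsum
  refine hsum.congr' ?_
  filter_upwards [self_mem_nhdsWithin] with w hw
  have hy := im_pos_of_mem_upperCone ha hw
  have hHi : IntervalIntegrable H volume 0 b := hH.intervalIntegrable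
  have hcont : Continuous fun t : ℝ => w.im / ((t - w.re) ^ 2 + w.im ^ 2) :=
    Continuous.div continuous_const (by fun_prop) fun t => by positivity
  have hcont' : Continuous fun t : ℝ => ((w.im / ((t - w.re) ^ 2 + w.im ^ 2) : ℝ) : ℂ) :=
    Complex.continuous_ofReal.comp hcont
  have hne : ∀ z : ℂ, z.im ≠ 0 → Continuous fun t : ℝ => 1 / ((t : ℂ) - z) := fun z hz =>
    Continuous.div continuous_const (by fun_prop)
      fun t h => hz (by simpa using congrArg Complex.im h)
  rw [← intervalIntegral.integral_ofReal, ← intervalIntegral.integral_mul_const,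
    ← intervalIntegral.integral_add, ← intervalIntegral.integral_mul_const,
    ← intervalIntegral.integral_sub]
  · refine intervalIntegral.integral_congr fun t _ => ?_
    rw [← sub_mul, line_kernel_sub t hy.ne']
    ring
  · exact hHi.continuousOn_mul (hne w hy.ne').continuousOn
  · exact hHi.continuousOn_mul (hne _ (by simpa using hy.ne')).continuousOn
  · exact (hHi.sub (by simp)).continuousOn_mul hcont'.continuousOn
  · exact (hcont'.mul continuous_const).intervalIntegrable _ _

/-! ### The Hardy projection and the Cauchy integral on a model circle -/

/-- The unit circle, parametrized with constant speed over a period `T`. -/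
noncomputable def modelCircle (T : ℝ) (t : ℝ) : ℂ := Complex.exp (2 * Real.pi * Complex.I * t / T)

lemma norm_modelCircle (T t : ℝ) : ‖modelCircle T t‖ = 1 := by
  have : 2 * Real.pi * Complex.I * t / T = ((2 * Real.pi * t / T : ℝ) : ℂ) * Complex.I := by
    push_cast; ring
  rw [modelCircle, this, Complex.norm_exp_ofReal_mul_I]

lemma modelCircle_ne_zero (T t : ℝ) : modelCircle T t ≠ 0 := Complex.exp_ne_zero _

lemma hasDerivAt_modelCircle (T t : ℝ) :
    HasDerivAt (modelCircle T) (2 * Real.pi * Complex.I / T * modelCircle T t) t := by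
  have h := (((Complex.ofRealCLM.hasDerivAt (x := t)).const_mul
    (2 * Real.pi * Complex.I)).div_const (T : ℂ)).cexp
  simp only [Complex.ofRealCLM_apply, Complex.ofReal_one, mul_one] at h
  rw [mul_comm]
  exact h

lemma deriv_modelCircle (T t : ℝ) :
    deriv (modelCircle T) t = 2 * Real.pi * Complex.I / T * modelCircle T t :=
  (hasDerivAt_modelCircle T t).deriv

lemma contDiff_modelCircle (T : ℝ) : ContDiff ℝ 2 (modelCircle T) := by
  unfold modelCircle
  have : ContDiff ℝ 2 (fun t : ℝ => (t : ℂ)) := Complex.ofRealCLM.contDiff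
  fun_prop

lemma continuous_modelCircle (T : ℝ) : Continuous (modelCircle T) :=
  (contDiff_modelCircle T).continuous

lemma fourier_eq_modelCircle_zpow (T : ℝ) (n : ℤ) (t : ℝ) :
    fourier n (t : AddCircle T) = modelCircle T t ^ n := by
  rw [fourier_coe_apply, modelCircle, ← Complex.exp_int_mul]
  congr 1; ring

lemma modelCircle_injOn {T s t : ℝ} (hT : 0 < T) (hst : |t - s| < T)
    (h : modelCircle T t = modelCircle T s) : t = s := by
  rw [modelCircle, modelCircle, Complex.exp_eq_exp_iff_exists_int] at h
  obtain ⟨n, hn⟩ := h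
  have hT' : (T : ℂ) ≠ 0 := by exact_mod_cast hT.ne'
  have h1 : (t : ℂ) = s + n * T := by
    have h2pi : 2 * (Real.pi : ℂ) * Complex.I ≠ 0 := Complex.two_pi_I_ne_zero
    field_simp at hn
    linear_combination hn
  have h2 : t = s + n * T := by exact_mod_cast h1
  have h3 : |(n : ℝ)| * T < 1 * T := by
    rw [one_mul]
    calc |(n : ℝ)| * T = |t - s| := by rw [h2, add_sub_cancel_left, abs_mul, abs_of_pos hT]
      _ < T := hst
  have h4 := lt_of_mul_lt_mul_right h3 hT.le
  have h5 : |n| < 1 := by exact_mod_cast h4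
  rw [Int.abs_lt_one_iff] at h5
  rw [h2, h5]; simp

/-- The Hardy projection of a square integrable function on a period: the part carried by the
nonnegative frequencies. -/
lemma exists_hardy_projection {T : ℝ} (hT : 0 < T) {f : ℝ → ℂ}
    (hf : MemLp f 2 (volume.restrict (Ioc 0 T))) :
    ∃ g : ℝ → ℂ, MemLp g 2 (volume.restrict (Ioc 0 T)) ∧
      eLpNorm g 2 (volume.restrict (Ioc 0 T)) ≤ eLpNorm f 2 (volume.restrict (Ioc 0 T)) ∧
      (∀ k : ℕ, ∫ t in (0 : ℝ)..T, (modelCircle T t)⁻¹ ^ k * (f t - g t) = 0) ∧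
      ∀ k : ℕ, ∫ t in (0 : ℝ)..T, modelCircle T t ^ (k + 1) * g t = 0 := by
  have : Fact (0 < T) := ⟨hT⟩
  have hmp := AddCircle.measurePreserving_mk T 0
  rw [zero_add] at hmp
  have hF0 : MemLp (AddCircle.liftIoc T 0 f) 2 := MemLp.memLp_liftIoc (by rwa [zero_add])
  have hFh := hF0.haarAddCircle
  set F := hFh.toLp with hF
  set U : Submodule ℂ (Lp ℂ 2 (AddCircle.haarAddCircle (T := T))) :=
    (Submodule.span ℂ (fourierLp 2 '' {n : ℤ | 0 ≤ n})).topologicalClosure with hU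
  have : CompleteSpace U := Submodule.topologicalClosure.completeSpace _
  set G := U.starProjection F with hG
  have hGm : MemLp (G : AddCircle T → ℂ) 2 := (Lp.memLp G).of_haarAddCircle
  have hlift : ∀ t ∈ Ioc 0 T, AddCircle.liftIoc T 0 f (t : AddCircle T) = f t := fun t ht =>
    AddCircle.liftIoc_coe_apply (by rwa [zero_add])
  have hfF : (fun t : ℝ => F (t : AddCircle T)) =ᵐ[volume.restrict (Ioc 0 T)] f := by
    have h1 : (F : AddCircle T → ℂ) =ᵐ[volume] AddCircle.liftIoc T 0 f := by
      have := hFh.coeFn_toLp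
      rw [AddCircle.volume_eq_smul_haarAddCircle]
      exact Measure.ae_smul_measure this _
    filter_upwards [hmp.quasiMeasurePreserving.ae_eq h1, ae_restrict_mem measurableSet_Ioc]
      with t ht htm
    exact ht.trans (hlift t htm)
  have hnorm : ∀ X : AddCircle T → ℂ, AEStronglyMeasurable X volume →
      eLpNorm (fun t : ℝ => X (t : AddCircle T)) 2 (volume.restrict (Ioc 0 T)) =
        ENNReal.ofReal T ^ (1 / (2 : ENNReal)).toReal *
          eLpNorm X 2 (AddCircle.haarAddCircle (T := T)) := by
    intro X hX
    have := eLpNorm_comp_measurePreserving (p := 2) hX hmp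
    rw [Function.comp_def] at this
    rw [this, AddCircle.volume_eq_smul_haarAddCircle, eLpNorm_smul_measure_of_ne_zero
      (by simpa using hT), smul_eq_mul]
  have hcoef : ∀ (X : Lp ℂ 2 (AddCircle.haarAddCircle (T := T))) (n : ℤ),
      inner ℂ (fourierLp 2 n) X = (0 : ℂ) →
        ∫ t in (0 : ℝ)..T, modelCircle T t ^ (-n) * X (t : AddCircle T) = 0 := by
    intro X n hn
    have h1 : fourierCoeff X n = 0 := by
      rw [← fourierBasis_repr, fourierBasis.repr_apply_apply, coe_fourierBasis, hn]
    rw [fourierCoeff_eq_intervalIntegral X n 0, zero_add, smul_eq_zero] at h1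
    have h2 := h1.resolve_left (by positivity)
    simpa only [fourier_eq_modelCircle_zpow, smul_eq_mul] using h2
  refine ⟨fun t => G (t : AddCircle T), hGm.comp_measurePreserving hmp, ?_, fun k => ?_,
    fun k => ?_⟩
  · rw [← eLpNorm_congr_ae hfF, hnorm _ hGm.aestronglyMeasurable,
      hnorm _ (Lp.memLp F).of_haarAddCircle.aestronglyMeasurable]
    gcongr
    have h := U.norm_starProjection_apply_le F
    rw [Lp.norm_def, Lp.norm_def] at h
    exact (ENNReal.toReal_le_toReal (Lp.memLp G).eLpNorm_ne_top (Lp.memLp F).eLpNorm_ne_top).1 h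
  · have hk : fourierLp 2 (k : ℤ) ∈ U := Submodule.le_topologicalClosure _
      (Submodule.subset_span ⟨k, Int.natCast_nonneg k, rfl⟩)
    have h1 : inner ℂ (fourierLp 2 (k : ℤ)) (F - G) = (0 : ℂ) :=
      Submodule.inner_right_of_mem_orthogonal hk (U.sub_starProjection_mem_orthogonal F)
    rw [← hcoef (F - G) k h1]
    refine intervalIntegral.integral_congr_ae_restrict ?_
    rw [uIoc_of_le hT.le]
    have h2 : ((F - G : Lp ℂ 2 AddCircle.haarAddCircle) : AddCircle T → ℂ) =ᵐ[volume]
        fun x => F x - G x := by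
      rw [AddCircle.volume_eq_smul_haarAddCircle]
      exact Measure.ae_smul_measure (Lp.coeFn_sub F G) _
    filter_upwards [hfF, hmp.quasiMeasurePreserving.ae_eq h2] with t ht1 ht2
    have ht2' : (F - G : Lp ℂ 2 AddCircle.haarAddCircle) (t : AddCircle T) =
      F (t : AddCircle T) - G (t : AddCircle T) := ht2
    rw [ht2', ht1, zpow_neg, zpow_natCast, inv_pow]
  · have hperp : fourierLp 2 (-(k + 1 : ℤ)) ∈ Uᗮ := by
      rw [hU, Submodule.orthogonal_closure, Submodule.mem_orthogonal]
      intro u hu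
      induction hu using Submodule.span_induction with
      | mem x hx =>
        obtain ⟨n, hn, rfl⟩ := hx
        refine orthonormal_fourier.2 ?_
        have : (0 : ℤ) ≤ n := hn
        omega
      | zero => simp
      | add x y _ _ hx hy => rw [inner_add_left, hx, hy, add_zero]
      | smul c x _ hx => rw [inner_smul_left, hx, mul_zero]
    have h1 := Submodule.inner_left_of_mem_orthogonal (U.starProjection_apply_mem F) hperp
    have h2 := hcoef G _ h1
    rw [neg_neg] at h2
    exact_mod_cast h2

/-- A density without nonnegative frequencies has vanishing Cauchy integral inside the circle. -/
lemma modelCircle_cauchy_eq_zero_inside {T : ℝ} (hT : 0 < T) {h : ℝ → ℂ}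
    (hh : IntervalIntegrable h volume 0 T)
    (h0 : ∀ k : ℕ, ∫ t in (0 : ℝ)..T, (modelCircle T t)⁻¹ ^ k * h t = 0) {ω : ℂ} (hω : ‖ω‖ < 1) :
    ∫ t in (0 : ℝ)..T, deriv (modelCircle T) t / (modelCircle T t - ω) * h t = 0 := by
  have hc := continuous_modelCircle T
  have hci : Continuous fun t => (modelCircle T t)⁻¹ := hc.inv₀ (modelCircle_ne_zero T)
  have key : HasSum (fun k : ℕ => ∫ t in (0 : ℝ)..T,
      2 * Real.pi * Complex.I / T * ω ^ k * ((modelCircle T t)⁻¹ ^ k * h t))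
      (∫ t in (0 : ℝ)..T, deriv (modelCircle T) t / (modelCircle T t - ω) * h t) := by
    refine intervalIntegral.hasSum_integral_of_dominated_convergence
      (fun k t => 2 * Real.pi / T * ‖h t‖ * ‖ω‖ ^ k) (fun k => ?_) (fun k => ?_) ?_ ?_ ?_
    · exact (((hci.pow k).aestronglyMeasurable.restrict).mul
        hh.def'.aestronglyMeasurable).const_mul _
    · refine Eventually.of_forall fun t _ => le_of_eq ?_
      simp only [norm_mul, norm_pow, norm_inv, norm_modelCircle, norm_div, Complex.norm_I,
        Complex.norm_real, inv_one, one_pow, one_mul, mul_one, Real.norm_of_nonneg hT.le,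
        Real.norm_of_nonneg Real.pi_pos.le, Complex.norm_ofNat]
      ring
    · exact Eventually.of_forall fun t _ => (summable_geometric_of_lt_one (norm_nonneg _) hω).mul_left _
    · simp only [tsum_mul_left]
      exact (hh.norm.const_mul _).mul_const _
    · refine Eventually.of_forall fun t _ => ?_
      have hx : ‖ω * (modelCircle T t)⁻¹‖ < 1 := by
        rwa [norm_mul, norm_inv, norm_modelCircle, inv_one, mul_one]
      have h1 := ((hasSum_geometric_of_norm_lt_one hx).mul_left
        (2 * Real.pi * Complex.I / T)).mul_right (h t)
      have hne : 1 - ω * (modelCircle T t)⁻¹ ≠ 0 := fun h => by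
        rw [← sub_eq_zero.1 h, norm_one] at hx; exact lt_irrefl _ hx
      have hz := modelCircle_ne_zero T t
      have e : deriv (modelCircle T) t / (modelCircle T t - ω) =
          2 * Real.pi * Complex.I / T * (1 - ω * (modelCircle T t)⁻¹)⁻¹ := by
        have e' : modelCircle T t - ω = modelCircle T t * (1 - ω * (modelCircle T t)⁻¹) := by
          field_simp
        rw [deriv_modelCircle, e', div_eq_mul_inv, mul_inv]
        calc _ = 2 * Real.pi * Complex.I / T * (modelCircle T t * (modelCircle T t)⁻¹) *
              (1 - ω * (modelCircle T t)⁻¹)⁻¹ := by ring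
          _ = _ := by rw [mul_inv_cancel₀ hz, mul_one]
      rw [e]
      exact HasSum.congr_fun h1 fun k => by rw [mul_pow]; ring
  refine key.unique ?_
  have : ∀ k : ℕ, ∫ t in (0 : ℝ)..T,
      2 * Real.pi * Complex.I / T * ω ^ k * ((modelCircle T t)⁻¹ ^ k * h t) = 0 := fun k => by
    rw [intervalIntegral.integral_const_mul, h0, mul_zero]
  simp only [this]
  exact hasSum_zero

/-- A density without negative frequencies has vanishing Cauchy integral outside the circle. -/
lemma modelCircle_cauchy_eq_zero_outside {T : ℝ} (hT : 0 < T) {h : ℝ → ℂ}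
    (hh : IntervalIntegrable h volume 0 T)
    (h0 : ∀ k : ℕ, ∫ t in (0 : ℝ)..T, modelCircle T t ^ (k + 1) * h t = 0) {ω : ℂ}
    (hω : 1 < ‖ω‖) :
    ∫ t in (0 : ℝ)..T, deriv (modelCircle T) t / (modelCircle T t - ω) * h t = 0 := by
  have hc := continuous_modelCircle T
  have hω0 : ω ≠ 0 := norm_pos_iff.1 (by linarith)
  have hω1 : ‖ω⁻¹‖ < 1 := by rw [norm_inv]; exact inv_lt_one_of_one_lt₀ hω
  have key : HasSum (fun k : ℕ => ∫ t in (0 : ℝ)..T,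
      -(2 * Real.pi * Complex.I / T) * ω⁻¹ ^ (k + 1) * (modelCircle T t ^ (k + 1) * h t))
      (∫ t in (0 : ℝ)..T, deriv (modelCircle T) t / (modelCircle T t - ω) * h t) := by
    refine intervalIntegral.hasSum_integral_of_dominated_convergence
      (fun k t => 2 * Real.pi / T * ‖h t‖ * ‖ω⁻¹‖ ^ (k + 1)) (fun k => ?_) (fun k => ?_) ?_ ?_ ?_
    · exact (((hc.pow _).aestronglyMeasurable.restrict).mul
        hh.def'.aestronglyMeasurable).const_mul _
    · refine Eventually.of_forall fun t _ => le_of_eq ?_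
      simp only [norm_mul, norm_pow, norm_neg, norm_modelCircle, norm_div, Complex.norm_I,
        Complex.norm_real, one_pow, one_mul, mul_one, Real.norm_of_nonneg hT.le,
        Real.norm_of_nonneg Real.pi_pos.le, Complex.norm_ofNat]
      ring
    · exact Eventually.of_forall fun t _ => ((summable_nat_add_iff 1).2
        (summable_geometric_of_lt_one (norm_nonneg _) hω1)).mul_left _
    · simp only [tsum_mul_left]
      exact (hh.norm.const_mul _).mul_const _
    · refine Eventually.of_forall fun t _ => ?_
      have hx : ‖ω⁻¹ * modelCircle T t‖ < 1 := by
        rwa [norm_mul, norm_modelCircle, mul_one]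
      have h1 := ((hasSum_geometric_of_norm_lt_one hx).mul_left
        (-(2 * Real.pi * Complex.I / T) * (ω⁻¹ * modelCircle T t))).mul_right (h t)
      have hne : 1 - ω⁻¹ * modelCircle T t ≠ 0 := fun h => by
        rw [← sub_eq_zero.1 h, norm_one] at hx; exact lt_irrefl _ hx
      have e : deriv (modelCircle T) t / (modelCircle T t - ω) =
          -(2 * Real.pi * Complex.I / T) * (ω⁻¹ * modelCircle T t) *
            (1 - ω⁻¹ * modelCircle T t)⁻¹ := by
        have e' : modelCircle T t - ω = -ω * (1 - ω⁻¹ * modelCircle T t) := by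
          field_simp; ring
        rw [deriv_modelCircle, e', div_eq_mul_inv, mul_inv, inv_neg]
        ring
      rw [e]
      exact HasSum.congr_fun h1 fun k => by rw [mul_pow, pow_succ, pow_succ]; ring
  refine key.unique ?_
  have : ∀ k : ℕ, ∫ t in (0 : ℝ)..T,
      -(2 * Real.pi * Complex.I / T) * ω⁻¹ ^ (k + 1) * (modelCircle T t ^ (k + 1) * h t) = 0 :=
    fun k => by rw [intervalIntegral.integral_const_mul, h0, mul_zero]
  simp only [this]
  exact hasSum_zero

/-- Points just above the real axis have tangential images inside the unit circle, and their
conjugates have images outside. -/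
lemma eventually_modelCircle_sides {T a : ℝ} (hT : 0 < T) (ha : 0 < a) (s : ℝ) :
    ∀ᶠ w in 𝓝[upperCone s a] (s : ℂ),
      ‖modelCircle T s + deriv (modelCircle T) s * (w - s)‖ < 1 ∧
      1 < ‖modelCircle T s + deriv (modelCircle T) s * ((starRingEnd ℂ) w - s)‖ := by
  have hball : ∀ᶠ w : ℂ in 𝓝[upperCone s a] (s : ℂ), ‖w - s‖ < a * T / Real.pi := by
    have := nhdsWithin_le_nhds (a := (s : ℂ)) (s := upperCone s a)
      (Metric.ball_mem_nhds (s : ℂ) (show 0 < a * T / Real.pi by positivity))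
    filter_upwards [this] with w hw
    simpa [dist_eq_norm] using hw
  -- the linear term in `v.im` decides the side once `v` is small compared with the aperture
  have hnorm : ∀ v : ℂ, ‖modelCircle T s + deriv (modelCircle T) s * v‖ ^ 2 =
      1 - 4 * Real.pi / T * v.im + (2 * Real.pi / T) ^ 2 * ‖v‖ ^ 2 := by
    intro v
    have e : modelCircle T s + deriv (modelCircle T) s * v =
        modelCircle T s * (1 + ((2 * Real.pi / T : ℝ) : ℂ) * Complex.I * v) := by
      rw [deriv_modelCircle]; push_cast; ring
    rw [e, norm_mul, norm_modelCircle, one_mul, ← Complex.normSq_eq_norm_sq,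
      ← Complex.normSq_eq_norm_sq, Complex.normSq_apply, Complex.normSq_apply]
    simp
    ring
  filter_upwards [hball, self_mem_nhdsWithin] with w hw hwc
  have hy := im_pos_of_mem_upperCone ha hwc
  have hwc' : a * ‖w - s‖ < w.im := hwc
  have hpi := Real.pi_pos
  have him : (w - s).im = w.im := by simp
  have himc : ((starRingEnd ℂ) w - s).im = -w.im := by simp
  refine ⟨?_, ?_⟩
  · rw [← abs_of_nonneg (norm_nonneg (modelCircle T s + deriv (modelCircle T) s * (w - s))),
      ← sq_lt_one_iff_abs_lt_one, hnorm, him]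
    have h1 : ‖w - s‖ * ‖w - s‖ ≤ a * T / Real.pi * ‖w - s‖ := by gcongr
    have h2 : (2 * Real.pi / T) ^ 2 * (a * T / Real.pi * ‖w - s‖) =
        4 * Real.pi / T * (a * ‖w - s‖) := by field_simp; ring
    have h3 : 4 * Real.pi / T * (a * ‖w - s‖) < 4 * Real.pi / T * w.im := by gcongr
    have h4 : (2 * Real.pi / T) ^ 2 * ‖w - s‖ ^ 2 ≤
      (2 * Real.pi / T) ^ 2 * (a * T / Real.pi * ‖w - s‖) := by rw [sq ‖w - s‖]; gcongr
    linarith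
  · rw [← abs_of_nonneg (norm_nonneg (modelCircle T s + deriv (modelCircle T) s *
        ((starRingEnd ℂ) w - s))), ← one_lt_sq_iff_one_lt_abs, hnorm, himc]
    have : 0 < 4 * Real.pi / T * w.im := by positivity
    have : 0 ≤ (2 * Real.pi / T) ^ 2 * ‖(starRingEnd ℂ) w - s‖ ^ 2 := by positivity
    linarith

/-- The symmetric jump relation along a curve, at almost every parameter. -/
lemma ae_tendsto_curve_jump {γ : ℝ → ℂ} (hγ : ContDiff ℝ 2 γ) {b : ℝ}
    (h' : ∀ s ∈ Ioo 0 b, deriv γ s ≠ 0)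
    (hinj : ∀ s ∈ Ioo 0 b, ∀ t ∈ Icc 0 b, t ≠ s → γ t ≠ γ s)
    {f : ℝ → ℂ} (hf : IntegrableOn f (Ioc 0 b)) :
    ∀ᵐ s : ℝ, s ∈ Ioo 0 b → ∀ a : ℝ, 0 < a → Tendsto (fun w : ℂ =>
        (∫ t in (0 : ℝ)..b, deriv γ t / (γ t - (γ s + deriv γ s * (w - s))) * f t) -
          ∫ t in (0 : ℝ)..b,
            deriv γ t / (γ t - (γ s + deriv γ s * ((starRingEnd ℂ) w - s))) * f t)
      (𝓝[upperCone s a] (s : ℂ)) (𝓝 (2 * Real.pi * Complex.I * f s)) := by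
  have hH : Integrable ((Ioc 0 b).indicator f) := hf.integrable_indicator measurableSet_Ioc
  filter_upwards [ae_tendsto_line_jump hH b] with s hs hsb a ha
  have hb : 0 ≤ b := (hsb.1.trans hsb.2).le
  have hfi : IntervalIntegrable f volume 0 b := (intervalIntegrable_iff_integrableOn_Ioc_of_le hb).2 hf
  have hcongr : ∀ k : ℝ → ℂ, ∫ t in (0 : ℝ)..b, k t * (Ioc 0 b).indicator f t =
      ∫ t in (0 : ℝ)..b, k t * f t := by
    intro k
    rw [intervalIntegral.integral_of_le hb, intervalIntegral.integral_of_le hb]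
    refine setIntegral_congr_fun measurableSet_Ioc fun t ht => ?_
    simp only [indicator_of_mem ht]
  have h1 := hs hsb a ha
  simp only [hcongr, indicator_of_mem (Ioo_subset_Ioc_self hsb)] at h1
  have h2 := tendsto_curve_sub_line hγ (Ioo_subset_Icc_self hsb) (h' s hsb) (hinj s hsb) ha hfi
  have h3 := h2.comp (tendsto_conj_doubleCone s a)
  have h4 := h2.mono_left (nhdsWithin_mono _ (upperCone_subset s a))
  -- the comparison terms with the tangent line have the same limit at `w` and at its conjugate
  have h5 := (h4.sub h3).add h1
  rw [sub_self, zero_add] at h5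
  refine h5.congr fun w => ?_
  simp only [Function.comp_apply]
  ring

/-- Nontangential boundary values on the model circle of the Cauchy integral of a square
integrable density: they are given by the Hardy projection. -/
lemma exists_modelCircle_boundary {T : ℝ} (hT : 0 < T) {f : ℝ → ℂ}
    (hf : MemLp f 2 (volume.restrict (Ioc 0 T))) :
    ∃ g : ℝ → ℂ, MemLp g 2 (volume.restrict (Ioc 0 T)) ∧
      eLpNorm g 2 (volume.restrict (Ioc 0 T)) ≤ eLpNorm f 2 (volume.restrict (Ioc 0 T)) ∧
      ∀ᵐ s : ℝ, s ∈ Ioo 0 T → ∀ a : ℝ, 0 < a →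
        Tendsto (fun w : ℂ => ∫ t in (0 : ℝ)..T, deriv (modelCircle T) t /
            (modelCircle T t - (modelCircle T s + deriv (modelCircle T) s * (w - s))) * f t)
          (𝓝[upperCone s a] (s : ℂ)) (𝓝 (2 * Real.pi * Complex.I * g s)) ∧
        Tendsto (fun w : ℂ => ∫ t in (0 : ℝ)..T, deriv (modelCircle T) t /
            (modelCircle T t - (modelCircle T s +
              deriv (modelCircle T) s * ((starRingEnd ℂ) w - s))) * f t)
          (𝓝[upperCone s a] (s : ℂ)) (𝓝 (2 * Real.pi * Complex.I * (g s - f s))) := by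
  obtain ⟨g, hg, hgf, hin, hout⟩ := exists_hardy_projection hT hf
  refine ⟨g, hg, hgf, ?_⟩
  have hfi : IntegrableOn f (Ioc 0 T) := hf.integrable (by norm_num)
  have hgi : IntegrableOn g (Ioc 0 T) := hg.integrable (by norm_num)
  have hfI := (intervalIntegrable_iff_integrableOn_Ioc_of_le hT.le).2 hfi
  have hgI := (intervalIntegrable_iff_integrableOn_Ioc_of_le hT.le).2 hgi
  have h' : ∀ s ∈ Ioo 0 T, deriv (modelCircle T) s ≠ 0 := fun s _ => by
    rw [deriv_modelCircle]
    have : (T : ℂ) ≠ 0 := by exact_mod_cast hT.ne'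
    exact mul_ne_zero (div_ne_zero Complex.two_pi_I_ne_zero this) (modelCircle_ne_zero T s)
  have hinj : ∀ s ∈ Ioo 0 T, ∀ t ∈ Icc 0 T, t ≠ s → modelCircle T t ≠ modelCircle T s := by
    intro s hs t ht hts h
    refine hts (modelCircle_injOn hT ?_ h)
    rw [abs_lt]; constructor <;> linarith [hs.1, hs.2, ht.1, ht.2]
  have hint : ∀ ω : ℂ, ‖ω‖ ≠ 1 → ContinuousOn
      (fun t => deriv (modelCircle T) t / (modelCircle T t - ω)) (uIcc 0 T) := by
    intro ω hω
    have hc := continuous_modelCircle T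
    refine (Continuous.div ((contDiff_modelCircle T).continuous_deriv (by norm_num))
      (hc.sub continuous_const) fun t h => hω ?_).continuousOn
    rw [← sub_eq_zero.1 (show modelCircle T t - ω = 0 from h), norm_modelCircle]
  have hsub : ∀ ω : ℂ, ‖ω‖ ≠ 1 →
      ∫ t in (0 : ℝ)..T, deriv (modelCircle T) t / (modelCircle T t - ω) * (f t - g t) =
        (∫ t in (0 : ℝ)..T, deriv (modelCircle T) t / (modelCircle T t - ω) * f t) -
          ∫ t in (0 : ℝ)..T, deriv (modelCircle T) t / (modelCircle T t - ω) * g t := by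
    intro ω hω
    rw [← intervalIntegral.integral_sub (hfI.continuousOn_mul (hint ω hω))
      (hgI.continuousOn_mul (hint ω hω))]
    simp only [mul_sub (deriv (modelCircle T) _ / (modelCircle T _ - ω))]
  -- with `f = g + (f - g)`, the inner limit is the jump of the Cauchy integral of `g`, which
  -- vanishes outside, and the outer limit is minus the jump of that of `f - g`, which vanishes inside
  filter_upwards [ae_tendsto_curve_jump (contDiff_modelCircle T) h' hinj hgi,
    ae_tendsto_curve_jump (contDiff_modelCircle T) h' hinj (hfi.sub hgi)] with s hs1 hs2 hs a ha
  refine ⟨(hs1 hs a ha).congr' ?_, ?_⟩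
  · filter_upwards [eventually_modelCircle_sides hT ha s] with w hw
    rw [modelCircle_cauchy_eq_zero_outside hT hgI hout hw.2, sub_zero]
    have h1 := modelCircle_cauchy_eq_zero_inside hT (hfI.sub hgI) hin hw.1
    rw [hsub _ hw.1.ne] at h1
    exact (sub_eq_zero.1 h1).symm
  · have h1 := (hs2 hs a ha).neg
    have e : -(2 * Real.pi * Complex.I * (f - g) s) = 2 * Real.pi * Complex.I * (g s - f s) := by
      simp only [Pi.sub_apply]; ring
    rw [e] at h1
    refine h1.congr' ?_
    filter_upwards [eventually_modelCircle_sides hT ha s] with w hw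
    have h2 := modelCircle_cauchy_eq_zero_inside hT (hfI.sub hgI) hin hw.1
    have h3 := modelCircle_cauchy_eq_zero_outside hT hgI hout hw.2
    simp only [Pi.sub_apply]
    rw [h2, zero_sub, neg_neg, hsub _ hw.2.ne', h3, sub_zero]

/-! ### Nontangential cones and boundary values of a curve against itself -/

/-- The open cone with vertex `z` to the left of the direction `τ`, of aperture `a`. -/
def leftCone (z τ : ℂ) (a : ℝ) : Set ℂ :=
  {ζ | a * (‖ζ - z‖ * ‖τ‖) < ((ζ - z) * (starRingEnd ℂ) τ).im}

lemma leftCone_neBot {z τ : ℂ} (hτ : τ ≠ 0) {a : ℝ} (ha : a < 1) :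
    (𝓝[leftCone z τ a] z).NeBot := by
  rw [← mem_closure_iff_nhdsWithin_neBot]
  have h1 : Tendsto (fun ε : ℝ => z + ε * (Complex.I * τ)) (𝓝[>] 0) (𝓝 z) := by
    have : ContinuousAt (fun ε : ℝ => z + ε * (Complex.I * τ)) 0 := by fun_prop
    have h := this.tendsto
    simp only [Complex.ofReal_zero, zero_mul, add_zero] at h
    exact h.mono_left nhdsWithin_le_nhds
  refine mem_closure_of_tendsto h1 ?_
  filter_upwards [self_mem_nhdsWithin] with ε hε
  have hε0 : 0 < ε := hε
  have hτ0 : 0 < ‖τ‖ := norm_pos_iff.2 hτ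
  have e : (ε * (Complex.I * τ)) * (starRingEnd ℂ) τ = ((ε * ‖τ‖ ^ 2 : ℝ) : ℂ) * Complex.I := by
    have := Complex.mul_conj τ
    rw [Complex.normSq_eq_norm_sq] at this
    push_cast
    push_cast at this
    linear_combination (ε * Complex.I : ℂ) * this
  simp only [leftCone, mem_ofPred_eq, add_sub_cancel_left, e]
  simp only [norm_mul, Complex.norm_real, Complex.norm_I, Real.norm_of_nonneg hε0.le,
    Complex.im_ofReal_mul, Complex.I_im, one_mul, mul_one]
  have : 0 < ε * ‖τ‖ ^ 2 := by positivity
  nlinarith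

lemma doubleCone_neBot (s : ℝ) {a : ℝ} (ha : a < 1) : (𝓝[doubleCone s a] (s : ℂ)).NeBot := by
  have := leftCone_neBot (z := s) (τ := 1) one_ne_zero ha
  refine this.mono (nhdsWithin_mono _ fun w hw => ?_)
  have : a * ‖w - s‖ < w.im := by simpa [leftCone] using hw
  exact this.trans_le (le_abs_self _)

/-- The tangential coordinate maps the left cone at a point of a curve to an upper cone. -/
lemma tendsto_tangent_coordinate (z : ℂ) {τ : ℂ} (hτ : τ ≠ 0) (s a : ℝ) :
    Tendsto (fun ζ => s + (ζ - z) / τ) (𝓝[leftCone z τ a] z) (𝓝[upperCone s a] (s : ℂ)) := by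
  refine tendsto_nhdsWithin_iff.2 ⟨?_, ?_⟩
  · have : ContinuousAt (fun ζ => s + (ζ - z) / τ) z := by fun_prop
    have h := this.tendsto
    simp only [sub_self, zero_div, add_zero] at h
    exact h.mono_left nhdsWithin_le_nhds
  · filter_upwards [self_mem_nhdsWithin] with ζ hζ
    have hτ0 : 0 < ‖τ‖ := norm_pos_iff.2 hτ
    have e : (ζ - z) / τ = ((‖τ‖ ^ 2 : ℝ) : ℂ)⁻¹ * ((ζ - z) * (starRingEnd ℂ) τ) := by
      rw [← Complex.normSq_eq_norm_sq, ← Complex.mul_conj]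
      have : (starRingEnd ℂ) τ ≠ 0 := by simpa using hτ
      field_simp
    have h : a * (‖ζ - z‖ * ‖τ‖) < ((ζ - z) * (starRingEnd ℂ) τ).im := hζ
    have him : ((s : ℂ) + (ζ - z) / τ).im =
        (‖τ‖ ^ 2)⁻¹ * ((ζ - z) * (starRingEnd ℂ) τ).im := by
      rw [Complex.add_im, Complex.ofReal_im, zero_add, e, ← Complex.ofReal_inv,
        Complex.im_ofReal_mul]
    change a * ‖((s : ℂ) + (ζ - z) / τ) - s‖ < ((s : ℂ) + (ζ - z) / τ).im
    rw [him, add_sub_cancel_left, norm_div, inv_mul_eq_div, lt_div_iff₀ (by positivity)]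
    calc _ = a * (‖ζ - z‖ * ‖τ‖) := by field_simp
      _ < _ := h

lemma tendsto_tangent_coordinate_neg (z : ℂ) {τ : ℂ} (hτ : τ ≠ 0) (s a : ℝ) :
    Tendsto (fun ζ => (starRingEnd ℂ) (s + (ζ - z) / τ)) (𝓝[leftCone z (-τ) a] z)
      (𝓝[upperCone s a] (s : ℂ)) := by
  refine tendsto_nhdsWithin_iff.2 ⟨?_, ?_⟩
  · have : ContinuousAt (fun ζ => (starRingEnd ℂ) (s + (ζ - z) / τ)) z :=
      Complex.continuous_conj.continuousAt.comp (by fun_prop)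
    have h := this.tendsto
    simp only [sub_self, zero_div, add_zero, Complex.conj_ofReal] at h
    exact h.mono_left nhdsWithin_le_nhds
  · have h1 := (tendsto_nhdsWithin_iff.1
      (tendsto_tangent_coordinate z (neg_ne_zero.2 hτ) s a)).2
    filter_upwards [h1] with ζ hζ
    have h2 : a * ‖((s : ℂ) + (ζ - z) / -τ) - s‖ < ((s : ℂ) + (ζ - z) / -τ).im := hζ
    change a * ‖(starRingEnd ℂ) (s + (ζ - z) / τ) - s‖ < ((starRingEnd ℂ) (s + (ζ - z) / τ)).im
    rw [map_add, Complex.conj_ofReal, add_sub_cancel_left, Complex.norm_conj, Complex.add_im,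
      Complex.conj_im]
    rw [add_sub_cancel_left, div_neg, norm_neg, Complex.add_im, Complex.neg_im] at h2
    exact h2

/-- Limits along a left cone, read in the tangential coordinate. -/
lemma tendsto_leftCone_of_upperCone {F : ℂ → ℂ} {z τ : ℂ} (hτ : τ ≠ 0) {s a : ℝ} {l : Filter ℂ}
    (h : Tendsto (fun w => F (z + τ * (w - s))) (𝓝[upperCone s a] (s : ℂ)) l) :
    Tendsto F (𝓝[leftCone z τ a] z) l := by
  refine (h.comp (tendsto_tangent_coordinate z hτ s a)).congr fun ζ => ?_
  simp only [Function.comp_apply, add_sub_cancel_left]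
  congr 1
  field_simp
  ring

lemma tendsto_leftCone_neg_of_upperCone {F : ℂ → ℂ} {z τ : ℂ} (hτ : τ ≠ 0) {s a : ℝ}
    {l : Filter ℂ} (h : Tendsto (fun w => F (z + τ * ((starRingEnd ℂ) w - s)))
      (𝓝[upperCone s a] (s : ℂ)) l) :
    Tendsto F (𝓝[leftCone z (-τ) a] z) l := by
  refine (h.comp (tendsto_tangent_coordinate_neg z hτ s a)).congr fun ζ => ?_
  simp only [Function.comp_apply, Complex.conj_conj, add_sub_cancel_left]
  congr 1
  field_simp
  ring

/-- Near a smooth point of a curve, the nontangential cones do not meet the curve. -/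
lemma eventually_notMem_curve {γ : ℝ → ℂ} (hγ : ContDiff ℝ 2 γ) {b s a : ℝ} (hs : s ∈ Icc 0 b)
    (h' : deriv γ s ≠ 0) (hinj : ∀ t ∈ Icc 0 b, t ≠ s → γ t ≠ γ s) (ha : 0 < a) :
    (∀ᶠ ζ in 𝓝[leftCone (γ s) (deriv γ s) a] (γ s), ζ ∉ γ '' Icc 0 b) ∧
      ∀ᶠ ζ in 𝓝[leftCone (γ s) (-deriv γ s) a] (γ s), ζ ∉ γ '' Icc 0 b := by
  obtain ⟨c, hc, h⟩ := eventually_lower_bound hγ hs h' hinj ha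
  have key : ∀ᶠ w in 𝓝[doubleCone s a] (s : ℂ),
      γ s + deriv γ s * (w - s) ∉ γ '' Icc 0 b := by
    filter_upwards [h, self_mem_nhdsWithin] with w hw hwc
    rintro ⟨t, ht, e⟩
    have h1 := hw t ht
    have h0 := (doubleCone_bounds ha hwc t).1
    rw [e, sub_self, norm_zero] at h1
    have : 0 < c * ‖(t : ℂ) - w‖ := by positivity
    linarith
  have hup := key.filter_mono (nhdsWithin_mono _ (upperCone_subset s a))
  have hlow := (tendsto_conj_doubleCone s a).eventually key
  refine ⟨?_, ?_⟩
  · filter_upwards [(tendsto_tangent_coordinate (γ s) h' s a).eventually hup] with ζ hζ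
    convert hζ using 2
    field_simp
    ring
  · filter_upwards [(tendsto_tangent_coordinate_neg (γ s) h' s a).eventually hlow] with ζ hζ
    convert hζ using 2
    rw [Complex.conj_conj]
    field_simp
    ring

/-- At a fixed smooth point, the difference of the Cauchy kernels of a curve and of its tangent
line is integrable against every integrable density. -/
lemma intervalIntegrable_kernel_sub {γ : ℝ → ℂ} (hγ : ContDiff ℝ 2 γ) {b s : ℝ} (hs : s ∈ Icc 0 b)
    (h' : deriv γ s ≠ 0) (hinj : ∀ t ∈ Icc 0 b, t ≠ s → γ t ≠ γ s)
    {f : ℝ → ℂ} (hf : IntervalIntegrable f volume 0 b) :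
    IntervalIntegrable (fun t => (deriv γ t / (γ t - γ s) - 1 / ((t : ℂ) - s)) * f t)
      volume 0 b := by
  have hb : 0 ≤ b := hs.1.trans hs.2
  obtain ⟨C, hC0, hC⟩ := exists_taylor_bound hγ b
  obtain ⟨c, hc, h⟩ := eventually_lower_bound hγ hs h' hinj (a := 1 / 2) (by norm_num)
  have hlow : ∀ t ∈ Icc 0 b, c * ‖(t : ℂ) - s‖ ≤ ‖γ t - (γ s + deriv γ s * ((s : ℂ) - s))‖ := by
    intro t ht
    have := doubleCone_neBot s (a := 1 / 2) (by norm_num)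
    have h1 : Tendsto (fun w : ℂ => c * ‖(t : ℂ) - w‖) (𝓝[doubleCone s (1 / 2)] (s : ℂ))
        (𝓝 (c * ‖(t : ℂ) - s‖)) :=
      (Continuous.tendsto (by fun_prop) _).mono_left nhdsWithin_le_nhds
    have h2 : Tendsto (fun w : ℂ => ‖γ t - (γ s + deriv γ s * (w - s))‖)
        (𝓝[doubleCone s (1 / 2)] (s : ℂ)) (𝓝 ‖γ t - (γ s + deriv γ s * ((s : ℂ) - s))‖) :=
      (Continuous.tendsto (by fun_prop) _).mono_left nhdsWithin_le_nhds
    exact le_of_tendsto_of_tendsto h1 h2 (h.mono fun w hw => hw t ht)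
  have hm : Measurable fun t : ℝ => deriv γ t / (γ t - γ s) - 1 / ((t : ℂ) - s) := by
    have := (hγ.continuous_deriv (by norm_num)).measurable
    have := hγ.continuous.measurable
    fun_prop
  refine IntervalIntegrable.mono_fun (f := fun t => (max 0 (C * (1 + 1 ^ 2) / c) : ℝ) * ‖f t‖)
    (hf.norm.const_mul _) (hm.aestronglyMeasurable.mul hf.def'.aestronglyMeasurable) ?_
  rw [uIoc_of_le hb]
  filter_upwards [ae_restrict_mem measurableSet_Ioc] with t ht
  have ht' := Ioc_subset_Icc_self ht
  rw [norm_mul, norm_mul, Real.norm_of_nonneg (le_max_left _ _), norm_norm]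
  gcongr
  rcases eq_or_ne t s with rfl | hts
  · simp
  · have hne : 0 < ‖(t : ℂ) - s‖ := norm_pos_iff.2 (sub_ne_zero.2 (by exact_mod_cast hts))
    have h1 := norm_kernel_sub_le (k := 1) hC0 hc (hC s hs t ht').1 (hC s hs t ht').2
      (by rw [one_mul, ← Complex.ofReal_sub, Complex.norm_real, Real.norm_eq_abs]) hne (hlow t ht')
    rw [sub_self, mul_zero, add_zero] at h1
    exact h1.trans (le_max_right _ _)

/-- The Cauchy integral of a density along a curve, parametrized over `[0, 1]`. -/
noncomputable def curveCauchy (γ : ℝ → ℂ) (f : ℝ → ℂ) (z : ℂ) : ℂ :=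
  ∫ t in (0 : ℝ)..1, deriv γ t / (γ t - z) * f t

lemma integral_norm_le_eLpNorm_two {E : Type*} [NormedAddCommGroup E] (f : ℝ → E)
    (hf : MemLp f 2 (volume.restrict (Ioc (0 : ℝ) 1))) :
    ∫ t in Ioc (0 : ℝ) 1, ‖f t‖ ≤ (eLpNorm f 2 (volume.restrict (Ioc (0 : ℝ) 1))).toReal := by
  have : IsProbabilityMeasure (volume.restrict (Ioc (0 : ℝ) 1)) := ⟨by simp⟩
  rw [integral_norm_eq_lintegral_enorm hf.aestronglyMeasurable, ← eLpNorm_one_eq_lintegral_enorm]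
  exact ENNReal.toReal_mono hf.eLpNorm_ne_top
    (eLpNorm_le_eLpNorm_of_exponent_le (by norm_num) hf.aestronglyMeasurable)

/-- Boundary values, on a curve, of the Cauchy integral along the same curve. The curve is compared
with a circle of period `T`; the difference of the two Cauchy kernels is assumed to be bounded. -/
lemma exists_boundary_self {γ : ℝ → ℂ} (hγ : ContDiff ℝ 2 γ)
    (h' : ∀ s ∈ Icc (0 : ℝ) 1, deriv γ s ≠ 0)
    (hinj : ∀ s ∈ Ioo (0 : ℝ) 1, ∀ t ∈ Icc (0 : ℝ) 1, t ≠ s → γ t ≠ γ s)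
    {T : ℝ} (hT : 1 ≤ T) {B : ℝ} (hB0 : 0 ≤ B)
    (hB : ∀ s ∈ Ioo (0 : ℝ) 1, ∀ t ∈ Icc (0 : ℝ) 1, t ≠ s →
      ‖deriv γ t / (γ t - γ s) -
        deriv (modelCircle T) t / (modelCircle T t - modelCircle T s)‖ ≤ B)
    {f : ℝ → ℂ} (hf : MemLp f 2 (volume.restrict (Ioc (0 : ℝ) 1))) :
    ∃ g : ℝ → ℂ, MemLp g 2 (volume.restrict (Ioc (0 : ℝ) 1)) ∧
      eLpNorm g 2 (volume.restrict (Ioc (0 : ℝ) 1)) ≤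
        ENNReal.ofReal (B + 4 * Real.pi) * eLpNorm f 2 (volume.restrict (Ioc (0 : ℝ) 1)) ∧
      ∀ᵐ s ∂volume.restrict (Ioc (0 : ℝ) 1), ∀ a : ℝ, 0 < a →
        Tendsto (curveCauchy γ f) (𝓝[leftCone (γ s) (-deriv γ s) a] (γ s)) (𝓝 (g s)) ∧
        Tendsto (curveCauchy γ f) (𝓝[leftCone (γ s) (deriv γ s) a] (γ s))
          (𝓝 (g s + 2 * Real.pi * Complex.I * f s)) := by
  have hT0 : 0 < T := by linarith
  set μ := volume.restrict (Ioc (0 : ℝ) 1) with hμ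
  have hsub : Ioc (0 : ℝ) 1 ⊆ Ioc 0 T := Ioc_subset_Ioc_right hT
  -- extension of the density by zero to the whole period
  set F : ℝ → ℂ := (Ioc (0 : ℝ) 1).indicator f with hF
  have hres : (volume.restrict (Ioc 0 T)).restrict (Ioc (0 : ℝ) 1) = μ := by
    rw [Measure.restrict_restrict measurableSet_Ioc, inter_eq_left.2 hsub]
  have hFm : MemLp F 2 (volume.restrict (Ioc 0 T)) := by
    rw [hF, memLp_indicator_iff_restrict measurableSet_Ioc, hres]; exact hf
  have hFn : eLpNorm F 2 (volume.restrict (Ioc 0 T)) = eLpNorm f 2 μ := by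
    rw [hF, eLpNorm_indicator_eq_eLpNorm_restrict measurableSet_Ioc, hres]
  obtain ⟨G, hG, hGn, hlim⟩ := exists_modelCircle_boundary hT0 hFm
  have hμT : μ ≤ volume.restrict (Ioc 0 T) := Measure.restrict_mono_set _ hsub
  have hG1 : MemLp G 2 μ := hG.mono_measure hμT
  have hGn1 : eLpNorm G 2 μ ≤ eLpNorm f 2 μ := by
    rw [← hFn]; exact (eLpNorm_mono_measure _ hμT).trans hGn
  have hfi : IntegrableOn f (Ioc 0 1) := by
    have : IsFiniteMeasure μ := ⟨by simp [hμ]⟩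
    exact hf.integrable (by norm_num)
  have hfI : IntervalIntegrable f volume 0 1 :=
    (intervalIntegrable_iff_integrableOn_Ioc_of_le zero_le_one).2 hfi
  have hFint : ∀ k : ℝ → ℂ, ∫ t in (0 : ℝ)..T, k t * F t = ∫ t in (0 : ℝ)..1, k t * f t := by
    intro k
    rw [intervalIntegral.integral_of_le hT0.le, intervalIntegral.integral_of_le zero_le_one]
    have : (fun t => k t * F t) = (Ioc (0 : ℝ) 1).indicator (fun t => k t * f t) := by
      funext t; by_cases ht : t ∈ Ioc (0 : ℝ) 1 <;> simp [hF, ht]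
    rw [this, integral_indicator measurableSet_Ioc, hres]
  -- the integral operator with the difference of the two kernels
  set D : ℝ → ℂ := fun s => ∫ t in Ioc (0 : ℝ) 1, (deriv γ t / (γ t - γ s) -
    deriv (modelCircle T) t / (modelCircle T t - modelCircle T s)) * f t with hD
  have hDm : AEStronglyMeasurable D μ := by
    have hm : Measurable fun p : ℝ × ℝ => deriv γ p.2 / (γ p.2 - γ p.1) -
        deriv (modelCircle T) p.2 / (modelCircle T p.2 - modelCircle T p.1) := by
      have := (hγ.continuous_deriv (by norm_num)).measurable
      have := hγ.continuous.measurable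
      have := ((contDiff_modelCircle T).continuous_deriv (by norm_num)).measurable
      have := (continuous_modelCircle T).measurable
      fun_prop
    have := (hm.aestronglyMeasurable (μ := μ.prod μ)).mul hf.aestronglyMeasurable.comp_snd
    exact this.integral_prod_right'
  have hnull : ∀ s : ℝ, ∀ᵐ t ∂μ, t ≠ s := fun s => by
    have : ∀ᵐ t ∂(volume : Measure ℝ), t ≠ s := by simp [ae_iff, measure_singleton]
    exact ae_restrict_of_ae this
  have hDb : ∀ s ∈ Ioo (0 : ℝ) 1, ‖D s‖ ≤ B * (eLpNorm f 2 μ).toReal := by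
    intro s hs
    calc ‖D s‖ ≤ ∫ t in Ioc (0 : ℝ) 1, B * ‖f t‖ := by
          refine norm_integral_le_of_norm_le (hfi.norm.const_mul _) ?_
          filter_upwards [hnull s, ae_restrict_mem measurableSet_Ioc] with t hts ht
          rw [norm_mul]
          gcongr
          exact hB s hs t (Ioc_subset_Icc_self ht) hts
      _ = B * ∫ t in Ioc (0 : ℝ) 1, ‖f t‖ := integral_const_mul _ _
      _ ≤ _ := by gcongr; exact integral_norm_le_eLpNorm_two f hf
  have hIoo : ∀ᵐ s ∂μ, s ∈ Ioo (0 : ℝ) 1 := by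
    filter_upwards [hnull 1, ae_restrict_mem measurableSet_Ioc] with t ht1 ht
    exact ⟨ht.1, lt_of_le_of_ne ht.2 ht1⟩
  have hDn : eLpNorm D 2 μ ≤ ENNReal.ofReal B * eLpNorm f 2 μ := by
    have : IsProbabilityMeasure μ := ⟨by simp [hμ]⟩
    have h1 := eLpNorm_le_of_ae_bound (p := 2) (hIoo.mono hDb)
    refine h1.trans (le_of_eq ?_)
    rw [measure_univ, ENNReal.one_rpow, one_mul, ENNReal.ofReal_mul hB0,
      ENNReal.ofReal_toReal hf.eLpNorm_ne_top]
  -- the right side of a curve corresponds to the outside of the positively oriented model circle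
  refine ⟨D + (2 * Real.pi * Complex.I) • (G - f), ?_, ?_, ?_⟩
  · exact (MemLp.add ⟨hDm, hDn.trans_lt (ENNReal.mul_lt_top ENNReal.ofReal_lt_top hf.2)⟩
      ((hG1.sub hf).const_smul _))
  · have h2pi : ‖(2 * Real.pi * Complex.I : ℂ)‖ₑ = ENNReal.ofReal (2 * Real.pi) := by
      rw [← ofReal_norm]; simp [abs_of_pos Real.pi_pos]
    calc _ ≤ eLpNorm D 2 μ + eLpNorm ((2 * Real.pi * Complex.I : ℂ) • (G - f)) 2 μ :=
          eLpNorm_add_le hDm ((hG1.sub hf).const_smul _).1 (by norm_num)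
      _ ≤ ENNReal.ofReal B * eLpNorm f 2 μ +
          ENNReal.ofReal (2 * Real.pi) * (eLpNorm f 2 μ + eLpNorm f 2 μ) := by
        rw [eLpNorm_const_smul, h2pi]
        gcongr
        exact (eLpNorm_sub_le hG1.1 hf.1 (by norm_num)).trans (by gcongr)
      _ = _ := by
        have hpi := Real.pi_pos
        rw [ENNReal.ofReal_add hB0 (by positivity), add_mul,
          show 4 * Real.pi = 2 * (2 * Real.pi) by ring, ENNReal.ofReal_mul (p := 2) (by norm_num)]
        norm_num
        ring
  · filter_upwards [ae_restrict_of_ae hlim, hIoo] with s hs hs01 a ha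
    have hs' : s ∈ Icc (0 : ℝ) 1 := Ioo_subset_Icc_self hs01
    obtain ⟨hl1, hl2⟩ := hs ⟨hs01.1, hs01.2.trans_le hT⟩ a ha
    have hFs : F s = f s := indicator_of_mem (Ioo_subset_Ioc_self hs01) f
    simp only [hFint, hFs] at hl1 hl2
    have hσ' : deriv (modelCircle T) s ≠ 0 := by
      rw [deriv_modelCircle]
      have : (T : ℂ) ≠ 0 := by exact_mod_cast hT0.ne'
      exact mul_ne_zero (div_ne_zero Complex.two_pi_I_ne_zero this) (modelCircle_ne_zero T s)
    have hσinj : ∀ t ∈ Icc (0 : ℝ) 1, t ≠ s → modelCircle T t ≠ modelCircle T s := by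
      intro t ht hts h
      refine hts (modelCircle_injOn hT0 ?_ h)
      rw [abs_lt]; constructor <;> linarith [hs01.1, hs01.2, ht.1, ht.2]
    have c1 := tendsto_curve_sub_line hγ hs' (h' s hs') (hinj s hs01) ha hfI
    have c2 := tendsto_curve_sub_line (contDiff_modelCircle T) hs' hσ' hσinj ha hfI
    have i1 := intervalIntegrable_kernel_sub hγ hs' (h' s hs') (hinj s hs01) hfI
    have i2 := intervalIntegrable_kernel_sub (contDiff_modelCircle T) hs' hσ' hσinj hfI
    -- comparing both curves with their tangent lines eliminates the line
    have c3 := c1.sub c2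
    rw [← intervalIntegral.integral_sub i1 i2] at c3
    have e : ∫ t in (0 : ℝ)..1, ((deriv γ t / (γ t - γ s) - 1 / ((t : ℂ) - s)) * f t -
        (deriv (modelCircle T) t / (modelCircle T t - modelCircle T s) -
          1 / ((t : ℂ) - s)) * f t) = D s := by
      rw [intervalIntegral.integral_of_le zero_le_one]
      simp only [hD]
      congr 1; funext t; ring
    rw [e] at c3
    refine ⟨tendsto_leftCone_neg_of_upperCone (s := s) (h' s hs') ?_,
      tendsto_leftCone_of_upperCone (s := s) (h' s hs') ?_⟩
    · refine ((c3.comp (tendsto_conj_doubleCone s a)).add hl2).congr fun w => ?_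
      simp only [Function.comp_apply, curveCauchy]
      ring
    · have h3 := (c3.mono_left (nhdsWithin_mono _ (upperCone_subset s a))).add hl1
      have e2 : (D + (2 * Real.pi * Complex.I : ℂ) • (G - f)) s + 2 * Real.pi * Complex.I * f s =
          D s + 2 * Real.pi * Complex.I * G s := by
        simp only [Pi.add_apply, Pi.smul_apply, Pi.sub_apply, smul_eq_mul]; ring
      rw [e2]
      refine h3.congr fun w => ?_
      simp only [curveCauchy]
      ring

/-! ### The Hilbert kernel and the Schur test -/

/-- The Schur test on a measure space, for a nonnegative kernel. -/
lemma lintegral_schur_le {α : Type*} [MeasurableSpace α] {μ : Measure α} [SFinite μ]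
    {k : α → α → ENNReal} (hk : Measurable (Function.uncurry k)) {p q : α → ENNReal}
    (hp : Measurable p) (hq : Measurable q) (hp0 : ∀ᵐ t ∂μ, p t ≠ 0 ∧ p t ≠ ⊤) {C : ENNReal}
    (h1 : ∀ᵐ s ∂μ, ∫⁻ t, k s t * p t ∂μ ≤ C * q s)
    (h2 : ∀ᵐ t ∂μ, ∫⁻ s, k s t * q s ∂μ ≤ C * p t)
    {f : α → ENNReal} (hf : AEMeasurable f μ) :
    ∫⁻ s, (∫⁻ t, k s t * f t ∂μ) ^ 2 ∂μ ≤ C ^ 2 * ∫⁻ t, f t ^ 2 ∂μ := by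
  have hks : ∀ s, Measurable (k s) := fun s => hk.of_uncurry_left
  -- Cauchy-Schwarz after writing `k f` as `(k p)^(1/2) (k p⁻¹ f ^ 2)^(1/2)`
  have cs : ∀ s, (∫⁻ t, k s t * f t ∂μ) ^ 2 ≤
      (∫⁻ t, k s t * p t ∂μ) * ∫⁻ t, k s t * ((p t)⁻¹ * f t ^ 2) ∂μ := by
    intro s
    have hms : AEMeasurable (fun t => k s t * ((p t)⁻¹ * f t ^ 2)) μ :=
      (hks s).aemeasurable.mul (hp.inv.aemeasurable.mul (hf.pow_const 2))
    have h := ENNReal.lintegral_mul_le_Lp_mul_Lq μ Real.HolderConjugate.two_two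
      (f := fun t => (k s t * p t) ^ (1 / 2 : ℝ))
      (g := fun t => (k s t * ((p t)⁻¹ * f t ^ 2)) ^ (1 / 2 : ℝ))
      (((hks s).mul hp).pow_const _).aemeasurable
      (hms.pow_const _)
    have hsq : ∀ x : ENNReal, (x ^ (1 / 2 : ℝ)) ^ (2 : ℝ) = x := fun x => by
      rw [← ENNReal.rpow_mul]; norm_num
    have hsq' : ∀ x : ENNReal, (x ^ (1 / 2 : ℝ)) ^ 2 = x := fun x => by
      rw [← ENNReal.rpow_natCast]; exact hsq x
    simp only [hsq] at h
    have e : ∫⁻ t, k s t * f t ∂μ = ∫⁻ t, ((fun t => (k s t * p t) ^ (1 / 2 : ℝ)) *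
        fun t => (k s t * ((p t)⁻¹ * f t ^ 2)) ^ (1 / 2 : ℝ)) t ∂μ := by
      refine lintegral_congr_ae ?_
      filter_upwards [hp0] with t ht
      rw [Pi.mul_apply, ← ENNReal.mul_rpow_of_nonneg _ _ (by norm_num)]
      have : k s t * p t * (k s t * ((p t)⁻¹ * f t ^ 2)) = (k s t * f t) ^ (2 : ℝ) := by
        calc _ = (p t * (p t)⁻¹) * (k s t * f t) ^ 2 := by ring
          _ = _ := by
            rw [ENNReal.mul_inv_cancel ht.1 ht.2, one_mul, ← ENNReal.rpow_natCast]; norm_num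
      rw [this, ← ENNReal.rpow_mul]; norm_num
    rw [e]
    calc _ ≤ _ := pow_le_pow_left' h 2
      _ = _ := by rw [mul_pow, hsq', hsq']
  have hm : AEMeasurable (Function.uncurry fun s t => q s * (k s t * ((p t)⁻¹ * f t ^ 2)))
      (μ.prod μ) := by
    refine (hq.comp measurable_fst).aemeasurable.mul (hk.aemeasurable.mul ?_)
    exact (hp.comp measurable_snd).inv.aemeasurable.mul (hf.comp_snd.pow_const 2)
  calc _ ≤ ∫⁻ s, (C * q s) * ∫⁻ t, k s t * ((p t)⁻¹ * f t ^ 2) ∂μ ∂μ := by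
        refine lintegral_mono_ae ?_
        filter_upwards [h1] with s hs
        exact (cs s).trans (by gcongr)
    _ ≤ ∫⁻ s, C * ∫⁻ t, q s * (k s t * ((p t)⁻¹ * f t ^ 2)) ∂μ ∂μ := by
        refine lintegral_mono fun s => ?_
        rw [mul_assoc]
        gcongr
        exact lintegral_const_mul_le _ _
    _ ≤ ∫⁻ s, ∫⁻ t, C * (q s * (k s t * ((p t)⁻¹ * f t ^ 2))) ∂μ ∂μ :=
        lintegral_mono fun s => lintegral_const_mul_le _ _
    _ = ∫⁻ t, ∫⁻ s, C * (q s * (k s t * ((p t)⁻¹ * f t ^ 2))) ∂μ ∂μ :=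
        lintegral_lintegral_swap (hm.const_mul C)
    _ = ∫⁻ t, C * ((p t)⁻¹ * f t ^ 2) * ∫⁻ s, k s t * q s ∂μ ∂μ := by
        refine lintegral_congr fun t => ?_
        have hmt : Measurable fun s => k s t * q s := hk.of_uncurry_right.mul hq
        rw [← lintegral_const_mul _ hmt]
        exact lintegral_congr fun s => by ring
    _ ≤ ∫⁻ t, C ^ 2 * f t ^ 2 ∂μ := by
        refine lintegral_mono_ae ?_
        filter_upwards [h2, hp0] with t ht ht0
        calc _ ≤ C * ((p t)⁻¹ * f t ^ 2) * (C * p t) := by gcongr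
          _ = C ^ 2 * f t ^ 2 * (p t * (p t)⁻¹) := by ring
          _ = _ := by rw [ENNReal.mul_inv_cancel ht0.1 ht0.2, mul_one]
    _ = _ := lintegral_const_mul'' _ (hf.pow_const 2)

/-- The weight `x ^ (-1/2)` is an eigenfunction of the Hilbert kernel `1 / (x + y)`. -/
lemma integral_hilbert_half {y : ℝ} (hy : 0 < y) :
    IntegrableOn (fun x => (x + y)⁻¹ * (Real.sqrt x)⁻¹) (Ioi 0) ∧
      ∫ x in Ioi (0 : ℝ), (x + y)⁻¹ * (Real.sqrt x)⁻¹ = Real.pi * (Real.sqrt y)⁻¹ := by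
  have hsy : 0 < Real.sqrt y := Real.sqrt_pos.2 hy
  have hd : ∀ x ∈ Ioi (0 : ℝ), HasDerivAt
      (fun x => 2 * (Real.sqrt y)⁻¹ * Real.arctan (Real.sqrt x / Real.sqrt y))
      ((x + y)⁻¹ * (Real.sqrt x)⁻¹) x := by
    intro x hx
    have hx0 : 0 < x := hx
    have hsx : 0 < Real.sqrt x := Real.sqrt_pos.2 hx0
    have := ((((hasDerivAt_id' x).sqrt hx0.ne').div_const (Real.sqrt y)).arctan).const_mul
      (2 * (Real.sqrt y)⁻¹)
    refine this.congr_deriv ?_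
    have e1 : x = Real.sqrt x ^ 2 := (Real.sq_sqrt hx0.le).symm
    have e2 : y = Real.sqrt y ^ 2 := (Real.sq_sqrt hy.le).symm
    rw [div_pow, ← e1, ← e2]
    have h3 : 1 + x / y = (x + y) / y := by field_simp; ring
    rw [h3]
    field_simp
    rw [← e2]
  have hc : ContinuousWithinAt
      (fun x => 2 * (Real.sqrt y)⁻¹ * Real.arctan (Real.sqrt x / Real.sqrt y)) (Ici 0) 0 := by
    refine Continuous.continuousWithinAt ?_
    have := Real.continuous_arctan
    fun_prop
  have hl : Tendsto (fun x => 2 * (Real.sqrt y)⁻¹ * Real.arctan (Real.sqrt x / Real.sqrt y)) atTop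
      (𝓝 (2 * (Real.sqrt y)⁻¹ * (Real.pi / 2))) :=
    ((tendsto_nhds_of_tendsto_nhdsWithin Real.tendsto_arctan_atTop).comp
      (Real.tendsto_sqrt_atTop.atTop_div_const hsy)).const_mul _
  have hpos : ∀ x ∈ Ioi (0 : ℝ), 0 ≤ (x + y)⁻¹ * (Real.sqrt x)⁻¹ := fun x hx => by
    have : 0 < x := hx
    positivity
  refine ⟨integrableOn_Ioi_deriv_of_nonneg hc hd hpos hl, ?_⟩
  rw [integral_Ioi_of_hasDerivAt_of_nonneg hc hd hpos hl]
  simp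
  ring

/-- The two-sided version of the integral of the Hilbert kernel, as a lower integral. -/
lemma lintegral_hilbert_half (c : ℝ) {y : ℝ} (hy : 0 < y) :
    ∫⁻ t, ENNReal.ofReal ((|t - c| + y)⁻¹) * ENNReal.ofReal ((Real.sqrt |t - c|)⁻¹) ≤
      ENNReal.ofReal (2 * Real.pi) * ENNReal.ofReal ((Real.sqrt y)⁻¹) := by
  set F : ℝ → ENNReal := fun x => ENNReal.ofReal ((|x| + y)⁻¹) *
    ENNReal.ofReal ((Real.sqrt |x|)⁻¹) with hF
  have h0 : ∫⁻ t, F (t - c) = ∫⁻ t, F t := lintegral_sub_right_eq_self F c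
  obtain ⟨hi, he⟩ := integral_hilbert_half hy
  have h1 : ∫⁻ x in Ioi (0 : ℝ), F x = ENNReal.ofReal (Real.pi * (Real.sqrt y)⁻¹) := by
    rw [← he, ofReal_integral_eq_lintegral_ofReal hi]
    · refine setLIntegral_congr_fun measurableSet_Ioi fun x hx => ?_
      have hx0 : 0 < x := hx
      simp only [hF, abs_of_pos hx0]
      rw [ENNReal.ofReal_mul (by positivity)]
    · filter_upwards [ae_restrict_mem measurableSet_Ioi] with x hx
      have hx0 : 0 < x := hx
      simp only [Pi.zero_apply]
      positivity
  have h2 : ∫⁻ x in Iio (0 : ℝ), F x = ∫⁻ x in Ioi (0 : ℝ), F x := by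
    have hmp : MeasurePreserving (fun x : ℝ => -x) volume volume :=
      Measure.measurePreserving_neg volume
    have := hmp.setLIntegral_comp_preimage (s := Ioi (0 : ℝ)) measurableSet_Ioi (f := F)
      (by fun_prop)
    rw [← this]
    have e : (fun x : ℝ => -x) ⁻¹' Ioi 0 = Iio 0 := by ext x; simp
    rw [e]
    simp only [hF, abs_neg]
  have h3 : ∫⁻ x, F x = (∫⁻ x in Iio (0 : ℝ), F x) + ∫⁻ x in Ioi (0 : ℝ), F x := by
    rw [← lintegral_add_compl F (measurableSet_Iio (a := (0 : ℝ))), compl_Iio,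
      setLIntegral_congr Ioi_ae_eq_Ici]
  change ∫⁻ t, F (t - c) ≤ _
  rw [h0, h3, h2, h1, ← two_mul, ENNReal.ofReal_mul (by norm_num : (0 : ℝ) ≤ 2),
    ENNReal.ofReal_mul Real.pi_pos.le]
  simp [mul_assoc]

/-- The Hilbert kernel centered at a point of the square is bounded on `L²`. -/
lemma memLp_hilbert (t₀ s₀ : ℝ) {f : ℝ → ℂ} (hf : MemLp f 2 (volume.restrict (Ioc (0 : ℝ) 1))) :
    MemLp (fun s => ∫ t in Ioc (0 : ℝ) 1, (|t - t₀| + |s - s₀|)⁻¹ * ‖f t‖) 2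
        (volume.restrict (Ioc (0 : ℝ) 1)) ∧
      eLpNorm (fun s => ∫ t in Ioc (0 : ℝ) 1, (|t - t₀| + |s - s₀|)⁻¹ * ‖f t‖) 2
        (volume.restrict (Ioc (0 : ℝ) 1)) ≤
      ENNReal.ofReal (2 * Real.pi) * eLpNorm f 2 (volume.restrict (Ioc (0 : ℝ) 1)) := by
  set μ := volume.restrict (Ioc (0 : ℝ) 1) with hμ
  have hne : ∀ c : ℝ, ∀ᵐ t ∂μ, t ≠ c := fun c => by
    have : ∀ᵐ t ∂(volume : Measure ℝ), t ≠ c := by simp [ae_iff, measure_singleton]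
    exact ae_restrict_of_ae this
  set H : ℝ → ℝ := fun s => ∫ t in Ioc (0 : ℝ) 1, (|t - t₀| + |s - s₀|)⁻¹ * ‖f t‖ with hH
  have hHm : AEStronglyMeasurable H μ := by
    have hm : Measurable fun p : ℝ × ℝ => (|p.2 - t₀| + |p.1 - s₀|)⁻¹ := by fun_prop
    have := (hm.aestronglyMeasurable (μ := μ.prod μ)).mul hf.aestronglyMeasurable.norm.comp_snd
    exact this.integral_prod_right'
  have hsch := lintegral_schur_le (μ := μ)
    (k := fun s t => ENNReal.ofReal ((|t - t₀| + |s - s₀|)⁻¹))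
    (p := fun t => ENNReal.ofReal ((Real.sqrt |t - t₀|)⁻¹))
    (q := fun s => ENNReal.ofReal ((Real.sqrt |s - s₀|)⁻¹)) (C := ENNReal.ofReal (2 * Real.pi))
    (by unfold Function.uncurry; fun_prop) (by fun_prop) (by fun_prop)
    (by
      filter_upwards [hne t₀] with t ht
      have : 0 < |t - t₀| := abs_pos.2 (sub_ne_zero.2 ht)
      have : 0 < (Real.sqrt |t - t₀|)⁻¹ := by positivity
      exact ⟨by simpa using this, ENNReal.ofReal_ne_top⟩)
    (by
      filter_upwards [hne s₀] with s hs
      exact (lintegral_mono' Measure.restrict_le_self le_rfl).trans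
        (lintegral_hilbert_half t₀ (abs_pos.2 (sub_ne_zero.2 hs))))
    (by
      filter_upwards [hne t₀] with t ht
      simp only [add_comm |t - t₀|]
      exact (lintegral_mono' Measure.restrict_le_self le_rfl).trans
        (lintegral_hilbert_half s₀ (abs_pos.2 (sub_ne_zero.2 ht))))
    (f := fun t => ‖f t‖ₑ) hf.aestronglyMeasurable.enorm
  have hpt : ∀ s, ‖H s‖ₑ ≤
      ∫⁻ t, ENNReal.ofReal ((|t - t₀| + |s - s₀|)⁻¹) * ‖f t‖ₑ ∂μ := by
    intro s
    refine (enorm_integral_le_lintegral_enorm _).trans (le_of_eq (lintegral_congr fun t => ?_))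
    rw [enorm_mul, enorm_norm, Real.enorm_of_nonneg (by positivity)]
  have hn : eLpNorm H 2 μ ≤ ENNReal.ofReal (2 * Real.pi) * eLpNorm f 2 μ := by
    have h2 : ∀ {E : Type} [NormedAddCommGroup E] (g : ℝ → E),
        eLpNorm g 2 μ = (∫⁻ t, ‖g t‖ₑ ^ 2 ∂μ) ^ (1 / 2 : ℝ) := by
      intro E _ g
      rw [eLpNorm_eq_lintegral_rpow_enorm_toReal (by norm_num) (by norm_num)]
      simp
    rw [h2, h2]
    calc _ ≤ (ENNReal.ofReal (2 * Real.pi) ^ 2 * ∫⁻ t, ‖f t‖ₑ ^ 2 ∂μ) ^ (1 / 2 : ℝ) := by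
          refine ENNReal.rpow_le_rpow (le_trans (lintegral_mono fun s => ?_) hsch) (by norm_num)
          exact pow_le_pow_left' (hpt s) 2
      _ = _ := by
          rw [ENNReal.mul_rpow_of_nonneg _ _ (by norm_num), ← ENNReal.rpow_natCast,
            ← ENNReal.rpow_mul]
          norm_num
  exact ⟨⟨hHm, hn.trans_lt (ENNReal.mul_lt_top ENNReal.ofReal_lt_top hf.2)⟩, hn⟩

/-! ### Cauchy integrals away from the curve and across transversal curves -/

/-- The Cauchy integral of an integrable density is analytic off the curve. -/
lemma differentiableAt_curveCauchy {γ : ℝ → ℂ} (hγ : ContDiff ℝ 2 γ) {f : ℝ → ℂ}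
    (hf : IntegrableOn f (Ioc (0 : ℝ) 1)) {z : ℂ} (hz : z ∉ γ '' Icc 0 1) :
    DifferentiableAt ℂ (curveCauchy γ f) z := by
  have hfI : IntervalIntegrable f volume 0 1 :=
    (intervalIntegrable_iff_integrableOn_Ioc_of_le zero_le_one).2 hf
  have hc := hγ.continuous
  have hcd : Continuous (deriv γ) := hγ.continuous_deriv (by norm_num)
  have hK : IsClosed (γ '' Icc 0 1) := (isCompact_Icc.image hc).isClosed
  obtain ⟨ρ, hρ, hball⟩ := Metric.isOpen_iff.1 hK.isOpen_compl z hz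
  obtain ⟨M, hM⟩ := (isCompact_Icc (a := (0 : ℝ)) (b := 1)).exists_bound_of_continuousOn
    hcd.continuousOn
  have hIoc : uIoc (0 : ℝ) 1 ⊆ Icc 0 1 := by
    rw [uIoc_of_le zero_le_one]; exact Ioc_subset_Icc_self
  have hfar : ∀ t ∈ Icc (0 : ℝ) 1, ∀ w ∈ Metric.ball z (ρ / 2), ρ / 2 ≤ ‖γ t - w‖ := by
    intro t ht w hw
    by_contra! h
    refine hball (a := γ t) ?_ ⟨t, ht, rfl⟩
    rw [Metric.mem_ball, dist_eq_norm] at hw ⊢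
    calc ‖γ t - z‖ = ‖(γ t - w) + (w - z)‖ := by congr 1; ring
      _ ≤ _ := norm_add_le _ _
      _ < ρ := by linarith
  have hne : ∀ t ∈ Icc (0 : ℝ) 1, ∀ w ∈ Metric.ball z (ρ / 2), γ t - w ≠ 0 := fun t ht w hw =>
    norm_pos_iff.1 (lt_of_lt_of_le (by positivity) (hfar t ht w hw))
  have hzb : z ∈ Metric.ball z (ρ / 2) := Metric.mem_ball_self (by positivity)
  have hm : ∀ w : ℂ, AEStronglyMeasurable (fun t => deriv γ t / (γ t - w) * f t)
      (volume.restrict (uIoc 0 1)) := by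
    intro w
    refine AEStronglyMeasurable.mul (Measurable.aestronglyMeasurable ?_)
      hfI.def'.aestronglyMeasurable
    have := hcd.measurable
    have := hc.measurable
    fun_prop
  have key := intervalIntegral.hasDerivAt_integral_of_dominated_loc_of_deriv_le
    (μ := volume) (a := 0) (b := 1) (x₀ := z) (s := Metric.ball z (ρ / 2))
    (F := fun w t => deriv γ t / (γ t - w) * f t)
    (F' := fun w t => deriv γ t / (γ t - w) ^ 2 * f t)
    (bound := fun t => M / (ρ / 2) ^ 2 * ‖f t‖)
    (Metric.ball_mem_nhds z (by positivity)) (Eventually.of_forall hm) ?_ ?_ ?_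
    (hfI.norm.const_mul _) ?_
  · exact key.2.differentiableAt
  · refine hfI.continuousOn_mul (ContinuousOn.div hcd.continuousOn (by fun_prop) fun t ht => ?_)
    rw [uIcc_of_le zero_le_one] at ht
    exact hne t ht z hzb
  · refine AEStronglyMeasurable.mul (Measurable.aestronglyMeasurable ?_)
      hfI.def'.aestronglyMeasurable
    have := hcd.measurable
    have := hc.measurable
    fun_prop
  · refine Eventually.of_forall fun t ht w hw => ?_
    rw [norm_mul, norm_div, norm_pow]
    gcongr
    · exact (norm_nonneg _).trans (hM t (hIoc ht))
    · exact hM t (hIoc ht)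
    · exact hfar t (hIoc ht) w hw
  · refine Eventually.of_forall fun t ht w hw => ?_
    have h0 := hne t (hIoc ht) w hw
    have h1 := (((hasDerivAt_const w (deriv γ t)).div ((hasDerivAt_id w).const_sub (γ t)) h0)).mul_const (f t)
    refine h1.congr_deriv ?_
    simp

/-- Chord-arc estimate: on a simple regular arc, the Cauchy kernel differs from the kernel of a
line by a bounded function. -/
lemma exists_kernel_bound_of_injOn {γ : ℝ → ℂ} (hγ : ContDiff ℝ 2 γ)
    (h' : ∀ s ∈ Icc (0 : ℝ) 1, deriv γ s ≠ 0) (hinj : InjOn γ (Icc 0 1)) :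
    ∃ B : ℝ, 0 ≤ B ∧ ∀ s ∈ Icc (0 : ℝ) 1, ∀ t ∈ Icc (0 : ℝ) 1, t ≠ s →
      ‖deriv γ t / (γ t - γ s) - 1 / ((t : ℂ) - s)‖ ≤ B := by
  obtain ⟨C, hC0, hC⟩ := exists_taylor_bound hγ 1
  have hcd : Continuous (deriv γ) := hγ.continuous_deriv (by norm_num)
  have hc := hγ.continuous
  obtain ⟨m, hm0, hm⟩ := (isCompact_Icc (a := (0 : ℝ)) (b := 1)).exists_forall_le'
    (f := fun t => ‖deriv γ t‖) (a := 0) hcd.norm.continuousOn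
    (fun t ht => norm_pos_iff.2 (h' t ht))
  set δ := m / (2 * (C + 1)) with hδ
  have hδ0 : 0 < δ := by positivity
  obtain ⟨d, hd0, hd⟩ : ∃ d : ℝ, 0 < d ∧ ∀ s ∈ Icc (0 : ℝ) 1, ∀ t ∈ Icc (0 : ℝ) 1,
      δ ≤ |t - s| → d ≤ ‖γ t - γ s‖ := by
    have hK : IsCompact ((Icc (0 : ℝ) 1 ×ˢ Icc (0 : ℝ) 1) ∩ {p : ℝ × ℝ | δ ≤ |p.2 - p.1|}) :=
      (isCompact_Icc.prod isCompact_Icc).inter_right (isClosed_le continuous_const (by fun_prop))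
    obtain ⟨d, hd0, hd⟩ := hK.exists_forall_le' (f := fun p => ‖γ p.2 - γ p.1‖) (a := 0)
      (Continuous.continuousOn (by fun_prop)) (by
        rintro ⟨s, t⟩ ⟨⟨hs, ht⟩, hst⟩
        refine norm_pos_iff.2 (sub_ne_zero.2 fun h => ?_)
        have : t = s := hinj ht hs h
        subst this
        simp at hst
        linarith)
    exact ⟨d, hd0, fun s hs t ht hst => hd (s, t) ⟨⟨hs, ht⟩, hst⟩⟩
  have hchord : ∀ s ∈ Icc (0 : ℝ) 1, ∀ t ∈ Icc (0 : ℝ) 1,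
      min (m / 2) d * |t - s| ≤ ‖γ t - γ s‖ := by
    intro s hs t ht
    rcases lt_or_ge |t - s| δ with h | h
    · have e := norm_sub_norm_le (deriv γ s * ((t : ℂ) - s)) (-(γ t - γ s - deriv γ s * ((t : ℂ) - s)))
      rw [norm_neg, sub_neg_eq_add, add_sub_cancel, norm_mul, ← Complex.ofReal_sub,
        Complex.norm_real, Real.norm_eq_abs] at e
      have h2 := (hC s hs t ht).2
      have h1 : m * |t - s| ≤ ‖deriv γ s‖ * |t - s| := by gcongr; exact hm s hs
      have h3 : C * |t - s| ^ 2 ≤ m / 2 * |t - s| := by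
        calc C * |t - s| ^ 2 = C * |t - s| * |t - s| := by ring
          _ ≤ (C + 1) * δ * |t - s| := by gcongr; linarith
          _ = m / 2 * |t - s| := by rw [hδ]; field_simp
      rw [Complex.ofReal_sub] at e
      calc _ ≤ m / 2 * |t - s| := by gcongr; exact min_le_left _ _
        _ ≤ _ := by linarith
    · have : |t - s| ≤ 1 := by rw [abs_le]; constructor <;> linarith [hs.1, hs.2, ht.1, ht.2]
      calc _ ≤ d * 1 := by gcongr; exact min_le_right _ _
        _ ≤ _ := by rw [mul_one]; exact hd s hs t ht h
  refine ⟨C * (1 + 1 ^ 2) / min (m / 2) d, by positivity, fun s hs t ht hts => ?_⟩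
  have e : ‖(t : ℂ) - s‖ = |t - s| := by
    rw [← Complex.ofReal_sub, Complex.norm_real, Real.norm_eq_abs]
  have h1 := norm_kernel_sub_le (k := 1) (w := (s : ℂ)) hC0
    (show 0 < min (m / 2) d by positivity) (hC s hs t ht).1 (hC s hs t ht).2
    (by rw [one_mul, e]) (by rw [e]; exact abs_pos.2 (sub_ne_zero.2 hts))
    (by rw [sub_self, mul_zero, add_zero, e]; exact hchord s hs t ht)
  simpa only [sub_self, mul_zero, add_zero] using h1

/-- Two curves without tangential contact meet for finitely many pairs of parameters, and their
Cauchy kernel is controlled by the Hilbert kernels centered at these pairs. -/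
lemma exists_meeting_bound {γ η : ℝ → ℂ} (hγ : ContDiff ℝ 2 γ) (hη : ContDiff ℝ 2 η)
    (htr : ∀ t ∈ Icc (0 : ℝ) 1, ∀ s ∈ Icc (0 : ℝ) 1, γ t = η s →
      ((starRingEnd ℂ) (deriv γ t) * deriv η s).im ≠ 0) :
    ∃ (S : Finset (ℝ × ℝ)) (C : ℝ), 0 ≤ C ∧
      ∀ x ∈ Icc (0 : ℝ) 1 ×ˢ Icc (0 : ℝ) 1, (γ x.1 = η x.2 → x ∈ S) ∧
        (γ x.1 ≠ η x.2 →
          ‖γ x.1 - η x.2‖⁻¹ ≤ C * (1 + ∑ p ∈ S, (|x.1 - p.1| + |x.2 - p.2|)⁻¹)) := by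
  classical
  refine (isCompact_Icc.prod isCompact_Icc).induction_on
    (p := fun A => ∃ (S : Finset (ℝ × ℝ)) (C : ℝ), 0 ≤ C ∧ ∀ x ∈ A, (γ x.1 = η x.2 → x ∈ S) ∧
        (γ x.1 ≠ η x.2 →
          ‖γ x.1 - η x.2‖⁻¹ ≤ C * (1 + ∑ p ∈ S, (|x.1 - p.1| + |x.2 - p.2|)⁻¹)))
    ⟨∅, 0, le_rfl, by simp⟩ ?_ ?_ ?_
  · rintro A A' hAA' ⟨S, C, hC, h⟩
    exact ⟨S, C, hC, fun x hx => h x (hAA' hx)⟩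
  · rintro A A' ⟨S, C, hC, h⟩ ⟨S', C', hC', h'⟩
    have hsum : ∀ (x : ℝ × ℝ) (U V : Finset (ℝ × ℝ)), U ⊆ V →
        0 ≤ ∑ p ∈ U, (|x.1 - p.1| + |x.2 - p.2|)⁻¹ ∧
        ∑ p ∈ U, (|x.1 - p.1| + |x.2 - p.2|)⁻¹ ≤ ∑ p ∈ V, (|x.1 - p.1| + |x.2 - p.2|)⁻¹ :=
      fun x U V hUV => ⟨Finset.sum_nonneg fun p _ => by positivity,
        Finset.sum_le_sum_of_subset_of_nonneg hUV fun p _ _ => by positivity⟩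
    refine ⟨S ∪ S', C + C', by positivity, ?_⟩
    rintro x (hx | hx)
    · refine ⟨fun e => Finset.mem_union_left _ ((h x hx).1 e), fun e => ?_⟩
      obtain ⟨h0, h1⟩ := hsum x S (S ∪ S') Finset.subset_union_left
      refine ((h x hx).2 e).trans ?_
      gcongr
      linarith
    · refine ⟨fun e => Finset.mem_union_right _ ((h' x hx).1 e), fun e => ?_⟩
      obtain ⟨h0, h1⟩ := hsum x S' (S ∪ S') Finset.subset_union_right
      refine ((h' x hx).2 e).trans ?_
      gcongr
      linarith
  · rintro ⟨t₀, s₀⟩ ⟨ht₀, hs₀⟩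
    by_cases heq : γ t₀ = η s₀
    · obtain ⟨C₁, hC₁, h₁⟩ := exists_taylor_bound hγ 1
      obtain ⟨C₂, hC₂, h₂⟩ := exists_taylor_bound hη 1
      set α := deriv γ t₀ with hα
      set β := deriv η s₀ with hβ
      set D := |((starRingEnd ℂ) α * β).im| with hD
      have hD0 : 0 < D := abs_pos.2 (htr t₀ ht₀ s₀ hs₀ heq)
      have hαβ : 0 < ‖α‖ + ‖β‖ := by
        have : α ≠ 0 := fun h => htr t₀ ht₀ s₀ hs₀ heq (by rw [← hα, h]; simp)
        have := norm_pos_iff.2 this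
        positivity
      -- transversality: the two tangent vectors are linearly independent over the reals
      have hlin : ∀ u v : ℝ, D * (|u| + |v|) ≤ (‖α‖ + ‖β‖) * ‖α * u - β * v‖ := by
        intro u v
        have e1 : D * |v| ≤ ‖α‖ * ‖α * u - β * v‖ := by
          rw [hD, ← abs_mul, ← Complex.norm_conj α, ← norm_mul]
          refine le_trans (le_of_eq ?_) (Complex.abs_im_le_norm _)
          rw [← abs_neg]
          congr 1
          simp
          ring
        have e2 : D * |u| ≤ ‖β‖ * ‖α * u - β * v‖ := by
          rw [hD, ← abs_mul, ← Complex.norm_conj β, ← norm_mul]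
          refine le_trans (le_of_eq ?_) (Complex.abs_im_le_norm _)
          rw [← abs_neg]
          congr 1
          simp
          ring
        linarith
      set c := D / (‖α‖ + ‖β‖) with hc
      have hc0 : 0 < c := by positivity
      -- within `δ`, the quadratic errors are at most half of the linear lower bound
      set δ := c / (2 * (C₁ + C₂ + 1)) with hδ
      have hδ0 : 0 < δ := by positivity
      have hlow : ∀ t ∈ Icc (0 : ℝ) 1, ∀ s ∈ Icc (0 : ℝ) 1, |t - t₀| < δ → |s - s₀| < δ →
          c / 2 * (|t - t₀| + |s - s₀|) ≤ ‖γ t - η s‖ := by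
        intro t ht s hs htδ hsδ
        have l1 := hlin (t - t₀) (s - s₀)
        have l2 : c * (|t - t₀| + |s - s₀|) ≤
            ‖α * ((t - t₀ : ℝ) : ℂ) - β * ((s - s₀ : ℝ) : ℂ)‖ := by
          rw [hc, div_mul_eq_mul_div, div_le_iff₀ hαβ]; linarith
        have e : α * ((t - t₀ : ℝ) : ℂ) - β * ((s - s₀ : ℝ) : ℂ) = (γ t - η s) -
            (γ t - γ t₀ - α * ((t : ℂ) - t₀)) + (η s - η s₀ - β * ((s : ℂ) - s₀)) := by
          rw [heq]; push_cast; ring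
        have l3 : ‖α * ((t - t₀ : ℝ) : ℂ) - β * ((s - s₀ : ℝ) : ℂ)‖ ≤
            ‖γ t - η s‖ + C₁ * |t - t₀| ^ 2 + C₂ * |s - s₀| ^ 2 := by
          rw [e]
          refine (norm_add_le _ _).trans (add_le_add ((norm_sub_le _ _).trans ?_)
            (h₂ s₀ hs₀ s hs).2)
          gcongr
          exact (h₁ t₀ ht₀ t ht).2
        have l4 : C₁ * |t - t₀| ^ 2 + C₂ * |s - s₀| ^ 2 ≤ c / 2 * (|t - t₀| + |s - s₀|) := by
          calc C₁ * |t - t₀| ^ 2 + C₂ * |s - s₀| ^ 2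
              = C₁ * |t - t₀| * |t - t₀| + C₂ * |s - s₀| * |s - s₀| := by ring
            _ ≤ (C₁ + C₂ + 1) * δ * |t - t₀| + (C₁ + C₂ + 1) * δ * |s - s₀| := by
              gcongr <;> linarith
            _ = (C₁ + C₂ + 1) * δ * (|t - t₀| + |s - s₀|) := by ring
            _ = _ := by rw [hδ]; field_simp
        linarith
      refine ⟨(Icc (0 : ℝ) 1 ×ˢ Icc (0 : ℝ) 1) ∩ Metric.ball (t₀, s₀) δ,
        inter_mem self_mem_nhdsWithin (mem_nhdsWithin_of_mem_nhds (Metric.ball_mem_nhds _ hδ0)),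
        {(t₀, s₀)}, 2 / c, by positivity, ?_⟩
      rintro ⟨t, s⟩ ⟨⟨ht, hs⟩, hb⟩
      rw [Metric.mem_ball, Prod.dist_eq, max_lt_iff, Real.dist_eq, Real.dist_eq] at hb
      have hl := hlow t ht s hs hb.1 hb.2
      dsimp only
      refine ⟨fun h => ?_, fun h => ?_⟩
      · rw [h, sub_self, norm_zero] at hl
        have h0 : |t - t₀| + |s - s₀| ≤ 0 := by
          by_contra! h0
          have : 0 < c / 2 * (|t - t₀| + |s - s₀|) := by positivity
          linarith
        have e1 : |t - t₀| = 0 := by linarith [abs_nonneg (t - t₀), abs_nonneg (s - s₀)]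
        have e2 : |s - s₀| = 0 := by linarith [abs_nonneg (t - t₀), abs_nonneg (s - s₀)]
        rw [abs_eq_zero, sub_eq_zero] at e1 e2
        simp [e1, e2]
      · rw [Finset.sum_singleton]
        have hpos : 0 < |t - t₀| + |s - s₀| := by
          by_contra! h0
          have e1 : |t - t₀| = 0 := by linarith [abs_nonneg (t - t₀), abs_nonneg (s - s₀)]
          have e2 : |s - s₀| = 0 := by linarith [abs_nonneg (t - t₀), abs_nonneg (s - s₀)]
          rw [abs_eq_zero, sub_eq_zero] at e1 e2
          exact h (by rw [e1, e2, heq])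
        calc ‖γ t - η s‖⁻¹ ≤ (c / 2 * (|t - t₀| + |s - s₀|))⁻¹ := by gcongr
          _ = 2 / c * (|t - t₀| + |s - s₀|)⁻¹ := by rw [mul_inv, inv_div]
          _ ≤ _ := by gcongr; linarith
    · have hd : 0 < ‖γ t₀ - η s₀‖ := norm_pos_iff.2 (sub_ne_zero.2 heq)
      have hc : Continuous fun x : ℝ × ℝ => ‖γ x.1 - η x.2‖ := by
        have := hγ.continuous
        have := hη.continuous
        fun_prop
      have hev : ∀ᶠ x in 𝓝 (t₀, s₀), ‖γ t₀ - η s₀‖ / 2 < ‖γ x.1 - η x.2‖ :=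
        hc.continuousAt.eventually_const_lt (by simpa using hd)
      refine ⟨_, mem_nhdsWithin_of_mem_nhds hev, ∅, 2 / ‖γ t₀ - η s₀‖, by positivity, ?_⟩
      intro x hx
      have hx' : ‖γ t₀ - η s₀‖ / 2 < ‖γ x.1 - η x.2‖ := hx
      refine ⟨fun e => ?_, fun e => ?_⟩
      · rw [e, sub_self, norm_zero] at hx'
        linarith
      · rw [Finset.sum_empty, add_zero, mul_one, ← inv_div]
        gcongr

/-- The parameters at which one curve meets another one transversally form a null set. -/
lemma ae_notMem_of_transversal {γ η : ℝ → ℂ} (hγ : ContDiff ℝ 2 γ) (hη : ContDiff ℝ 2 η)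
    (htr : ∀ t ∈ Icc (0 : ℝ) 1, ∀ s ∈ Icc (0 : ℝ) 1, γ t = η s →
      ((starRingEnd ℂ) (deriv γ t) * deriv η s).im ≠ 0) :
    ∀ᵐ s ∂volume.restrict (Ioc (0 : ℝ) 1), η s ∉ γ '' Icc 0 1 := by
  classical
  obtain ⟨S, C, -, hS⟩ := exists_meeting_bound hγ hη htr
  have hnull : ∀ᵐ s ∂(volume : Measure ℝ), s ∉ S.image Prod.snd :=
    by
      have h := (S.image Prod.snd).finite_toSet.measure_zero volume
      simp only [ae_iff, not_not]
      exact h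
  filter_upwards [ae_restrict_of_ae hnull, ae_restrict_mem measurableSet_Ioc] with s hs hs1
  rintro ⟨t, ht, e⟩
  exact hs (Finset.mem_image.2 ⟨(t, s), (hS (t, s) ⟨ht, Ioc_subset_Icc_self hs1⟩).1 e, rfl⟩)

/-- The Cauchy integral along one curve, restricted to another curve without tangential contact,
is a bounded operator on `L²`. -/
lemma exists_boundary_cross {γ η : ℝ → ℂ} (hγ : ContDiff ℝ 2 γ) (hη : ContDiff ℝ 2 η)
    (htr : ∀ t ∈ Icc (0 : ℝ) 1, ∀ s ∈ Icc (0 : ℝ) 1, γ t = η s →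
      ((starRingEnd ℂ) (deriv γ t) * deriv η s).im ≠ 0) :
    ∃ B : ℝ, 0 ≤ B ∧ ∀ f : ℝ → ℂ, MemLp f 2 (volume.restrict (Ioc (0 : ℝ) 1)) →
      MemLp (fun s => curveCauchy γ f (η s)) 2 (volume.restrict (Ioc (0 : ℝ) 1)) ∧
      eLpNorm (fun s => curveCauchy γ f (η s)) 2 (volume.restrict (Ioc (0 : ℝ) 1)) ≤
        ENNReal.ofReal B * eLpNorm f 2 (volume.restrict (Ioc (0 : ℝ) 1)) := by
  obtain ⟨S, C, hC0, hS⟩ := exists_meeting_bound hγ hη htr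
  have hcd : Continuous (deriv γ) := hγ.continuous_deriv (by norm_num)
  have hc := hγ.continuous
  obtain ⟨M, hM⟩ := (isCompact_Icc (a := (0 : ℝ)) (b := 1)).exists_bound_of_continuousOn
    hcd.continuousOn
  have hM0 : 0 ≤ M := (norm_nonneg _).trans (hM 0 (by simp))
  set μ := volume.restrict (Ioc (0 : ℝ) 1) with hμ
  have : IsProbabilityMeasure μ := ⟨by simp [hμ]⟩
  refine ⟨M * C * (1 + S.card * (2 * Real.pi)), by positivity, fun f hf => ?_⟩
  set g : ℝ → ℂ := fun s => curveCauchy γ f (η s) with hg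
  have hgm : AEStronglyMeasurable g μ := by
    have hm : Measurable fun p : ℝ × ℝ => deriv γ p.2 / (γ p.2 - η p.1) := by
      have := hcd.measurable
      have := hc.measurable
      have := hη.continuous.measurable
      fun_prop
    have := (hm.aestronglyMeasurable (μ := μ.prod μ)).mul hf.aestronglyMeasurable.comp_snd
    simp only [hg, curveCauchy, intervalIntegral.integral_of_le zero_le_one]
    exact this.integral_prod_right'
  set H : ℝ × ℝ → ℝ → ℝ := fun p s => ∫ t in Ioc (0 : ℝ) 1, (|t - p.1| + |s - p.2|)⁻¹ * ‖f t‖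
    with hH
  set X : ℝ := (eLpNorm f 2 μ).toReal with hX
  have hfi : Integrable f μ := hf.integrable (by norm_num)
  have hbound : ∀ᵐ s ∂μ, ‖g s‖ ≤ ‖(M * C) • (X + ∑ p ∈ S, H p s)‖ := by
    have hnull : ∀ᵐ s ∂μ, ∀ p ∈ S, s ≠ p.2 := by
      rw [Filter.eventually_all_finset]
      intro p _
      have : ∀ᵐ t ∂(volume : Measure ℝ), t ≠ p.2 := by simp [ae_iff, measure_singleton]
      exact ae_restrict_of_ae this
    filter_upwards [hnull, ae_restrict_mem measurableSet_Ioc,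
      ae_notMem_of_transversal hγ hη htr] with s hs hs1 hs2
    have hHi : ∀ p ∈ S, Integrable (fun t => (|t - p.1| + |s - p.2|)⁻¹ * ‖f t‖) μ := by
      intro p hp
      have hpos : 0 < |s - p.2| := abs_pos.2 (sub_ne_zero.2 (hs p hp))
      refine Integrable.bdd_mul (c := |s - p.2|⁻¹) hfi.norm
        (Measurable.aestronglyMeasurable (by fun_prop)) (Eventually.of_forall fun t => ?_)
      rw [Real.norm_of_nonneg (by positivity)]
      gcongr
      linarith [abs_nonneg (t - p.1)]
    have hpos : 0 ≤ X + ∑ p ∈ S, H p s := by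
      have : 0 ≤ ∑ p ∈ S, H p s :=
        Finset.sum_nonneg fun p _ => integral_nonneg fun t => by positivity
      have : 0 ≤ X := ENNReal.toReal_nonneg
      positivity
    rw [smul_eq_mul, Real.norm_of_nonneg (by positivity)]
    calc ‖g s‖ ≤ ∫ t, (M * C) * (‖f t‖ + ∑ p ∈ S, (|t - p.1| + |s - p.2|)⁻¹ * ‖f t‖) ∂μ := by
          simp only [hg, curveCauchy, intervalIntegral.integral_of_le zero_le_one]
          refine norm_integral_le_of_norm_le
            ((hfi.norm.add (integrable_finsetSum _ hHi)).const_mul _) ?_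
          filter_upwards [ae_restrict_mem measurableSet_Ioc] with t ht
          have ht' := Ioc_subset_Icc_self ht
          have h1 := (hS (t, s) ⟨ht', Ioc_subset_Icc_self hs1⟩).2 fun e => hs2 ⟨t, ht', e⟩
          rw [norm_mul, norm_div, div_eq_mul_inv, ← Finset.sum_mul]
          calc _ ≤ M * (C * (1 + ∑ p ∈ S, (|t - p.1| + |s - p.2|)⁻¹)) * ‖f t‖ := by
                gcongr
                exact hM t ht'
            _ = _ := by ring
      _ = (M * C) * ((∫ t, ‖f t‖ ∂μ) + ∑ p ∈ S, H p s) := by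
          rw [integral_const_mul, integral_add hfi.norm (integrable_finsetSum _ hHi),
            integral_finsetSum _ hHi]
      _ ≤ _ := by
          gcongr
          exact integral_norm_le_eLpNorm_two f hf
  have hHm : ∀ p ∈ S, MemLp (H p) 2 μ := fun p _ => (memLp_hilbert p.1 p.2 hf).1
  have hsum : (fun s => X + ∑ p ∈ S, H p s) = (fun _ => X) + ∑ p ∈ S, H p := by
    funext s; simp
  have hSm : MemLp (∑ p ∈ S, H p) 2 μ := memLp_finsetSum' S hHm
  have hn : eLpNorm g 2 μ ≤
      ENNReal.ofReal (M * C * (1 + S.card * (2 * Real.pi))) * eLpNorm f 2 μ := by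
    calc eLpNorm g 2 μ ≤ eLpNorm ((M * C) • fun s => X + ∑ p ∈ S, H p s) 2 μ :=
          eLpNorm_mono_ae hbound
      _ = ENNReal.ofReal (M * C) * eLpNorm ((fun _ => X) + ∑ p ∈ S, H p) 2 μ := by
          rw [eLpNorm_const_smul, hsum, Real.enorm_of_nonneg (by positivity)]
      _ ≤ ENNReal.ofReal (M * C) * (eLpNorm f 2 μ +
          ∑ p ∈ S, ENNReal.ofReal (2 * Real.pi) * eLpNorm f 2 μ) := by
          gcongr
          refine (eLpNorm_add_le aestronglyMeasurable_const hSm.1 (by norm_num)).trans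
            (add_le_add ?_ ((eLpNorm_sum_le (fun p hp => (hHm p hp).1) (by norm_num)).trans
              (Finset.sum_le_sum fun p _ => (memLp_hilbert p.1 p.2 hf).2)))
          refine (eLpNorm_le_of_ae_bound (C := X) (Eventually.of_forall fun s => ?_)).trans
            (le_of_eq ?_)
          · rw [Real.norm_of_nonneg ENNReal.toReal_nonneg]
          · rw [measure_univ, ENNReal.one_rpow, one_mul, ENNReal.ofReal_toReal hf.eLpNorm_ne_top]
      _ = _ := by
          rw [Finset.sum_const, nsmul_eq_mul, ENNReal.ofReal_mul (p := M * C) (by positivity),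
            ENNReal.ofReal_add (by norm_num) (by positivity),
            ENNReal.ofReal_mul (p := (S.card : ℝ)) (by positivity), ENNReal.ofReal_one,
            ENNReal.ofReal_natCast]
          ring
  exact ⟨⟨hgm, hn.trans_lt (ENNReal.mul_lt_top ENNReal.ofReal_lt_top hf.2)⟩, hn⟩

/-! ### Measures carried by parametrized curves -/

/-- A curve which is injective on the open parameter interval transports measures faithfully. -/
lemma map_eq_map_comap_Ioo {γ : ℝ → ℂ} (hγ : Continuous γ) {ν : Measure ℝ}
    (hν : ν (Ioo (0 : ℝ) 1)ᶜ = 0) :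
    ν.map γ = (ν.comap ((↑) : Ioo (0 : ℝ) 1 → ℝ)).map (fun t : Ioo (0 : ℝ) 1 => γ t) := by
  have h1 : ν.restrict (Ioo (0 : ℝ) 1) = ν := Measure.restrict_eq_self_of_ae_mem (by
    rw [ae_iff]; exact hν)
  conv_lhs => rw [← h1, ← map_comap_subtype_coe measurableSet_Ioo ν,
    Measure.map_map hγ.measurable measurable_subtype_coe]
  rfl

lemma measurableEmbedding_Ioo {γ : ℝ → ℂ} (hγ : Continuous γ) (hinj : InjOn γ (Ioo 0 1)) :
    MeasurableEmbedding (fun t : Ioo (0 : ℝ) 1 => γ t) := by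
  have : StandardBorelSpace (Ioo (0 : ℝ) 1) := measurableSet_Ioo.standardBorel
  exact (hγ.comp continuous_subtype_val).measurable.measurableEmbedding
    (injOn_iff_injective.1 hinj)

lemma ae_map_curve_iff {γ : ℝ → ℂ} (hγ : Continuous γ) (hinj : InjOn γ (Ioo 0 1))
    {ν : Measure ℝ} (hν : ν (Ioo (0 : ℝ) 1)ᶜ = 0) {Q : ℂ → Prop} :
    (∀ᵐ z ∂ν.map γ, Q z) ↔ ∀ᵐ t ∂ν, Q (γ t) := by
  have h1 : ν.restrict (Ioo (0 : ℝ) 1) = ν := Measure.restrict_eq_self_of_ae_mem (by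
    rw [ae_iff]; exact hν)
  rw [map_eq_map_comap_Ioo hγ hν, (measurableEmbedding_Ioo hγ hinj).ae_map_iff]
  conv_rhs => rw [← h1, ← map_comap_subtype_coe measurableSet_Ioo ν,
    (MeasurableEmbedding.subtype_coe measurableSet_Ioo).ae_map_iff]

lemma aestronglyMeasurable_map_curve_iff {E : Type*} [TopologicalSpace E] {γ : ℝ → ℂ}
    (hγ : Continuous γ) (hinj : InjOn γ (Ioo 0 1)) {ν : Measure ℝ}
    (hν : ν (Ioo (0 : ℝ) 1)ᶜ = 0) {g : ℂ → E} :
    AEStronglyMeasurable g (ν.map γ) ↔ AEStronglyMeasurable (fun t => g (γ t)) ν := by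
  have h1 : ν.restrict (Ioo (0 : ℝ) 1) = ν := Measure.restrict_eq_self_of_ae_mem (by
    rw [ae_iff]; exact hν)
  rw [map_eq_map_comap_Ioo hγ hν, (measurableEmbedding_Ioo hγ hinj).aestronglyMeasurable_map_iff]
  conv_rhs => rw [← h1, ← map_comap_subtype_coe measurableSet_Ioo ν,
    (MeasurableEmbedding.subtype_coe measurableSet_Ioo).aestronglyMeasurable_map_iff]
  rfl

lemma eLpNorm_map_curve {E : Type*} [NormedAddCommGroup E] {γ : ℝ → ℂ}
    (hγ : Continuous γ) (hinj : InjOn γ (Ioo 0 1)) {ν : Measure ℝ}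
    (hν : ν (Ioo (0 : ℝ) 1)ᶜ = 0) (g : ℂ → E) :
    eLpNorm g 2 (ν.map γ) = eLpNorm (fun t => g (γ t)) 2 ν := by
  have h1 : ν.restrict (Ioo (0 : ℝ) 1) = ν := Measure.restrict_eq_self_of_ae_mem (by
    rw [ae_iff]; exact hν)
  rw [map_eq_map_comap_Ioo hγ hν, (measurableEmbedding_Ioo hγ hinj).eLpNorm_map_measure]
  conv_rhs => rw [← h1, ← map_comap_subtype_coe measurableSet_Ioo ν,
    (MeasurableEmbedding.subtype_coe measurableSet_Ioo).eLpNorm_map_measure]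
  rfl

lemma eLpNorm_two_eq {α E : Type*} [MeasurableSpace α] [NormedAddCommGroup E] (g : α → E)
    (μ : Measure α) : eLpNorm g 2 μ = (∫⁻ t, ‖g t‖ₑ ^ 2 ∂μ) ^ (1 / 2 : ℝ) := by
  rw [eLpNorm_eq_lintegral_rpow_enorm_toReal (by norm_num) (by norm_num)]
  simp

/-- The `L²` norm is subadditive in the measure. -/
lemma eLpNorm_finset_sum_measure_le {α E ι : Type*} [MeasurableSpace α] [NormedAddCommGroup E]
    (g : α → E) (μ : ι → Measure α) (s : Finset ι) :
    eLpNorm g 2 (∑ i ∈ s, μ i) ≤ ∑ i ∈ s, eLpNorm g 2 (μ i) := by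
  classical
  induction s using Finset.induction_on with
  | empty => simp
  | insert i s hi ih =>
    rw [Finset.sum_insert hi, Finset.sum_insert hi]
    refine le_trans ?_ (add_le_add le_rfl ih)
    rw [eLpNorm_two_eq, eLpNorm_two_eq, eLpNorm_two_eq, lintegral_add_measure]
    exact ENNReal.rpow_add_le_add_rpow _ _ (by norm_num) (by norm_num)

/-! ### The pieces of the error contour -/

/-- A circle traversed clockwise, parametrized over `[0, 1]`. -/
noncomputable def clockwiseCircle (c : ℂ) (r : ℝ) (t : ℝ) : ℂ :=
  circleMap c r (-(2 * Real.pi * t))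

lemma clockwiseCircle_eq (c : ℂ) (r t : ℝ) :
    clockwiseCircle c r t = c + r * (modelCircle 1 t)⁻¹ := by
  rw [clockwiseCircle, circleMap, modelCircle, ← Complex.exp_neg]
  congr 3
  push_cast
  ring

lemma hasDerivAt_clockwiseCircle (c : ℂ) (r t : ℝ) :
    HasDerivAt (clockwiseCircle c r) (-(2 * Real.pi * Complex.I) * r * (modelCircle 1 t)⁻¹) t := by
  have h := (((hasDerivAt_modelCircle 1 t).inv (modelCircle_ne_zero 1 t)).const_mul (r : ℂ)).const_add c
  have e : clockwiseCircle c r = fun t => c + r * (modelCircle 1)⁻¹ t := by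
    funext t; rw [clockwiseCircle_eq]; rfl
  rw [e]
  refine h.congr_deriv ?_
  have := modelCircle_ne_zero 1 t
  field_simp
  simp

lemma deriv_clockwiseCircle (c : ℂ) (r t : ℝ) :
    deriv (clockwiseCircle c r) t = -(2 * Real.pi * Complex.I) * r * (modelCircle 1 t)⁻¹ :=
  (hasDerivAt_clockwiseCircle c r t).deriv

lemma contDiff_clockwiseCircle (c : ℂ) (r : ℝ) : ContDiff ℝ 2 (clockwiseCircle c r) := by
  have e : clockwiseCircle c r = fun t => c + r * (modelCircle 1 t)⁻¹ :=
    funext fun t => clockwiseCircle_eq c r t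
  rw [e]
  exact contDiff_const.add (contDiff_const.mul
    ((contDiff_modelCircle 1).inv fun t => modelCircle_ne_zero 1 t))

lemma deriv_clockwiseCircle_ne_zero (c : ℂ) {r : ℝ} (hr : 0 < r) (t : ℝ) :
    deriv (clockwiseCircle c r) t ≠ 0 := by
  rw [deriv_clockwiseCircle]
  have : (r : ℂ) ≠ 0 := by exact_mod_cast hr.ne'
  exact mul_ne_zero (mul_ne_zero (neg_ne_zero.2 Complex.two_pi_I_ne_zero) this)
    (inv_ne_zero (modelCircle_ne_zero 1 t))

lemma clockwiseCircle_ne (c : ℂ) {r : ℝ} (hr : 0 < r) {s t : ℝ} (hs : s ∈ Ioo (0 : ℝ) 1)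
    (ht : t ∈ Icc (0 : ℝ) 1) (hts : t ≠ s) : clockwiseCircle c r t ≠ clockwiseCircle c r s := by
  intro h
  rw [clockwiseCircle_eq, clockwiseCircle_eq] at h
  have hr' : (r : ℂ) ≠ 0 := by exact_mod_cast hr.ne'
  have h1 := inv_injective (mul_left_cancel₀ hr' (add_left_cancel h))
  refine hts (modelCircle_injOn one_pos ?_ h1)
  rw [abs_lt]; constructor <;> linarith [hs.1, hs.2, ht.1, ht.2]

lemma image_clockwiseCircle (c : ℂ) {r : ℝ} (hr : 0 < r) :
    clockwiseCircle c r '' Icc 0 1 = Metric.sphere c r := by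
  ext z
  constructor
  · rintro ⟨t, -, rfl⟩
    exact circleMap_mem_sphere c hr.le _
  · intro hz
    have hz' : z ∈ circleMap c r '' Ioc 0 (2 * Real.pi) := by
      rw [image_circleMap_Ioc, abs_of_pos hr]; exact hz
    obtain ⟨θ, hθ, rfl⟩ := hz'
    have hpi := Real.pi_pos
    refine ⟨1 - θ / (2 * Real.pi), ⟨?_, ?_⟩, ?_⟩
    · rw [sub_nonneg, div_le_one (by positivity)]; exact hθ.2
    · have : 0 ≤ θ / (2 * Real.pi) := div_nonneg hθ.1.le (by positivity)
      linarith
    · rw [clockwiseCircle, show -(2 * Real.pi * (1 - θ / (2 * Real.pi))) = θ - 2 * Real.pi by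
        field_simp; ring]
      exact (periodic_circleMap c r).sub_eq θ

/-- For a clockwise circle, the comparison of Cauchy kernels with the model circle is exact up to a
constant. -/
lemma norm_kernel_clockwiseCircle_le (c : ℂ) {r : ℝ} (hr : 0 < r) {s t : ℝ}
    (hs : s ∈ Ioo (0 : ℝ) 1) (ht : t ∈ Icc (0 : ℝ) 1) (hts : t ≠ s) :
    ‖deriv (clockwiseCircle c r) t / (clockwiseCircle c r t - clockwiseCircle c r s) -
      deriv (modelCircle 1) t / (modelCircle 1 t - modelCircle 1 s)‖ ≤ 2 * Real.pi := by
  have hr' : (r : ℂ) ≠ 0 := by exact_mod_cast hr.ne'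
  have h1 := modelCircle_ne_zero 1 t
  have h2 := modelCircle_ne_zero 1 s
  have h3 : modelCircle 1 t - modelCircle 1 s ≠ 0 := by
    intro h
    refine hts (modelCircle_injOn one_pos ?_ (sub_eq_zero.1 h))
    rw [abs_lt]; constructor <;> linarith [hs.1, hs.2, ht.1, ht.2]
  have e1 : clockwiseCircle c r t - clockwiseCircle c r s =
      -(r * (modelCircle 1 t - modelCircle 1 s) * (modelCircle 1 t)⁻¹ * (modelCircle 1 s)⁻¹) := by
    rw [clockwiseCircle_eq, clockwiseCircle_eq]; field_simp; ring
  have e : deriv (clockwiseCircle c r) t / (clockwiseCircle c r t - clockwiseCircle c r s) -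
      deriv (modelCircle 1) t / (modelCircle 1 t - modelCircle 1 s) =
        -(2 * Real.pi * Complex.I) := by
    rw [e1, deriv_clockwiseCircle, deriv_modelCircle]
    field_simp
    simp
  rw [e]
  simp [abs_of_pos Real.pi_pos]

namespace ContourData

variable {Γ : ContourData}

lemma param_hardCircle : Γ.param .hardCircle = clockwiseCircle 0 Γ.r₀ := rfl

lemma param_softCircle : Γ.param .softCircle = clockwiseCircle Γ.x₀ Γ.r₁ := rfl

lemma contDiff_param (p : Piece) : ContDiff ℝ 2 (Γ.param p) := by
  cases p with
  | hardCircle => exact contDiff_clockwiseCircle _ _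
  | softCircle => exact contDiff_clockwiseCircle _ _
  | lip ch s => exact (Γ.lip ch s).contDiff

lemma continuous_param (p : Piece) : Continuous (Γ.param p) := (contDiff_param p).continuous

lemma continuous_deriv_param (p : Piece) : Continuous (deriv (Γ.param p)) :=
  (contDiff_param p).continuous_deriv (by norm_num)

lemma IsRegular.deriv_param_ne_zero (hΓ : Γ.IsRegular) (p : Piece) :
    ∀ t ∈ Icc (0 : ℝ) 1, deriv (Γ.param p) t ≠ 0 := by
  cases p with
  | hardCircle => exact fun t _ => deriv_clockwiseCircle_ne_zero _ hΓ.r₀_pos t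
  | softCircle => exact fun t _ => deriv_clockwiseCircle_ne_zero _ hΓ.r₁_pos t
  | lip ch s => exact (Γ.lip ch s).deriv_ne_zero

lemma IsRegular.param_ne (hΓ : Γ.IsRegular) (p : Piece) :
    ∀ s ∈ Ioo (0 : ℝ) 1, ∀ t ∈ Icc (0 : ℝ) 1, t ≠ s → Γ.param p t ≠ Γ.param p s := by
  cases p with
  | hardCircle => exact fun s hs t ht hts => clockwiseCircle_ne _ hΓ.r₀_pos hs ht hts
  | softCircle => exact fun s hs t ht hts => clockwiseCircle_ne _ hΓ.r₁_pos hs ht hts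
  | lip ch sd =>
    exact fun s hs t ht hts h => hts ((Γ.lip ch sd).injOn ht (Ioo_subset_Icc_self hs) h)

lemma IsRegular.injOn_param (hΓ : Γ.IsRegular) (p : Piece) : InjOn (Γ.param p) (Ioo 0 1) := by
  intro s hs t ht h
  by_contra hst
  exact hΓ.param_ne p s hs t (Ioo_subset_Icc_self ht) (Ne.symm hst) h.symm

lemma IsRegular.sigmaR_eq (hΓ : Γ.IsRegular) : Γ.sigmaR = ⋃ p, Γ.param p '' Icc 0 1 := by
  have h0 := image_clockwiseCircle 0 hΓ.r₀_pos
  have h1 := image_clockwiseCircle (Γ.x₀ : ℂ) hΓ.r₁_pos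
  ext z
  simp only [sigmaR, mem_union, mem_iUnion]
  constructor
  · rintro ((⟨ch, s, h⟩ | h) | h)
    · exact ⟨.lip ch s, h⟩
    · exact ⟨.hardCircle, by rw [param_hardCircle, h0]; exact h⟩
    · exact ⟨.softCircle, by rw [param_softCircle, h1]; exact h⟩
  · rintro ⟨p, h⟩
    cases p with
    | hardCircle => rw [param_hardCircle, h0] at h; exact Or.inl (Or.inr h)
    | softCircle => rw [param_softCircle, h1] at h; exact Or.inr h
    | lip ch s => exact Or.inl (Or.inl ⟨ch, s, h⟩)

lemma IsRegular.isCompact_sigmaR (hΓ : Γ.IsRegular) : IsCompact Γ.sigmaR := by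
  rw [hΓ.sigmaR_eq]
  exact isCompact_iUnion fun p => isCompact_Icc.image (continuous_param p)

lemma IsRegular.param_mem_sigmaR (hΓ : Γ.IsRegular) (p : Piece) {t : ℝ} (ht : t ∈ Icc (0 : ℝ) 1) :
    Γ.param p t ∈ Γ.sigmaR := by
  rw [hΓ.sigmaR_eq]; exact mem_iUnion.2 ⟨p, t, ht, rfl⟩

/-- At almost every parameter, a piece of the error contour avoids all other pieces. -/
lemma IsRegular.ae_notMem_other (hΓ : Γ.IsRegular) (p : Piece) :
    ∀ᵐ t ∂volume.restrict (Ioc (0 : ℝ) 1), ∀ q, q ≠ p → Γ.param p t ∉ Γ.param q '' Icc 0 1 := by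
  rw [ae_all_iff]
  intro q
  rcases eq_or_ne q p with h | h
  · simp [h]
  · filter_upwards [ae_notMem_of_transversal (contDiff_param q) (contDiff_param p)
      fun t ht s hs e => hΓ.transversal q p h t ht s hs e] with t ht _
    exact ht

lemma ae_mem_Ioo : ∀ᵐ t ∂volume.restrict (Ioc (0 : ℝ) 1), t ∈ Ioo (0 : ℝ) 1 := by
  have h1 : ∀ᵐ t ∂(volume : Measure ℝ), t ≠ 1 := by simp [ae_iff, measure_singleton]
  filter_upwards [ae_restrict_of_ae h1, ae_restrict_mem measurableSet_Ioc] with t ht1 ht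
  exact ⟨ht.1, lt_of_le_of_ne ht.2 ht1⟩

/-- The nontangential cones at almost every point of the error contour are free of the contour
near their vertex. -/
lemma IsRegular.ae_eventually_notMem_sigmaR (hΓ : Γ.IsRegular) (p : Piece) :
    ∀ᵐ t ∂volume.restrict (Ioc (0 : ℝ) 1), ∀ a : ℝ, 0 < a →
      (∀ᶠ ζ in 𝓝[leftCone (Γ.param p t) (deriv (Γ.param p) t) a] (Γ.param p t), ζ ∉ Γ.sigmaR) ∧
      ∀ᶠ ζ in 𝓝[leftCone (Γ.param p t) (-deriv (Γ.param p) t) a] (Γ.param p t),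
        ζ ∉ Γ.sigmaR := by
  filter_upwards [hΓ.ae_notMem_other p, ae_mem_Ioo] with t ht ht01 a ha
  have ht' := Ioo_subset_Icc_self ht01
  have hself := eventually_notMem_curve (contDiff_param (Γ := Γ) p) ht' (hΓ.deriv_param_ne_zero p t ht')
    (hΓ.param_ne p t ht01) ha
  have hother : ∀ q, q ≠ p → ∀ᶠ ζ in 𝓝 (Γ.param p t), ζ ∉ Γ.param q '' Icc 0 1 := fun q hq =>
    (isCompact_Icc.image (continuous_param q)).isClosed.isOpen_compl.mem_nhds (ht q hq)
  rw [hΓ.sigmaR_eq]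
  simp only [mem_iUnion, not_exists]
  rw [eventually_all, eventually_all]
  refine ⟨fun q => ?_, fun q => ?_⟩ <;> rcases eq_or_ne q p with rfl | h
  · exact hself.1
  · exact (hother q h).filter_mono nhdsWithin_le_nhds
  · exact hself.2
  · exact (hother q h).filter_mono nhdsWithin_le_nhds

/-! ### Square integrability on the error contour -/

lemma restrict_Icc_eq_Ioc :
    volume.restrict (Icc (0 : ℝ) 1) = volume.restrict (Ioc (0 : ℝ) 1) :=
  (Measure.restrict_congr_set Ioc_ae_eq_Icc).symm

/-- Arc length of one piece, as a measure on the parameter interval. -/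
noncomputable def speedMeasure (Γ : ContourData) (p : Piece) : Measure ℝ :=
  (volume.restrict (Ioc (0 : ℝ) 1)).withDensity (fun t => ‖deriv (Γ.param p) t‖ₑ)

lemma arcLength_eq : Γ.arcLength = ∑ p : Piece, (Γ.speedMeasure p).map (Γ.param p) := by
  simp only [arcLength, speedMeasure, restrict_Icc_eq_Ioc]

/-- The speed measure of a piece is comparable with Lebesgue measure. -/
lemma IsRegular.exists_speed_bounds (hΓ : Γ.IsRegular) (p : Piece) :
    ∃ m M : NNReal, m ≠ 0 ∧
      (m : ENNReal) • volume.restrict (Ioc (0 : ℝ) 1) ≤ Γ.speedMeasure p ∧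
      Γ.speedMeasure p ≤ (M : ENNReal) • volume.restrict (Ioc (0 : ℝ) 1) := by
  have hc : Continuous fun t => ‖deriv (Γ.param p) t‖ := (continuous_deriv_param p).norm
  obtain ⟨m, hm0, hm⟩ := (isCompact_Icc (a := (0 : ℝ)) (b := 1)).exists_forall_le' (a := 0)
    hc.continuousOn (fun t ht => norm_pos_iff.2 (hΓ.deriv_param_ne_zero p t ht))
  obtain ⟨M, hM⟩ := (isCompact_Icc (a := (0 : ℝ)) (b := 1)).exists_bound_of_continuousOn
    (continuous_deriv_param (Γ := Γ) p).continuousOn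
  refine ⟨m.toNNReal, M.toNNReal, by simpa using hm0, ?_, ?_⟩
  · rw [← withDensity_const]
    refine withDensity_mono ?_
    filter_upwards [ae_restrict_mem measurableSet_Ioc] with t ht
    rw [← ofReal_norm]
    exact ENNReal.ofReal_le_ofReal (hm t (Ioc_subset_Icc_self ht))
  · rw [← withDensity_const]
    refine withDensity_mono ?_
    filter_upwards [ae_restrict_mem measurableSet_Ioc] with t ht
    rw [← ofReal_norm]
    exact ENNReal.ofReal_le_ofReal (hM t (Ioc_subset_Icc_self ht))

lemma IsRegular.ac_speedMeasure (hΓ : Γ.IsRegular) (p : Piece) :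
    volume.restrict (Ioc (0 : ℝ) 1) ≪ Γ.speedMeasure p ∧
      Γ.speedMeasure p ≪ volume.restrict (Ioc (0 : ℝ) 1) := by
  obtain ⟨m, M, hm, h1, -⟩ := hΓ.exists_speed_bounds p
  refine ⟨?_, withDensity_absolutelyContinuous _ _⟩
  refine Measure.AbsolutelyContinuous.trans ?_ (Measure.absolutelyContinuous_of_le h1)
  exact Measure.absolutelyContinuous_smul (by simpa using hm)

lemma IsRegular.speedMeasure_compl (hΓ : Γ.IsRegular) (p : Piece) :
    Γ.speedMeasure p (Ioo (0 : ℝ) 1)ᶜ = 0 :=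
  (hΓ.ac_speedMeasure p).2 ae_mem_Ioo

/-- Almost everywhere statements on the error contour, read in the parameters. -/
lemma IsRegular.ae_arcLength_iff (hΓ : Γ.IsRegular) {Q : ℂ → Prop} :
    (∀ᵐ z ∂Γ.arcLength, Q z) ↔
      ∀ p, ∀ᵐ t ∂volume.restrict (Ioc (0 : ℝ) 1), Q (Γ.param p t) := by
  rw [arcLength_eq, ae_finsetSum_measure_iff]
  simp only [Finset.mem_univ, true_imp_iff]
  refine forall_congr' fun p => ?_
  rw [ae_map_curve_iff (continuous_param p) (hΓ.injOn_param p) (hΓ.speedMeasure_compl p)]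
  exact ⟨fun h => (hΓ.ac_speedMeasure p).1.ae_le h, fun h => (hΓ.ac_speedMeasure p).2.ae_le h⟩

lemma IsRegular.aestronglyMeasurable_arcLength_iff (hΓ : Γ.IsRegular) {E : Type*}
    [NormedAddCommGroup E] {g : ℂ → E} :
    AEStronglyMeasurable g Γ.arcLength ↔
      ∀ p, AEStronglyMeasurable (fun t => g (Γ.param p t)) (volume.restrict (Ioc (0 : ℝ) 1)) := by
  rw [arcLength_eq, ← Measure.sum_fintype, aestronglyMeasurable_sum_measure_iff]
  refine forall_congr' fun p => ?_
  rw [aestronglyMeasurable_map_curve_iff (continuous_param p) (hΓ.injOn_param p)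
    (hΓ.speedMeasure_compl p)]
  exact ⟨fun h => h.mono_ac (hΓ.ac_speedMeasure p).1, fun h => h.mono_ac (hΓ.ac_speedMeasure p).2⟩

/-- The `L²` norm on the error contour is equivalent to the sum of the `L²` norms in the
parameters. -/
lemma IsRegular.exists_eLpNorm_bounds (hΓ : Γ.IsRegular) (E : Type*) [NormedAddCommGroup E] :
    ∃ C : NNReal, ∀ g : ℂ → E,
      (∀ p, eLpNorm (fun t => g (Γ.param p t)) 2 (volume.restrict (Ioc (0 : ℝ) 1)) ≤
        C * eLpNorm g 2 Γ.arcLength) ∧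
      eLpNorm g 2 Γ.arcLength ≤
        C * ∑ p, eLpNorm (fun t => g (Γ.param p t)) 2 (volume.restrict (Ioc (0 : ℝ) 1)) := by
  choose m M hm hlow hup using hΓ.exists_speed_bounds
  have hx : ∀ (p : Piece) (g : ℂ → E), eLpNorm g 2 ((Γ.speedMeasure p).map (Γ.param p)) =
      eLpNorm (fun t => g (Γ.param p t)) 2 (Γ.speedMeasure p) := fun p g =>
    eLpNorm_map_curve (continuous_param p) (hΓ.injOn_param p) (hΓ.speedMeasure_compl p) g
  set c : Piece → NNReal := fun p => (m p ^ (1 / 2 : ℝ))⁻¹ + M p ^ (1 / 2 : ℝ) with hc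
  have hcle : ∀ p, c p ≤ ∑ p, c p := fun p =>
    Finset.single_le_sum (f := c) (fun _ _ => zero_le) (Finset.mem_univ p)
  have hcoe : ∀ (x : NNReal), ((x : ENNReal)) ^ (1 / (2 : ENNReal)).toReal =
      ((x ^ (1 / 2 : ℝ) : NNReal) : ENNReal) := fun x => by
    rw [ENNReal.coe_rpow_of_nonneg _ (by norm_num)]; norm_num
  refine ⟨∑ p, c p, fun g => ⟨fun p => ?_, ?_⟩⟩
  · have h1 : eLpNorm (fun t => g (Γ.param p t)) 2
        ((m p : ENNReal) • volume.restrict (Ioc (0 : ℝ) 1)) ≤ eLpNorm g 2 Γ.arcLength := by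
      refine (eLpNorm_mono_measure _ (hlow p)).trans ?_
      rw [← hx, arcLength_eq, ← Measure.sum_fintype]
      exact eLpNorm_mono_measure _ (Measure.le_sum _ p)
    rw [eLpNorm_smul_measure_of_ne_zero (by simpa using hm p), smul_eq_mul, hcoe] at h1
    have hne : (m p ^ (1 / 2 : ℝ) : NNReal) ≠ 0 := (NNReal.rpow_pos (pos_iff_ne_zero.2 (hm p))).ne'
    calc _ = ((m p ^ (1 / 2 : ℝ))⁻¹ : NNReal) * (((m p ^ (1 / 2 : ℝ) : NNReal) : ENNReal) *
          eLpNorm (fun t => g (Γ.param p t)) 2 (volume.restrict (Ioc (0 : ℝ) 1))) := by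
          rw [← mul_assoc, ← ENNReal.coe_mul, inv_mul_cancel₀ hne, ENNReal.coe_one, one_mul]
      _ ≤ _ := by
          gcongr
          exact (le_self_add).trans (hcle p)
  · rw [arcLength_eq]
    refine (eLpNorm_finset_sum_measure_le _ _ _).trans ?_
    rw [Finset.mul_sum]
    refine Finset.sum_le_sum fun p _ => ?_
    rw [hx]
    refine (eLpNorm_mono_measure _ (hup p)).trans ?_
    rcases eq_or_ne (M p) 0 with h0 | h0
    · rw [h0]; simp
    · rw [eLpNorm_smul_measure_of_ne_zero (by simpa using h0), smul_eq_mul, hcoe]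
      gcongr
      exact (le_add_self).trans (hcle p)

lemma IsRegular.memLp_arcLength_iff (hΓ : Γ.IsRegular) {E : Type*}
    [NormedAddCommGroup E] {g : ℂ → E} :
    MemLp g 2 Γ.arcLength ↔
      ∀ p, MemLp (fun t => g (Γ.param p t)) 2 (volume.restrict (Ioc (0 : ℝ) 1)) := by
  obtain ⟨C, hC⟩ := hΓ.exists_eLpNorm_bounds E
  obtain ⟨h1, h2⟩ := hC g
  constructor
  · exact fun h p => ⟨hΓ.aestronglyMeasurable_arcLength_iff.1 h.1 p,
      (h1 p).trans_lt (ENNReal.mul_lt_top ENNReal.coe_lt_top h.2)⟩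
  · exact fun h => ⟨hΓ.aestronglyMeasurable_arcLength_iff.2 fun p => (h p).1,
      h2.trans_lt (ENNReal.mul_lt_top ENNReal.coe_lt_top
        (ENNReal.sum_lt_top.2 fun p _ => (h p).2))⟩

/-- Functions given in the parameters of the pieces come from one function on the contour. -/
lemma IsRegular.exists_glue (hΓ : Γ.IsRegular) {E : Type*} [Zero E] (b : Piece → ℝ → E) :
    ∃ g : ℂ → E, ∀ p, ∀ᵐ t ∂volume.restrict (Ioc (0 : ℝ) 1), g (Γ.param p t) = b p t := by
  classical
  refine ⟨fun z => if h : ∃ x : Piece × ℝ, x.2 ∈ Ioo (0 : ℝ) 1 ∧ Γ.param x.1 x.2 = z then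
    b h.choose.1 h.choose.2 else 0, fun p => ?_⟩
  filter_upwards [hΓ.ae_notMem_other p, ae_mem_Ioo] with t ht ht01
  have h : ∃ x : Piece × ℝ, x.2 ∈ Ioo (0 : ℝ) 1 ∧ Γ.param x.1 x.2 = Γ.param p t :=
    ⟨(p, t), ht01, rfl⟩
  rw [dif_pos h]
  obtain ⟨h1, h2⟩ := h.choose_spec
  have h3 : h.choose.1 = p := by
    by_contra hne
    exact ht _ hne ⟨_, Ioo_subset_Icc_self h1, h2⟩
  have h4 : h.choose.2 = t := by
    rw [h3] at h2
    exact hΓ.injOn_param p h1 ht01 h2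
  rw [h3, h4]

lemma IsRegular.isFiniteMeasure_arcLength (hΓ : Γ.IsRegular) : IsFiniteMeasure Γ.arcLength := by
  have : MemLp (fun _ : ℂ => (1 : ℝ)) 2 Γ.arcLength := by
    rw [hΓ.memLp_arcLength_iff]
    intro p
    have : IsFiniteMeasure (volume.restrict (Ioc (0 : ℝ) 1)) := ⟨by simp⟩
    exact memLp_const 1
  rw [memLp_const_iff (by norm_num) (by norm_num)] at this
  exact ⟨by simpa using this⟩

end ContourData

/-- The topology of the matrix norm. It is definitionally the product topology; as a local instance
it makes the lemmas on normed spaces apply to matrices without unfolding. -/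
@[reducible] noncomputable def matNormTopology : TopologicalSpace Mat3 :=
  PseudoMetricSpace.toUniformSpace.toTopologicalSpace

section NormTopology

attribute [local instance] matNormTopology

namespace ContourData

variable {Γ : ContourData}

/-! ### Boundary values on the error contour -/

lemma isMinusValue_iff {F g : ℂ → Mat3} : Γ.IsMinusValue F g ↔
    ∀ p, ∀ᵐ t ∂volume.restrict (Ioc (0 : ℝ) 1), ∀ a : ℝ, 0 < a → a < 1 →
      Tendsto F (𝓝[leftCone (Γ.param p t) (-deriv (Γ.param p) t) a] (Γ.param p t))
        (𝓝 (g (Γ.param p t))) := by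
  rw [← restrict_Icc_eq_Ioc]; rfl

lemma isPlusValue_iff {F g : ℂ → Mat3} : Γ.IsPlusValue F g ↔
    ∀ p, ∀ᵐ t ∂volume.restrict (Ioc (0 : ℝ) 1), ∀ a : ℝ, 0 < a → a < 1 →
      Tendsto F (𝓝[leftCone (Γ.param p t) (deriv (Γ.param p) t) a] (Γ.param p t))
        (𝓝 (g (Γ.param p t))) := by
  rw [← restrict_Icc_eq_Ioc]; rfl

lemma IsMinusValue.unique (hΓ : Γ.IsRegular) {F g g' : ℂ → Mat3} (h : Γ.IsMinusValue F g)
    (h' : Γ.IsMinusValue F g') : g =ᵐ[Γ.arcLength] g' := by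
  rw [isMinusValue_iff] at h h'
  refine hΓ.ae_arcLength_iff.2 fun p => ?_
  filter_upwards [h p, h' p, ae_mem_Ioo] with t h1 h2 ht
  have hne := neg_ne_zero.2 (hΓ.deriv_param_ne_zero p t (Ioo_subset_Icc_self ht))
  have := leftCone_neBot (z := Γ.param p t) hne (a := 1 / 2) (by norm_num)
  exact tendsto_nhds_unique (h1 (1 / 2) (by norm_num) (by norm_num))
    (h2 (1 / 2) (by norm_num) (by norm_num))

lemma IsPlusValue.unique (hΓ : Γ.IsRegular) {F g g' : ℂ → Mat3} (h : Γ.IsPlusValue F g)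
    (h' : Γ.IsPlusValue F g') : g =ᵐ[Γ.arcLength] g' := by
  rw [isPlusValue_iff] at h h'
  refine hΓ.ae_arcLength_iff.2 fun p => ?_
  filter_upwards [h p, h' p, ae_mem_Ioo] with t h1 h2 ht
  have hne := hΓ.deriv_param_ne_zero p t (Ioo_subset_Icc_self ht)
  have := leftCone_neBot (z := Γ.param p t) hne (a := 1 / 2) (by norm_num)
  exact tendsto_nhds_unique (h1 (1 / 2) (by norm_num) (by norm_num))
    (h2 (1 / 2) (by norm_num) (by norm_num))

/-- Boundary values may be computed from an expression that holds off the contour only. -/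
lemma IsMinusValue.map_congr (hΓ : Γ.IsRegular) {F F' g g' : ℂ → Mat3} (h : Γ.IsMinusValue F g)
    {Φ : Mat3 → Mat3} (hΦ : Continuous Φ) (hF : ∀ z ∉ Γ.sigmaR, F' z = Φ (F z))
    (hg : (fun z => Φ (g z)) =ᵐ[Γ.arcLength] g') : Γ.IsMinusValue F' g' := by
  rw [isMinusValue_iff] at h ⊢
  intro p
  filter_upwards [h p, hΓ.ae_eventually_notMem_sigmaR p, hΓ.ae_arcLength_iff.1 hg p]
    with t h1 h2 h3 a ha ha1
  rw [← h3]
  refine ((hΦ.tendsto _).comp (h1 a ha ha1)).congr' ?_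
  filter_upwards [(h2 a ha).2] with ζ hζ
  exact (hF ζ hζ).symm

lemma IsPlusValue.map_congr (hΓ : Γ.IsRegular) {F F' g g' : ℂ → Mat3} (h : Γ.IsPlusValue F g)
    {Φ : Mat3 → Mat3} (hΦ : Continuous Φ) (hF : ∀ z ∉ Γ.sigmaR, F' z = Φ (F z))
    (hg : (fun z => Φ (g z)) =ᵐ[Γ.arcLength] g') : Γ.IsPlusValue F' g' := by
  rw [isPlusValue_iff] at h ⊢
  intro p
  filter_upwards [h p, hΓ.ae_eventually_notMem_sigmaR p, hΓ.ae_arcLength_iff.1 hg p]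
    with t h1 h2 h3 a ha ha1
  rw [← h3]
  refine ((hΦ.tendsto _).comp (h1 a ha ha1)).congr' ?_
  filter_upwards [(h2 a ha).1] with ζ hζ
  exact (hF ζ hζ).symm

lemma IsMinusValue.add {F G f g : ℂ → Mat3} (h : Γ.IsMinusValue F f) (h' : Γ.IsMinusValue G g) :
    Γ.IsMinusValue (fun z => F z + G z) (fun z => f z + g z) := by
  rw [isMinusValue_iff] at h h' ⊢
  intro p
  filter_upwards [h p, h' p] with t h1 h2 a ha ha1
  exact (h1 a ha ha1).add (h2 a ha ha1)

/-! ### The Cauchy transform on the error contour -/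

lemma cauchy_congr (hΓ : Γ.IsRegular) {h h' : ℂ → Mat3} (e : h =ᵐ[Γ.arcLength] h') (z : ℂ) :
    Γ.cauchy h z = Γ.cauchy h' z := by
  simp only [cauchy, intervalIntegral.integral_of_le zero_le_one]
  congr 1
  refine Finset.sum_congr rfl fun p _ => integral_congr_ae ?_
  filter_upwards [hΓ.ae_arcLength_iff.1 e p] with t ht
  rw [ht]

lemma IsRegular.integrable_cauchy (hΓ : Γ.IsRegular) {h : ℂ → Mat3} (hh : MemLp h 2 Γ.arcLength)
    {z : ℂ} (hz : z ∉ Γ.sigmaR) (p : Piece) :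
    IntervalIntegrable (fun t => (deriv (Γ.param p) t / (Γ.param p t - z)) • h (Γ.param p t))
      volume 0 1 := by
  have hfin : IsFiniteMeasure (volume.restrict (Ioc (0 : ℝ) 1)) := ⟨by simp⟩
  have hi : IntervalIntegrable (fun t => h (Γ.param p t)) volume 0 1 :=
    (intervalIntegrable_iff_integrableOn_Ioc_of_le zero_le_one).2
      ((hΓ.memLp_arcLength_iff.1 hh p).integrable (by norm_num))
  refine hi.continuousOn_smul (ContinuousOn.div (continuous_deriv_param p).continuousOn
    ((continuous_param p).sub continuous_const).continuousOn fun t ht h0 => hz ?_)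
  rw [uIcc_of_le zero_le_one] at ht
  rw [← sub_eq_zero.1 (show Γ.param p t - z = 0 from h0)]
  exact hΓ.param_mem_sigmaR p ht

lemma IsRegular.cauchy_add (hΓ : Γ.IsRegular) {h h' : ℂ → Mat3} (hh : MemLp h 2 Γ.arcLength)
    (hh' : MemLp h' 2 Γ.arcLength) {z : ℂ} (hz : z ∉ Γ.sigmaR) :
    Γ.cauchy (fun s => h s + h' s) z = Γ.cauchy h z + Γ.cauchy h' z := by
  simp only [cauchy]
  rw [← smul_add, ← Finset.sum_add_distrib]
  congr 1
  refine Finset.sum_congr rfl fun p _ => ?_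
  rw [← intervalIntegral.integral_add (hΓ.integrable_cauchy hh hz p)
    (hΓ.integrable_cauchy hh' hz p)]
  simp only [smul_add]

lemma cauchy_smul (c : ℂ) (h : ℂ → Mat3) (z : ℂ) :
    Γ.cauchy (fun s => c • h s) z = c • Γ.cauchy h z := by
  simp only [cauchy]
  rw [smul_comm c (_ : ℂ) (_ : Mat3), Finset.smul_sum (r := c)]
  congr 1
  refine Finset.sum_congr rfl fun p _ => ?_
  rw [← intervalIntegral.integral_smul]
  simp only [smul_comm c]

/-- A matrix entry, as a continuous linear functional. -/
noncomputable def entryCLM (i j : Fin 3) : Mat3 →L[ℂ] ℂ :=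
  LinearMap.toContinuousLinearMap (Matrix.entryLinearMap ℂ ℂ i j)

lemma entryCLM_apply (i j : Fin 3) (A : Mat3) : entryCLM i j A = A i j := rfl

/-- The scalar Cauchy transform of a matrix entry. -/
noncomputable def entryCauchy (Γ : ContourData) (h : ℂ → Mat3) (i j : Fin 3) (z : ℂ) : ℂ :=
  (2 * Real.pi * Complex.I)⁻¹ *
    ∑ p : Piece, curveCauchy (Γ.param p) (fun t => h (Γ.param p t) i j) z

lemma eq_sum_entries (A : Mat3) : A = ∑ i, ∑ j, A i j • Matrix.single i j (1 : ℂ) := by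
  conv_lhs => rw [Matrix.matrix_eq_sum_single A]
  simp [Matrix.smul_single]

/-- Off the contour, the Cauchy transform is computed entrywise. -/
lemma IsRegular.cauchy_eq_sum (hΓ : Γ.IsRegular) {h : ℂ → Mat3} (hh : MemLp h 2 Γ.arcLength)
    {z : ℂ} (hz : z ∉ Γ.sigmaR) :
    Γ.cauchy h z = ∑ i, ∑ j, Γ.entryCauchy h i j z • Matrix.single i j (1 : ℂ) := by
  rw [eq_sum_entries (Γ.cauchy h z)]
  refine Finset.sum_congr rfl fun i _ => Finset.sum_congr rfl fun j _ => ?_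
  congr 1
  rw [← entryCLM_apply i j (Γ.cauchy h z), cauchy, map_smul, map_sum, entryCauchy, smul_eq_mul]
  congr 1
  refine Finset.sum_congr rfl fun p _ => ?_
  rw [← (entryCLM i j).intervalIntegral_comp_comm (hΓ.integrable_cauchy hh hz p)]
  simp only [map_smul, entryCLM_apply, smul_eq_mul, curveCauchy]

lemma memLp_entry {h : ℝ → Mat3} (hh : MemLp h 2 (volume.restrict (Ioc (0 : ℝ) 1)))
    (i j : Fin 3) : MemLp (fun t => h t i j) 2 (volume.restrict (Ioc (0 : ℝ) 1)) ∧
      eLpNorm (fun t => h t i j) 2 (volume.restrict (Ioc (0 : ℝ) 1)) ≤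
        ‖entryCLM i j‖ₑ * eLpNorm h 2 (volume.restrict (Ioc (0 : ℝ) 1)) := by
  refine ⟨(entryCLM i j).comp_memLp' hh, ?_⟩
  rw [← ofReal_norm]
  exact eLpNorm_le_mul_eLpNorm_of_ae_le_mul
    (Eventually.of_forall fun t => (entryCLM i j).le_opNorm (h t)) 2

/-- The Cauchy transform of a square integrable density is analytic off the contour. -/
lemma IsRegular.differentiableOn_cauchy (hΓ : Γ.IsRegular) {h : ℂ → Mat3}
    (hh : MemLp h 2 Γ.arcLength) : DifferentiableOn ℂ (Γ.cauchy h) Γ.sigmaRᶜ := by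
  have hfin : IsFiniteMeasure (volume.restrict (Ioc (0 : ℝ) 1)) := ⟨by simp⟩
  have key : DifferentiableOn ℂ
      (fun z => ∑ i, ∑ j, Γ.entryCauchy h i j z • Matrix.single i j (1 : ℂ)) Γ.sigmaRᶜ := by
    intro z hz
    refine DifferentiableAt.differentiableWithinAt ?_
    refine DifferentiableAt.fun_sum fun i _ => DifferentiableAt.fun_sum fun j _ => ?_
    refine DifferentiableAt.smul_const (DifferentiableAt.const_mul ?_ _) _
    refine DifferentiableAt.fun_sum fun p _ => ?_
    refine differentiableAt_curveCauchy (contDiff_param p)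
      ((memLp_entry (hΓ.memLp_arcLength_iff.1 hh p) i j).1.integrable (by norm_num)) ?_
    rw [hΓ.sigmaR_eq] at hz
    exact fun h => hz (mem_iUnion.2 ⟨p, h⟩)
  exact key.congr fun z hz => hΓ.cauchy_eq_sum hh hz

/-- Away from the contour, the Cauchy transform is controlled by the distance. -/
lemma IsRegular.exists_norm_cauchy_le (hΓ : Γ.IsRegular) :
    ∃ K : ℝ, 0 ≤ K ∧ ∀ h : ℂ → Mat3, MemLp h 2 Γ.arcLength → ∀ (z : ℂ) (d : ℝ), 0 < d →
      (∀ s ∈ Γ.sigmaR, d ≤ ‖s - z‖) →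
      ‖Γ.cauchy h z‖ ≤ K / d * (eLpNorm h 2 Γ.arcLength).toReal := by
  have hM : ∀ p : Piece, ∃ M : ℝ, 0 ≤ M ∧ ∀ t ∈ Icc (0 : ℝ) 1, ‖deriv (Γ.param p) t‖ ≤ M := by
    intro p
    obtain ⟨M, hM⟩ := (isCompact_Icc (a := (0 : ℝ)) (b := 1)).exists_bound_of_continuousOn
      (continuous_deriv_param (Γ := Γ) p).continuousOn
    exact ⟨M, (norm_nonneg _).trans (hM 0 (by simp)), hM⟩
  choose M hM0 hM using hM
  obtain ⟨C, hC⟩ := hΓ.exists_eLpNorm_bounds Mat3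
  have hfin : IsFiniteMeasure (volume.restrict (Ioc (0 : ℝ) 1)) := ⟨by simp⟩
  refine ⟨‖(2 * Real.pi * Complex.I : ℂ)⁻¹‖ * ∑ p, M p * C,
    mul_nonneg (norm_nonneg _) (Finset.sum_nonneg fun p _ => mul_nonneg (hM0 p) C.coe_nonneg), ?_⟩
  intro h hh z d hd hz
  have hp : ∀ p : Piece, ‖∫ t in (0 : ℝ)..1,
      (deriv (Γ.param p) t / (Γ.param p t - z)) • h (Γ.param p t)‖ ≤
        M p * C / d * (eLpNorm h 2 Γ.arcLength).toReal := by
    intro p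
    have hhp := hΓ.memLp_arcLength_iff.1 hh p
    rw [intervalIntegral.integral_of_le zero_le_one]
    calc _ ≤ ∫ t in Ioc (0 : ℝ) 1, M p / d * ‖h (Γ.param p t)‖ := by
          refine norm_integral_le_of_norm_le ((hhp.integrable (by norm_num)).norm.const_mul _) ?_
          filter_upwards [ae_restrict_mem measurableSet_Ioc] with t ht
          have ht' := Ioc_subset_Icc_self ht
          refine (norm_smul_le _ _).trans ?_
          rw [norm_div]
          gcongr
          · exact hM0 p
          · exact hM p t ht'
          · exact hz _ (hΓ.param_mem_sigmaR p ht')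
      _ = M p / d * ∫ t in Ioc (0 : ℝ) 1, ‖h (Γ.param p t)‖ := integral_const_mul _ _
      _ ≤ M p / d * (C * (eLpNorm h 2 Γ.arcLength).toReal) := by
          have := hM0 p
          gcongr
          refine (integral_norm_le_eLpNorm_two _ hhp).trans ?_
          have h1 := ENNReal.toReal_mono (ENNReal.mul_ne_top ENNReal.coe_ne_top hh.eLpNorm_ne_top)
            ((hC h).1 p)
          rwa [ENNReal.toReal_mul, ENNReal.coe_toReal] at h1
      _ = _ := by ring
  calc ‖Γ.cauchy h z‖ ≤ ‖(2 * Real.pi * Complex.I : ℂ)⁻¹‖ *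
        ∑ p, M p * C / d * (eLpNorm h 2 Γ.arcLength).toReal := by
        rw [cauchy]
        refine (norm_smul_le _ _).trans ?_
        gcongr
        exact norm_sum_le_of_le _ fun p _ => hp p
    _ = _ := by rw [← Finset.sum_mul, ← Finset.sum_div]; ring

/-- Boundary values on the piece `q` of the Cauchy integral along the piece `p`. -/
lemma IsRegular.exists_boundary_pair (hΓ : Γ.IsRegular) (p q : Piece) :
    ∃ B : ℝ, ∀ f : ℝ → ℂ, MemLp f 2 (volume.restrict (Ioc (0 : ℝ) 1)) →
      ∃ g : ℝ → ℂ, MemLp g 2 (volume.restrict (Ioc (0 : ℝ) 1)) ∧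
      eLpNorm g 2 (volume.restrict (Ioc (0 : ℝ) 1)) ≤
        ENNReal.ofReal B * eLpNorm f 2 (volume.restrict (Ioc (0 : ℝ) 1)) ∧
      ∀ᵐ s ∂volume.restrict (Ioc (0 : ℝ) 1), ∀ a : ℝ, 0 < a →
        Tendsto (curveCauchy (Γ.param p) f)
          (𝓝[leftCone (Γ.param q s) (-deriv (Γ.param q) s) a] (Γ.param q s)) (𝓝 (g s)) ∧
        Tendsto (curveCauchy (Γ.param p) f)
          (𝓝[leftCone (Γ.param q s) (deriv (Γ.param q) s) a] (Γ.param q s))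
          (𝓝 (g s + if p = q then 2 * Real.pi * Complex.I * f s else 0)) := by
  rcases eq_or_ne p q with rfl | hpq
  · simp only [if_true]
    obtain ⟨T, hT, B, hB0, hB⟩ : ∃ T : ℝ, 1 ≤ T ∧ ∃ B : ℝ, 0 ≤ B ∧
        ∀ s ∈ Ioo (0 : ℝ) 1, ∀ t ∈ Icc (0 : ℝ) 1, t ≠ s →
          ‖deriv (Γ.param p) t / (Γ.param p t - Γ.param p s) -
            deriv (modelCircle T) t / (modelCircle T t - modelCircle T s)‖ ≤ B := by
      cases p with
      | hardCircle => exact ⟨1, le_rfl, 2 * Real.pi, by positivity, fun s hs t ht hts =>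
          norm_kernel_clockwiseCircle_le 0 hΓ.r₀_pos hs ht hts⟩
      | softCircle => exact ⟨1, le_rfl, 2 * Real.pi, by positivity, fun s hs t ht hts =>
          norm_kernel_clockwiseCircle_le Γ.x₀ hΓ.r₁_pos hs ht hts⟩
      | lip ch sd =>
        -- an arc is compared with half of the circle of period `2`, itself a simple arc
        obtain ⟨B₁, hB₁, h₁⟩ := exists_kernel_bound_of_injOn (Γ.lip ch sd).contDiff
          (Γ.lip ch sd).deriv_ne_zero (Γ.lip ch sd).injOn
        obtain ⟨B₂, hB₂, h₂⟩ := exists_kernel_bound_of_injOn (contDiff_modelCircle 2)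
          (fun s _ => by
            rw [deriv_modelCircle]
            exact mul_ne_zero (div_ne_zero Complex.two_pi_I_ne_zero (by norm_num))
              (modelCircle_ne_zero 2 s))
          (fun t ht s hs h => modelCircle_injOn two_pos (by
            rw [abs_lt]; constructor <;> linarith [hs.1, hs.2, ht.1, ht.2]) h)
        refine ⟨2, by norm_num, B₁ + B₂, by positivity, fun s hs t ht hts => ?_⟩
        have hs' := Ioo_subset_Icc_self hs
        have := norm_sub_le_norm_sub_add_norm_sub
          (deriv (Γ.lip ch sd).toFun t / ((Γ.lip ch sd).toFun t - (Γ.lip ch sd).toFun s))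
          (1 / ((t : ℂ) - s))
          (deriv (modelCircle 2) t / (modelCircle 2 t - modelCircle 2 s))
        refine this.trans (add_le_add (h₁ s hs' t ht hts) ?_)
        rw [norm_sub_rev]
        exact h₂ s hs' t ht hts
    exact ⟨B + 4 * Real.pi, fun f hf => exists_boundary_self (contDiff_param p)
      (hΓ.deriv_param_ne_zero p) (hΓ.param_ne p) hT hB0 hB hf⟩
  · have htr : ∀ t ∈ Icc (0 : ℝ) 1, ∀ s ∈ Icc (0 : ℝ) 1, Γ.param p t = Γ.param q s →
        ((starRingEnd ℂ) (deriv (Γ.param p) t) * deriv (Γ.param q) s).im ≠ 0 :=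
      fun t ht s hs e => hΓ.transversal p q hpq t ht s hs e
    obtain ⟨B, -, hB⟩ := exists_boundary_cross (contDiff_param (Γ := Γ) p)
      (contDiff_param (Γ := Γ) q) htr
    refine ⟨B, fun f hf => ⟨_, (hB f hf).1, (hB f hf).2, ?_⟩⟩
    have hfin : IsFiniteMeasure (volume.restrict (Ioc (0 : ℝ) 1)) := ⟨by simp⟩
    filter_upwards [ae_notMem_of_transversal (contDiff_param (Γ := Γ) p)
      (contDiff_param (Γ := Γ) q) htr] with s hs a _
    have hc := (differentiableAt_curveCauchy (contDiff_param (Γ := Γ) p)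
      (hf.integrable (by norm_num)) hs).continuousAt.tendsto
    rw [if_neg hpq, add_zero]
    exact ⟨hc.mono_left nhdsWithin_le_nhds, hc.mono_left nhdsWithin_le_nhds⟩

/-- **Cauchy operators on the error contour.** The Cauchy transform of a square integrable density
has nontangential boundary values almost everywhere; their difference is the density, and the
boundary value from the `-` side depends boundedly on it. -/
theorem IsRegular.exists_cauchy_boundary (hΓ : Γ.IsRegular) :
    ∃ K : NNReal, ∀ h : ℂ → Mat3, MemLp h 2 Γ.arcLength →
      ∃ g : ℂ → Mat3, MemLp g 2 Γ.arcLength ∧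
        eLpNorm g 2 Γ.arcLength ≤ K * eLpNorm h 2 Γ.arcLength ∧
        Γ.IsMinusValue (Γ.cauchy h) g ∧ Γ.IsPlusValue (Γ.cauchy h) fun z => g z + h z := by
  choose B hB using hΓ.exists_boundary_pair
  obtain ⟨C, hC⟩ := hΓ.exists_eLpNorm_bounds Mat3
  set c₀ : ℂ := (2 * Real.pi * Complex.I)⁻¹ with hc₀
  set E : Fin 3 → Fin 3 → Mat3 := fun i j => Matrix.single i j (1 : ℂ) with hE
  set L : NNReal := ∑ q : Piece, ∑ i, ∑ j, ‖E i j‖₊ *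
    (‖c₀‖₊ * ∑ p : Piece, (B p q).toNNReal * (‖entryCLM i j‖₊ * C)) with hL
  refine ⟨C * L, fun h hh => ?_⟩
  have hhp := hΓ.memLp_arcLength_iff.1 hh
  -- `b p q i j` is the boundary value on `q` of the integral along `p` of the entry `(i, j)`
  choose b hbm hbn hbl using fun (p q : Piece) (i j : Fin 3) =>
    hB p q (fun t => h (Γ.param p t) i j) (memLp_entry (hhp p) i j).1
  have hterm : ∀ (q : Piece) (i j : Fin 3),
      MemLp (fun t => c₀ * ∑ p, b p q i j t) 2 (volume.restrict (Ioc (0 : ℝ) 1)) := fun q i j =>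
    (memLp_finsetSum _ fun p _ => hbm p q i j).const_mul c₀
  have htermE : ∀ (q : Piece) (i j : Fin 3),
      MemLp (fun t => (c₀ * ∑ p, b p q i j t) • E i j) 2 (volume.restrict (Ioc (0 : ℝ) 1)) :=
    fun q i j => ((ContinuousLinearMap.id ℂ ℂ).smulRight (E i j)).comp_memLp' (hterm q i j)
  obtain ⟨g, hg⟩ := hΓ.exists_glue
    (fun q t => ∑ i, ∑ j, (c₀ * ∑ p, b p q i j t) • E i j)
  have hgm : MemLp g 2 Γ.arcLength := by
    rw [hΓ.memLp_arcLength_iff]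
    intro q
    refine MemLp.ae_eq (EventuallyEq.symm (hg q)) ?_
    exact memLp_finsetSum _ fun i _ => memLp_finsetSum _ fun j _ => htermE q i j
  refine ⟨g, hgm, ?_, ?_, ?_⟩
  · set X := eLpNorm h 2 Γ.arcLength with hX
    have hq : ∀ q, eLpNorm (fun t => g (Γ.param q t)) 2 (volume.restrict (Ioc (0 : ℝ) 1)) ≤
        ((∑ i, ∑ j, ‖E i j‖₊ *
          (‖c₀‖₊ * ∑ p : Piece, (B p q).toNNReal * (‖entryCLM i j‖₊ * C)) : NNReal) : ENNReal) * X := by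
      intro q
      rw [eLpNorm_congr_ae (hg q)]
      have e : (fun t => ∑ i, ∑ j, (c₀ * ∑ p, b p q i j t) • E i j) =
          ∑ i, ∑ j, fun t => (c₀ * ∑ p, b p q i j t) • E i j := by
        funext t; simp only [Finset.sum_apply]
      rw [e, ENNReal.ofNNReal_finsetSum, Finset.sum_mul]
      refine (eLpNorm_sum_le (fun i _ => (memLp_finsetSum' _ fun j _ => htermE q i j).1)
        (by norm_num)).trans (Finset.sum_le_sum fun i _ => ?_)
      rw [ENNReal.ofNNReal_finsetSum, Finset.sum_mul]
      refine (eLpNorm_sum_le (fun j _ => (htermE q i j).1)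
        (by norm_num)).trans (Finset.sum_le_sum fun j _ => ?_)
      calc eLpNorm (fun t => (c₀ * ∑ p, b p q i j t) • E i j) 2 (volume.restrict (Ioc (0 : ℝ) 1))
          ≤ ‖E i j‖₊ * eLpNorm (fun t => c₀ * ∑ p, b p q i j t) 2
            (volume.restrict (Ioc (0 : ℝ) 1)) := by
            have h1 := eLpNorm_le_nnreal_smul_eLpNorm_of_ae_le_mul (c := ‖E i j‖₊)
              (f := fun t => (c₀ * ∑ p, b p q i j t) • E i j)
              (g := fun t => c₀ * ∑ p, b p q i j t)
              (μ := volume.restrict (Ioc (0 : ℝ) 1))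
              (Eventually.of_forall fun t => by
                rw [mul_comm ‖E i j‖₊]; exact nnnorm_smul_le (c₀ * ∑ p, b p q i j t) (E i j)) 2
            exact h1
        _ = ‖E i j‖₊ * (‖c₀‖₊ * eLpNorm (∑ p, b p q i j) 2 (volume.restrict (Ioc (0 : ℝ) 1))) := by
            have e2 : (fun t => c₀ * ∑ p, b p q i j t) = c₀ • ∑ p, b p q i j := by
              funext t; simp
            rw [e2, eLpNorm_const_smul]
            rfl
        _ ≤ ‖E i j‖₊ * (‖c₀‖₊ * ∑ p, ((B p q).toNNReal * (‖entryCLM i j‖₊ * C) : NNReal) * X) := by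
            gcongr
            refine (eLpNorm_sum_le (fun p _ => (hbm p q i j).1) (by norm_num)).trans
              (Finset.sum_le_sum fun p _ => (hbn p q i j).trans ?_)
            rw [ENNReal.coe_mul, ENNReal.coe_mul, mul_assoc, mul_assoc]
            refine mul_le_mul' le_rfl ((memLp_entry (hhp p) i j).2.trans ?_)
            exact mul_le_mul' le_rfl ((hC h).1 p)
        _ = _ := by
            push_cast
            rw [← Finset.sum_mul]
            ring
    calc eLpNorm g 2 Γ.arcLength ≤ C * ∑ q, eLpNorm (fun t => g (Γ.param q t)) 2
          (volume.restrict (Ioc (0 : ℝ) 1)) := (hC g).2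
      _ ≤ C * (L * X) := by
          gcongr
          rw [hL, ENNReal.ofNNReal_finsetSum, Finset.sum_mul]
          exact Finset.sum_le_sum fun q _ => hq q
      _ = _ := by rw [ENNReal.coe_mul]; ring
  · rw [isMinusValue_iff]
    intro q
    have hall : ∀ᵐ s ∂volume.restrict (Ioc (0 : ℝ) 1), ∀ (p : Piece) (i j : Fin 3) (a : ℝ), 0 < a →
        Tendsto (curveCauchy (Γ.param p) fun t => h (Γ.param p t) i j)
          (𝓝[leftCone (Γ.param q s) (-deriv (Γ.param q) s) a] (Γ.param q s))
          (𝓝 (b p q i j s)) := by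
      simp only [ae_all_iff (ι := Piece), ae_all_iff (ι := Fin 3)]
      intro p i j
      filter_upwards [hbl p q i j] with s hs a ha
      exact (hs a ha).1
    filter_upwards [hall, hg q, hΓ.ae_eventually_notMem_sigmaR q] with s hs hgs hoff a ha _
    rw [hgs]
    have hlim : Tendsto (fun z => ∑ i, ∑ j, Γ.entryCauchy h i j z • E i j)
        (𝓝[leftCone (Γ.param q s) (-deriv (Γ.param q) s) a] (Γ.param q s))
        (𝓝 (∑ i, ∑ j, (c₀ * ∑ p, b p q i j s) • E i j)) :=
      tendsto_finsetSum _ fun i _ => tendsto_finsetSum _ fun j _ =>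
        ((tendsto_finsetSum _ fun p _ => hs p i j a ha).const_mul c₀).smul_const _
    refine hlim.congr' ?_
    filter_upwards [(hoff a ha).2] with ζ hζ
    exact (hΓ.cauchy_eq_sum hh hζ).symm
  · rw [isPlusValue_iff]
    intro q
    have hall : ∀ᵐ s ∂volume.restrict (Ioc (0 : ℝ) 1), ∀ (p : Piece) (i j : Fin 3) (a : ℝ), 0 < a →
        Tendsto (curveCauchy (Γ.param p) fun t => h (Γ.param p t) i j)
          (𝓝[leftCone (Γ.param q s) (deriv (Γ.param q) s) a] (Γ.param q s))
          (𝓝 (b p q i j s + if p = q then 2 * Real.pi * Complex.I * h (Γ.param p s) i j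
            else 0)) := by
      simp only [ae_all_iff (ι := Piece), ae_all_iff (ι := Fin 3)]
      intro p i j
      filter_upwards [hbl p q i j] with s hs a ha
      exact (hs a ha).2
    filter_upwards [hall, hg q, hΓ.ae_eventually_notMem_sigmaR q] with s hs hgs hoff a ha _
    rw [hgs]
    have hlim : Tendsto (fun z => ∑ i, ∑ j, Γ.entryCauchy h i j z • E i j)
        (𝓝[leftCone (Γ.param q s) (deriv (Γ.param q) s) a] (Γ.param q s))
        (𝓝 (∑ i, ∑ j, (c₀ * ∑ p, (b p q i j s + if p = q then
          2 * Real.pi * Complex.I * h (Γ.param p s) i j else 0)) • E i j)) :=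
      tendsto_finsetSum _ fun i _ => tendsto_finsetSum _ fun j _ =>
        ((tendsto_finsetSum _ fun p _ => hs p i j a ha).const_mul c₀).smul_const _
    have e : ∑ i, ∑ j, (c₀ * ∑ p, (b p q i j s + if p = q then
          2 * Real.pi * Complex.I * h (Γ.param p s) i j else 0)) • E i j =
        (∑ i, ∑ j, (c₀ * ∑ p, b p q i j s) • E i j) + h (Γ.param q s) := by
      conv_rhs => rw [eq_sum_entries (h (Γ.param q s))]
      rw [← Finset.sum_add_distrib]
      refine Finset.sum_congr rfl fun i _ => ?_
      rw [← Finset.sum_add_distrib]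
      refine Finset.sum_congr rfl fun j _ => ?_
      rw [← add_smul, Finset.sum_add_distrib, Finset.sum_ite_eq' Finset.univ q,
        if_pos (Finset.mem_univ q), mul_add, ← mul_assoc c₀, hc₀,
        inv_mul_cancel₀ Complex.two_pi_I_ne_zero, one_mul]
    rw [← e]
    refine hlim.congr' ?_
    filter_upwards [(hoff a ha).1] with ζ hζ
    exact (hΓ.cauchy_eq_sum hh hζ).symm

end ContourData

end NormTopology

/-! ### Small jumps: the singular integral equation and the error problem -/

/-- Neumann series of an operator of norm at most one half. -/
lemma exists_neumann_series {E : Type*} [NormedAddCommGroup E] [NormedSpace ℂ E] [CompleteSpace E]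
    (T : E →L[ℂ] E) (hT : ‖T‖ ≤ 1 / 2) (e : E) :
    ∃ u : E, HasSum (fun k : ℕ => (T ^ k) e) u ∧ (∀ v, v = e + T v ↔ v = u) ∧ ‖u‖ ≤ 2 * ‖e‖ := by
  have hs : Summable fun k : ℕ => (T ^ k) e := by
    refine Summable.of_norm_bounded (g := fun k : ℕ => (1 / 2 : ℝ) ^ k * ‖e‖)
      (summable_geometric_two.mul_right _) fun k => ?_
    refine ((T ^ k).le_opNorm e).trans ?_
    gcongr
    cases k with
    | zero => rw [pow_zero, pow_zero]; exact ContinuousLinearMap.norm_id_le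
    | succ k => exact (norm_pow_le' T k.succ_pos).trans (by gcongr)
  have hfix : (∑' k : ℕ, (T ^ k) e) = e + T (∑' k : ℕ, (T ^ k) e) := by
    rw [T.map_tsum hs, hs.tsum_eq_zero_add]
    congr 1
    simp only [pow_succ', mul_apply_eq_comp]
  have hhalf : ∀ w : E, ‖T w‖ ≤ ‖w‖ / 2 := fun w =>
    (T.le_of_opNorm_le hT w).trans (by linarith)
  refine ⟨_, hs.hasSum, fun v => ⟨fun hv => ?_, fun hv => hv ▸ hfix⟩, ?_⟩
  · set u := ∑' k : ℕ, (T ^ k) e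
    have h1 : v - u = T (v - u) := by
      rw [map_sub]; nth_rewrite 1 [hv, hfix]; abel
    have h2 := hhalf (v - u)
    rw [← h1] at h2
    exact sub_eq_zero.1 (norm_le_zero_iff.1 (by linarith [norm_nonneg (v - u)]))
  · set u := ∑' k : ℕ, (T ^ k) e
    have h1 : ‖u‖ ≤ ‖e‖ + ‖T u‖ := by
      conv_lhs => rw [hfix]
      exact norm_add_le _ _
    linarith [hhalf u]

section NormTopology

attribute [local instance] matNormTopology

lemma memLp_mul_of_bound {μ : Measure ℂ} {W : ℂ → Mat3} {ε : ℝ}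
    (hWm : AEStronglyMeasurable W μ) (hW : ∀ᵐ z ∂μ, ‖W z‖ ≤ ε)
    {f : ℂ → Mat3} (hf : MemLp f 2 μ) :
    MemLp (fun z => f z * W z) 2 μ ∧
      eLpNorm (fun z => f z * W z) 2 μ ≤ ENNReal.ofReal ε * eLpNorm f 2 μ := by
  have hb : ∀ᵐ z ∂μ, ‖f z * W z‖ ≤ ε * ‖f z‖ := by
    filter_upwards [hW] with z hz
    rw [mul_comm]
    exact (norm_mul_le _ _).trans (by gcongr)
  exact ⟨hf.of_le_mul (hf.1.mul hWm) hb, eLpNorm_le_mul_eLpNorm_of_ae_le_mul hb 2⟩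

namespace ContourData

variable {Γ : ContourData}

/-- The operator `f ↦ C₋(f W)` is bounded on `L²`, with norm controlled by the supremum of `W`. -/
lemma IsRegular.exists_isCauchyOperator (hΓ : Γ.IsRegular) :
    ∃ K : NNReal, ∀ (W : ℂ → Mat3) (ε : ℝ), 0 ≤ ε → AEStronglyMeasurable W Γ.arcLength →
      (∀ᵐ z ∂Γ.arcLength, ‖W z‖ ≤ ε) →
      ∃ T : Lp Mat3 2 Γ.arcLength →L[ℂ] Lp Mat3 2 Γ.arcLength,
        Γ.IsCauchyOperator W T ∧ ‖T‖ ≤ K * ε := by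
  obtain ⟨K, hK⟩ := hΓ.exists_cauchy_boundary
  refine ⟨K, fun W ε hε hWm hW => ?_⟩
  have hmul := fun f : Lp Mat3 2 Γ.arcLength => memLp_mul_of_bound hWm hW (Lp.memLp f)
  choose g hgm hgn hminus _ using fun f : Lp Mat3 2 Γ.arcLength => hK _ (hmul f).1
  have hminus' : ∀ f, Γ.IsMinusValue (Γ.cauchy fun z => f z * W z) ((hgm f).toLp) := fun f =>
    (hminus f).map_congr hΓ continuous_id (fun _ _ => rfl) (hgm f).coeFn_toLp.symm
  let T₀ : Lp Mat3 2 Γ.arcLength →ₗ[ℂ] Lp Mat3 2 Γ.arcLength :=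
    { toFun := fun f => (hgm f).toLp
      map_add' := fun f₁ f₂ => by
        refine Lp.ext (((hminus' (f₁ + f₂)).unique hΓ ?_).trans (Lp.coeFn_add _ _).symm)
        refine ((hminus' f₁).add (hminus' f₂)).map_congr hΓ continuous_id (fun z hz => ?_)
          (Eventually.of_forall fun _ => rfl)
        rw [id, ← hΓ.cauchy_add (hmul f₁).1 (hmul f₂).1 hz]
        refine cauchy_congr hΓ ?_ z
        filter_upwards [Lp.coeFn_add f₁ f₂] with s hs
        rw [hs, Pi.add_apply, add_mul]
      map_smul' := fun c f => by
        refine Lp.ext (((hminus' (c • f)).unique hΓ ?_).trans (Lp.coeFn_smul _ _).symm)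
        refine (hminus' f).map_congr hΓ (continuous_const_smul c) (fun z hz => ?_)
          (Eventually.of_forall fun _ => rfl)
        rw [← cauchy_smul]
        refine cauchy_congr hΓ ?_ z
        filter_upwards [Lp.coeFn_smul c f] with s hs
        rw [hs, Pi.smul_apply, smul_mul_assoc] }
  refine ⟨T₀.mkContinuous (K * ε) fun f => ?_, fun f => hminus' f,
    LinearMap.mkContinuous_norm_le _ (by positivity) _⟩
  change ‖(hgm f).toLp‖ ≤ _
  rw [Lp.norm_toLp, Lp.norm_def]
  have h1 : eLpNorm (g f) 2 Γ.arcLength ≤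
      K * (ENNReal.ofReal ε * eLpNorm f 2 Γ.arcLength) :=
    (hgn f).trans (mul_le_mul' le_rfl (hmul f).2)
  have h2 := ENNReal.toReal_mono (ENNReal.mul_ne_top ENNReal.coe_ne_top
    (ENNReal.mul_ne_top ENNReal.ofReal_ne_top (Lp.memLp f).eLpNorm_ne_top)) h1
  rwa [ENNReal.toReal_mul, ENNReal.toReal_mul, ENNReal.coe_toReal, ENNReal.toReal_ofReal hε,
    ← mul_assoc] at h2

lemma SolvesSingularEquation.memLp {W u : ℂ → Mat3} (h : Γ.SolvesSingularEquation W u) :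
    MemLp u 2 Γ.arcLength :=
  h.1

lemma SolvesSingularEquation.congr (hΓ : Γ.IsRegular) {W u v : ℂ → Mat3}
    (h : Γ.SolvesSingularEquation W u) (e : u =ᵐ[Γ.arcLength] v) :
    Γ.SolvesSingularEquation W v := by
  refine ⟨h.1.ae_eq e, h.2.map_congr hΓ continuous_id (fun z _ => cauchy_congr hΓ ?_ z) ?_⟩
  · filter_upwards [e] with z hz
    rw [hz]
  · filter_upwards [e] with z hz
    rw [hz, id]

/-- The singular integral equation is the fixed point equation of the Cauchy operator. -/
lemma IsCauchyOperator.solvesSingularEquation_iff (hΓ : Γ.IsRegular) {W : ℂ → Mat3}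
    {T : Lp Mat3 2 Γ.arcLength →L[ℂ] Lp Mat3 2 Γ.arcLength} (hT : Γ.IsCauchyOperator W T)
    {e : Lp Mat3 2 Γ.arcLength} (he : e =ᵐ[Γ.arcLength] fun _ => (1 : Mat3))
    (v : Lp Mat3 2 Γ.arcLength) : Γ.SolvesSingularEquation W v ↔ v = e + T v := by
  constructor
  · intro h
    refine Lp.ext ?_
    filter_upwards [h.2.unique hΓ (hT v), he, Lp.coeFn_add e (T v)] with z h1 h2 h3
    rw [h3, Pi.add_apply, h2, ← h1]
    abel
  · intro h
    refine ⟨Lp.memLp v, (hT v).map_congr hΓ continuous_id (fun _ _ => rfl) ?_⟩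
    have h0 : v =ᵐ[Γ.arcLength] (e + T v : Lp Mat3 2 Γ.arcLength) := by rw [← h]
    filter_upwards [h0, he, Lp.coeFn_add e (T v)] with z h1 h2 h3
    rw [h1, h3, Pi.add_apply, h2, id]
    abel

/-- The boundary values from the `-` side of a solution of the error problem solve the singular
integral equation, and the solution is recovered from them. -/
lemma IsErrorSolution.exists_singular (hΓ : Γ.IsRegular) {J R : ℂ → Mat3}
    (hR : Γ.IsErrorSolution J R) :
    ∃ v : ℂ → Mat3, Γ.SolvesSingularEquation (fun z => J z - 1) v ∧ Γ.IsMinusValue R v ∧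
      ∀ z ∉ Γ.sigmaR, R z = 1 + Γ.cauchy (fun s => v s * (J s - 1)) z := by
  obtain ⟨K, hK⟩ := hΓ.exists_cauchy_boundary
  obtain ⟨h, hh, hRh⟩ := hR.square_integrable
  obtain ⟨Rp, Rm, hRp, hRm, hplus, hminus, hjump⟩ := hR.jump
  obtain ⟨g, -, -, hgm, hgp⟩ := hK h hh
  have e₁ : Rm =ᵐ[Γ.arcLength] fun z => 1 + g z :=
    hminus.unique hΓ (hgm.map_congr hΓ (continuous_const.add continuous_id) hRh
      (Eventually.of_forall fun _ => rfl))
  have e₂ : Rp =ᵐ[Γ.arcLength] fun z => 1 + (g z + h z) :=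
    hplus.unique hΓ (hgp.map_congr hΓ (continuous_const.add continuous_id) hRh
      (Eventually.of_forall fun _ => rfl))
  have e₃ : h =ᵐ[Γ.arcLength] fun z => Rm z * (J z - 1) := by
    filter_upwards [e₁, e₂, hjump] with z h1 h2 h3
    rw [mul_sub, mul_one, ← h3, h1, h2]
    abel
  have hc := cauchy_congr hΓ e₃
  refine ⟨Rm, ⟨hRm, hgm.map_congr hΓ continuous_id (fun z _ => (hc z).symm) ?_⟩, hminus,
    fun z hz => by rw [hRh z hz, hc z]⟩
  filter_upwards [e₁] with z hz
  rw [hz, id]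
  abel

/-- The Cauchy transform decays like `1 / z` at infinity. -/
lemma IsRegular.cauchy_isBigO (hΓ : Γ.IsRegular) {h : ℂ → Mat3} (hh : MemLp h 2 Γ.arcLength) :
    Γ.cauchy h =O[Bornology.cobounded ℂ] fun z => z⁻¹ := by
  obtain ⟨D, hD0, hD⟩ := hΓ.exists_norm_cauchy_le
  obtain ⟨ρ, hρ⟩ := hΓ.isCompact_sigmaR.isBounded.exists_norm_le
  refine Asymptotics.IsBigO.of_bound (2 * D * (eLpNorm h 2 Γ.arcLength).toReal) ?_
  filter_upwards [(Filter.hasBasis_cobounded_norm (E := ℂ)).mem_of_mem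
    (i := 2 * |ρ| + 1) trivial] with z hz
  have hz' : 2 * |ρ| + 1 ≤ ‖z‖ := hz
  have hz0 : 0 < ‖z‖ := by linarith [abs_nonneg ρ]
  refine (hD _ hh z (‖z‖ / 2) (by positivity) fun s hs => ?_).trans (le_of_eq ?_)
  · have := norm_sub_norm_le z s
    rw [norm_sub_rev] at this
    linarith [hρ s hs, le_abs_self ρ]
  · rw [norm_inv]
    field_simp

/-- A solution of the singular integral equation produces a solution of the error problem. -/
lemma SolvesSingularEquation.isErrorSolution (hΓ : Γ.IsRegular) {J u : ℂ → Mat3}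
    (hu : Γ.SolvesSingularEquation (fun z => J z - 1) u)
    (huJ : MemLp (fun z => u z * (J z - 1)) 2 Γ.arcLength) :
    Γ.IsErrorSolution J fun z => 1 + Γ.cauchy (fun s => u s * (J s - 1)) z := by
  obtain ⟨K, hK⟩ := hΓ.exists_cauchy_boundary
  obtain ⟨g, -, -, hgm, hgp⟩ := hK _ huJ
  have e₁ := hgm.unique hΓ hu.2
  have hdiff : DifferentiableOn ℂ (fun z => 1 + Γ.cauchy (fun s => u s * (J s - 1)) z)
      Γ.sigmaRᶜ := (hΓ.differentiableOn_cauchy huJ).const_add 1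
  have hplus : Γ.IsPlusValue (fun z => 1 + Γ.cauchy (fun s => u s * (J s - 1)) z)
      (fun z => u z + u z * (J z - 1)) := by
    refine hgp.map_congr hΓ (Φ := fun A => 1 + A) (continuous_const.add continuous_id) (fun _ _ => rfl) ?_
    filter_upwards [e₁] with z hz
    rw [hz]
    abel
  have hminus : Γ.IsMinusValue (fun z => 1 + Γ.cauchy (fun s => u s * (J s - 1)) z) u := by
    refine hu.2.map_congr hΓ (Φ := fun A => 1 + A) (continuous_const.add continuous_id) (fun _ _ => rfl) ?_
    exact Eventually.of_forall fun z => by simp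
  have hLp : MemLp (fun z => u z + u z * (J z - 1)) 2 Γ.arcLength := hu.memLp.add huJ
  have hO : (fun z => 1 + Γ.cauchy (fun s => u s * (J s - 1)) z - 1)
      =O[Bornology.cobounded ℂ] fun z => z⁻¹ := by
    simpa only [add_sub_cancel_left] using hΓ.cauchy_isBigO huJ
  have hjump : ∀ᵐ z ∂Γ.arcLength, u z + u z * (J z - 1) = u z * J z :=
    Eventually.of_forall fun z => by rw [mul_sub, mul_one]; abel
  exact ⟨hdiff, ⟨_, u, hLp, hu.memLp, hplus, hminus, hjump⟩, hO, ⟨_, huJ, fun _ _ => rfl⟩⟩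

end ContourData

end NormTopology

namespace ContourData

variable {Γ : ContourData}

/-! ### The jump of the error problem -/

lemma IsRegular.notMem_softCircle (hΓ : Γ.IsRegular) {z : ℂ} (hz : z ∈ Metric.sphere (0 : ℂ) Γ.r₀) :
    z ∉ Metric.sphere (Γ.x₀ : ℂ) Γ.r₁ := by
  intro h
  rw [mem_sphere_iff_norm] at hz h
  have h1 := norm_sub_norm_le (Γ.x₀ : ℂ) z
  rw [norm_sub_rev, h] at h1
  rw [sub_zero] at hz
  have h2 : Γ.x₀ ≤ ‖(Γ.x₀ : ℂ)‖ := (le_abs_self _).trans_eq (Complex.norm_real _).symm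
  linarith [hΓ.disks_disjoint]

/-- The contour of `S` meets the circles in finitely many points: conductors by assumption, the
other arcs only at their endpoints. -/
lemma IsRegular.finite_sigmaS_inter (hΓ : Γ.IsRegular) :
    (Γ.sigmaS ∩ (Metric.sphere (0 : ℂ) Γ.r₀ ∪ Metric.sphere (Γ.x₀ : ℂ) Γ.r₁)).Finite := by
  have hfin : ((Γ.conductors ∩ (Metric.sphere (0 : ℂ) Γ.r₀ ∪ Metric.sphere (Γ.x₀ : ℂ) Γ.r₁)) ∪
      ((⋃ ch, ⋃ s, {(Γ.lip ch s).toFun 0, (Γ.lip ch s).toFun 1}) ∪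
        ⋃ k, {(Γ.inner k).toFun 0, (Γ.inner k).toFun 1})).Finite :=
    hΓ.conductors_circles.union ((finite_iUnion fun ch => finite_iUnion fun s =>
      toFinite _).union (finite_iUnion fun k => toFinite _))
  refine hfin.subset ?_
  rintro z ⟨hz, hc⟩
  obtain ⟨l, t, ht, rfl⟩ := mem_iUnion.1 hz
  have hends : t ∉ Ioo (0 : ℝ) 1 → t = 0 ∨ t = 1 := fun h => by
    by_contra! h'
    exact h ⟨lt_of_le_of_ne ht.1 h'.1.symm, lt_of_le_of_ne ht.2 h'.2⟩
  cases l with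
  | conductor ch => exact Or.inl ⟨mem_iUnion.2 ⟨ch, t, ht, rfl⟩, hc⟩
  | lip ch s =>
    refine Or.inr (Or.inl (mem_iUnion.2 ⟨ch, mem_iUnion.2 ⟨s, ?_⟩⟩))
    rcases hends fun h => hΓ.lips_outside ch s t h
      (hc.imp (fun h => Metric.sphere_subset_closedBall h)
        fun h => Metric.sphere_subset_closedBall h) with rfl | rfl
    exacts [Or.inl rfl, Or.inr rfl]
  | inner k =>
    refine Or.inr (Or.inr (mem_iUnion.2 ⟨k, ?_⟩))
    rcases hends fun h => by
      have hin := hΓ.inner_inside k t h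
      -- the two closed disks are disjoint, so the point is inside the disk whose circle it is on
      have h2 : Γ.x₀ ≤ ‖(Γ.x₀ : ℂ)‖ := (le_abs_self _).trans_eq (Complex.norm_real _).symm
      have h3 := norm_sub_norm_le (Γ.x₀ : ℂ) ((Γ.inner k).toFun t)
      rw [norm_sub_rev] at h3
      have hd := hΓ.disks_disjoint
      simp only [mem_union, mem_ball_iff_norm, mem_sphere_iff_norm, sub_zero, sArc] at hin hc
      rcases hin with h | h <;> rcases hc with h' | h' <;> linarith with rfl | rfl
    exacts [Or.inl rfl, Or.inr rfl]

lemma IsRegular.ae_notMem_finite (hΓ : Γ.IsRegular) (p : Piece) {F : Set ℂ} (hF : F.Finite) :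
    ∀ᵐ t ∂volume.restrict (Ioc (0 : ℝ) 1), Γ.param p t ∉ F := by
  have h1 : ∀ w ∈ F, ∀ᵐ t ∂volume.restrict (Ioc (0 : ℝ) 1), Γ.param p t ≠ w := by
    intro w _
    have hsub : ({t | Γ.param p t = w} ∩ Ioo 0 1).Subsingleton :=
      fun s hs t ht => hΓ.injOn_param p hs.2 ht.2 (hs.1.trans ht.1.symm)
    have h0 : ∀ᵐ t ∂(volume : Measure ℝ), t ∉ {t | Γ.param p t = w} ∩ Ioo 0 1 :=
      measure_eq_zero_iff_ae_notMem.1 (hsub.measure_zero volume)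
    filter_upwards [ae_restrict_of_ae h0, ae_mem_Ioo] with t ht ht' h
    exact ht ⟨h, ht'⟩
  filter_upwards [(ae_ball_iff hF.countable).2 h1] with t ht h
  exact ht _ h rfl

section Jump

variable {φ : Channel → ℂ → ℂ} {JS : ℕ → ℂ → Mat3} {N : ℂ → Mat3} {P₀ P₁ : ℕ → ℂ → Mat3}

lemma errorJump_hardCircle (hJS : Γ.IsPostLensJump φ JS) (n : ℕ) {z : ℂ}
    (hz : z ∈ Metric.sphere (0 : ℂ) Γ.r₀) (hzS : z ∉ Γ.sigmaS) :
    Γ.errorJump JS N P₀ P₁ n z = P₀ n z * (N z)⁻¹ := by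
  rw [errorJump, globalMinus, if_pos hz, hJS.off n z hzS, mul_one]

lemma errorJump_softCircle (hΓ : Γ.IsRegular) (hJS : Γ.IsPostLensJump φ JS) (n : ℕ) {z : ℂ}
    (hz : z ∈ Metric.sphere (Γ.x₀ : ℂ) Γ.r₁) (hzS : z ∉ Γ.sigmaS) :
    Γ.errorJump JS N P₀ P₁ n z = P₁ n z * (N z)⁻¹ := by
  rw [errorJump, globalMinus, if_neg fun h => hΓ.notMem_softCircle h hz, if_pos hz,
    hJS.off n z hzS, mul_one]

lemma errorJump_lip (hΓ : Γ.IsRegular) (n : ℕ) {ch : Channel} {s : Side} {z : ℂ}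
    (hz : z ∈ (Γ.lip ch s).toFun '' Ioo 0 1) :
    Γ.errorJump JS N P₀ P₁ n z = N z * JS n z * (N z)⁻¹ := by
  obtain ⟨t, ht, rfl⟩ := hz
  have h := hΓ.lips_outside ch s t ht
  rw [errorJump, globalMinus,
    if_neg fun h' => h (Or.inl (Metric.sphere_subset_closedBall h')),
    if_neg fun h' => h (Or.inr (Metric.sphere_subset_closedBall h'))]

lemma IsRegular.lip_notMem_conductors (hΓ : Γ.IsRegular) {ch : Channel} {s : Side} {z : ℂ}
    (hz : z ∈ (Γ.lip ch s).carrier) : z ∉ Γ.conductors :=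
  disjoint_left.1 (hΓ.lips_conductors ch s) hz

lemma isCompact_carrier (a : SmoothArc) : IsCompact a.carrier :=
  isCompact_Icc.image a.contDiff.continuous

/-- The inverse of the outer parametrix is continuous off the conductors. -/
lemma IsOuterParametrix.continuousOn_inv (hN : Γ.IsOuterParametrix N) :
    ContinuousOn (fun z => (N z)⁻¹) Γ.conductorsᶜ := by
  intro z hz
  have h1 : ContinuousAt (fun A : Mat3 => A⁻¹) (N z) := by
    refine continuousAt_matrix_inv _ ?_
    rw [Ring.inverse_eq_inv']
    exact continuousAt_inv₀ (hN.invertible z hz)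
  exact h1.comp_continuousWithinAt (hN.analytic.continuousOn z hz)

/-- On the lips the error jump is exponentially close to the identity: it is conjugate to the jump
of `S` by the outer parametrix, which is bounded there together with its inverse. -/
lemma IsOuterParametrix.exists_lip_bound (hΓ : Γ.IsRegular) (hφ : Γ.IsPhase φ)
    (hJS : Γ.IsPostLensJump φ JS) (hN : Γ.IsOuterParametrix N) :
    ∃ C c : ℝ, 0 ≤ C ∧ 0 < c ∧ ∀ᶠ n : ℕ in atTop, ∀ ch s, ∀ z ∈ (Γ.lip ch s).toFun '' Ioo 0 1,
      ‖Γ.errorJump JS N P₀ P₁ n z - 1‖ ≤ C * Real.exp (-(c * n)) := by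
  obtain ⟨c, hc, hre⟩ := hφ.lower_bound
  obtain ⟨A, hA⟩ := hJS.lip
  set X : Set ℂ := ⋃ ch, ⋃ s, (Γ.lip ch s).carrier with hX
  have hXc : IsCompact X := isCompact_iUnion fun ch => isCompact_iUnion fun s =>
    isCompact_carrier _
  have hXN : X ⊆ Γ.conductorsᶜ := iUnion_subset fun ch => iUnion_subset fun s z hz =>
    hΓ.lip_notMem_conductors hz
  obtain ⟨B₁, hB₁⟩ := hXc.exists_bound_of_continuousOn (hN.analytic.continuousOn.mono hXN)
  obtain ⟨B₂, hB₂⟩ := hXc.exists_bound_of_continuousOn (hN.continuousOn_inv.mono hXN)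
  set D : ℝ := ∑ i : Fin 3, ∑ j : Fin 3, ‖(Matrix.single i j (1 : ℂ) : Mat3)‖ with hD
  have hsingle : ∀ (i j : Fin 3) (w : ℂ), ‖(Matrix.single i j w : Mat3)‖ ≤ ‖w‖ * D := by
    intro i j w
    have e : (Matrix.single i j w : Mat3) = w • Matrix.single i j (1 : ℂ) := by
      rw [Matrix.smul_single, smul_eq_mul, mul_one]
    rw [e]
    refine (norm_smul_le _ _).trans (mul_le_mul_of_nonneg_left ?_ (norm_nonneg _))
    refine (Finset.single_le_sum (f := fun j => ‖(Matrix.single i j (1 : ℂ) : Mat3)‖)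
      (fun _ _ => norm_nonneg _) (Finset.mem_univ j)).trans ?_
    exact Finset.single_le_sum (f := fun i => ∑ j, ‖(Matrix.single i j (1 : ℂ) : Mat3)‖)
      (fun _ _ => Finset.sum_nonneg fun _ _ => norm_nonneg _) (Finset.mem_univ i)
  have hD0 : 0 ≤ D := Finset.sum_nonneg fun _ _ => Finset.sum_nonneg fun _ _ => norm_nonneg _
  refine ⟨|B₁| * (|A| * D) * |B₂|, c, by positivity, hc, ?_⟩
  filter_upwards [hA] with n hn ch s z hz
  have hzl : z ∈ (Γ.lip ch s).carrier := image_mono Ioo_subset_Icc_self hz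
  have hzX : z ∈ X := mem_iUnion.2 ⟨ch, mem_iUnion.2 ⟨s, hzl⟩⟩
  obtain ⟨w, hw, hJ⟩ := hn ch s z hz
  have hexp : ‖Complex.exp (-(n * φ ch z))‖ ≤ Real.exp (-(c * n)) := by
    rw [Complex.norm_exp, Real.exp_le_exp]
    simp only [Complex.neg_re, Complex.mul_re, Complex.natCast_re, Complex.natCast_im, zero_mul,
      sub_zero, neg_le_neg_iff]
    rw [mul_comm]
    exact mul_le_mul_of_nonneg_left (hre ch s z hzl) n.cast_nonneg
  have hw' : ‖w‖ ≤ |A| * Real.exp (-(c * n)) :=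
    hw.trans (mul_le_mul (le_abs_self A) hexp (norm_nonneg _) (abs_nonneg A))
  obtain ⟨i, j, hij⟩ : ∃ i j : Fin 3, JS n z = 1 + Matrix.single i j w := by
    rcases hJ with h | h
    exacts [⟨_, _, h⟩, ⟨_, _, h⟩]
  have hNN : N z * (N z)⁻¹ = 1 := Matrix.mul_nonsing_inv _
    (isUnit_iff_ne_zero.2 (hN.invertible z (hXN hzX)))
  have e : Γ.errorJump JS N P₀ P₁ n z - 1 = N z * Matrix.single i j w * (N z)⁻¹ := by
    rw [errorJump_lip hΓ n hz, hij, mul_add, mul_one, add_mul, hNN, add_sub_cancel_left]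
  rw [e]
  calc ‖N z * Matrix.single i j w * (N z)⁻¹‖
      ≤ ‖N z‖ * ‖(Matrix.single i j w : Mat3)‖ * ‖(N z)⁻¹‖ :=
        (norm_mul_le _ _).trans (mul_le_mul_of_nonneg_right (norm_mul_le _ _) (norm_nonneg _))
    _ ≤ |B₁| * (|A| * Real.exp (-(c * n)) * D) * |B₂| := by
        gcongr
        · exact (hB₁ z hzX).trans (le_abs_self _)
        · exact (hsingle i j w).trans (mul_le_mul_of_nonneg_right hw' hD0)
        · exact (hB₂ z hzX).trans (le_abs_self _)
    _ = _ := by ring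

/-- The error jump tends to the identity, at rate `1 / n` on the circles and exponentially on the
lips. -/
lemma exists_errorJump_bounds (hΓ : Γ.IsRegular) (hφ : Γ.IsPhase φ)
    (hJS : Γ.IsPostLensJump φ JS) (hN : Γ.IsOuterParametrix N)
    (hP₀ : Γ.IsLocalParametrix JS N 0 Γ.r₀ P₀) (hP₁ : Γ.IsLocalParametrix JS N Γ.x₀ Γ.r₁ P₁) :
    ∃ C c : ℝ, 0 ≤ C ∧ 0 < c ∧ ∀ᶠ n : ℕ in atTop,
      (∀ z ∈ (Metric.sphere (0 : ℂ) Γ.r₀ ∪ Metric.sphere (Γ.x₀ : ℂ) Γ.r₁) \ Γ.sigmaS,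
        ‖Γ.errorJump JS N P₀ P₁ n z - 1‖ ≤ C / n) ∧
      (∀ ch s, ∀ z ∈ (Γ.lip ch s).toFun '' Ioo 0 1,
        ‖Γ.errorJump JS N P₀ P₁ n z - 1‖ ≤ C * Real.exp (-(c * n))) := by
  obtain ⟨C, c, hC, hc, hlip⟩ := hN.exists_lip_bound (P₀ := P₀) (P₁ := P₁) hΓ hφ hJS
  obtain ⟨C₀, hC₀⟩ := hP₀.matching
  obtain ⟨C₁, hC₁⟩ := hP₁.matching
  have key : ∀ (D : ℝ) (n : ℕ), D ≤ |C₀| + |C₁| + C → D / n ≤ (|C₀| + |C₁| + C) / n :=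
    fun D n h => div_le_div_of_nonneg_right h n.cast_nonneg
  refine ⟨|C₀| + |C₁| + C, c, by positivity, hc, ?_⟩
  filter_upwards [hlip, hC₀, hC₁] with n h1 h2 h3
  refine ⟨?_, fun ch s z hz => (h1 ch s z hz).trans ?_⟩
  · rintro z ⟨hz | hz, hzS⟩
    · rw [errorJump_hardCircle hJS n hz hzS]
      exact (h2 z ⟨hz, hzS⟩).trans (key _ n (by linarith [le_abs_self C₀, abs_nonneg C₁]))
    · rw [errorJump_softCircle hΓ hJS n hz hzS]
      exact (h3 z ⟨hz, hzS⟩).trans (key _ n (by linarith [le_abs_self C₁, abs_nonneg C₀]))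
  · gcongr
    linarith [abs_nonneg C₀, abs_nonneg C₁]

/-- Bounds on the circles and lips give a bound almost everywhere on the error contour. -/
lemma exists_ae_errorJump_bound (hΓ : Γ.IsRegular) (hφ : Γ.IsPhase φ)
    (hJS : Γ.IsPostLensJump φ JS) (hN : Γ.IsOuterParametrix N)
    (hP₀ : Γ.IsLocalParametrix JS N 0 Γ.r₀ P₀) (hP₁ : Γ.IsLocalParametrix JS N Γ.x₀ Γ.r₁ P₁) :
    ∃ C : ℝ, 0 ≤ C ∧ ∀ᶠ n : ℕ in atTop,
      ∀ᵐ z ∂Γ.arcLength, ‖Γ.errorJump JS N P₀ P₁ n z - 1‖ ≤ C / n := by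
  obtain ⟨C, c, hC, hc, h⟩ := exists_errorJump_bounds hΓ hφ hJS hN hP₀ hP₁
  refine ⟨C + C / c, by positivity, ?_⟩
  filter_upwards [h, eventually_gt_atTop 0] with n hn hn0
  have hn0' : (0 : ℝ) < n := Nat.cast_pos.2 hn0
  have hcirc : ∀ z ∈ (Metric.sphere (0 : ℂ) Γ.r₀ ∪ Metric.sphere (Γ.x₀ : ℂ) Γ.r₁) \ Γ.sigmaS,
      ‖Γ.errorJump JS N P₀ P₁ n z - 1‖ ≤ (C + C / c) / n := fun z hz =>
    (hn.1 z hz).trans (by gcongr; exact le_add_of_nonneg_right (by positivity))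
  rw [hΓ.ae_arcLength_iff]
  intro p
  filter_upwards [hΓ.ae_notMem_finite p hΓ.finite_sigmaS_inter, ae_mem_Ioo] with t ht ht'
  cases p with
  | hardCircle =>
    have hm : Γ.param .hardCircle t ∈ Metric.sphere (0 : ℂ) Γ.r₀ :=
      circleMap_mem_sphere _ hΓ.r₀_pos.le _
    exact hcirc _ ⟨Or.inl hm, fun h => ht ⟨h, Or.inl hm⟩⟩
  | softCircle =>
    have hm : Γ.param .softCircle t ∈ Metric.sphere (Γ.x₀ : ℂ) Γ.r₁ :=
      circleMap_mem_sphere _ hΓ.r₁_pos.le _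
    exact hcirc _ ⟨Or.inr hm, fun h => ht ⟨h, Or.inr hm⟩⟩
  | lip ch s =>
    refine (hn.2 ch s _ ⟨t, ht', rfl⟩).trans ?_
    have hx : 0 < c * n := mul_pos hc hn0'
    -- exponential decay is absorbed in `1 / n`
    have hexp : Real.exp (-(c * n)) ≤ (c * n)⁻¹ := by
      rw [Real.exp_neg]
      exact inv_anti₀ hx (by linarith [Real.add_one_le_exp (c * n)])
    calc C * Real.exp (-(c * n)) ≤ C * (c * n)⁻¹ := by gcongr
      _ = C / c / n := by field_simp
      _ ≤ (C + C / c) / n := by gcongr; exact le_add_of_nonneg_left hC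

lemma aestronglyMeasurable_errorJump (hΓ : Γ.IsRegular)
    (hJS : Γ.IsPostLensJump φ JS) (hN : Γ.IsOuterParametrix N)
    (hP₀ : Γ.IsLocalParametrix JS N 0 Γ.r₀ P₀) (hP₁ : Γ.IsLocalParametrix JS N Γ.x₀ Γ.r₁ P₁)
    (n : ℕ) : AEStronglyMeasurable (Γ.errorJump JS N P₀ P₁ n) Γ.arcLength := by
  refine hΓ.aestronglyMeasurable_arcLength_iff.2 fun p => ?_
  set F := Γ.sigmaS ∩ (Metric.sphere (0 : ℂ) Γ.r₀ ∪ Metric.sphere (Γ.x₀ : ℂ) Γ.r₁) with hF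
  have hFfin : F.Finite := hΓ.finite_sigmaS_inter
  set S : Set ℝ := Ioo 0 1 ∩ Γ.param p ⁻¹' Fᶜ with hS
  have hSm : MeasurableSet S := measurableSet_Ioo.inter
    ((hFfin.isClosed.isOpen_compl.preimage (continuous_param p)).measurableSet)
  have hmem : ∀ᵐ t ∂volume.restrict (Ioc (0 : ℝ) 1), t ∈ S := by
    filter_upwards [hΓ.ae_notMem_finite p hFfin, ae_mem_Ioo] with t ht ht'
    exact ⟨ht', ht⟩
  rw [← Measure.restrict_eq_self_of_ae_mem hmem]
  refine ContinuousOn.aestronglyMeasurable ?_ hSm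
  have hcond : Γ.conductors ⊆ Γ.sigmaS := iUnion_subset fun ch z hz =>
    mem_iUnion.2 ⟨.conductor ch, hz⟩
  have hpar := (continuous_param (Γ := Γ) p).continuousOn (s := S)
  cases p with
  | hardCircle =>
    have hm : ∀ t, Γ.param .hardCircle t ∈ Metric.sphere (0 : ℂ) Γ.r₀ := fun t =>
      circleMap_mem_sphere _ hΓ.r₀_pos.le _
    have hSS : ∀ t ∈ S, Γ.param .hardCircle t ∉ Γ.sigmaS := fun t ht h => ht.2 ⟨h, Or.inl (hm t)⟩
    refine ContinuousOn.congr ?_ fun t ht => errorJump_hardCircle hJS n (hm t) (hSS t ht)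
    exact ((hP₀.continuous n).comp hpar fun t ht =>
      ⟨Metric.sphere_subset_closedBall (hm t), hSS t ht⟩).mul
      (hN.continuousOn_inv.comp hpar fun t ht h => hSS t ht (hcond h))
  | softCircle =>
    have hm : ∀ t, Γ.param .softCircle t ∈ Metric.sphere (Γ.x₀ : ℂ) Γ.r₁ := fun t =>
      circleMap_mem_sphere _ hΓ.r₁_pos.le _
    have hSS : ∀ t ∈ S, Γ.param .softCircle t ∉ Γ.sigmaS := fun t ht h => ht.2 ⟨h, Or.inr (hm t)⟩
    refine ContinuousOn.congr ?_ fun t ht => errorJump_softCircle hΓ hJS n (hm t) (hSS t ht)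
    exact ((hP₁.continuous n).comp hpar fun t ht =>
      ⟨Metric.sphere_subset_closedBall (hm t), hSS t ht⟩).mul
      (hN.continuousOn_inv.comp hpar fun t ht h => hSS t ht (hcond h))
  | lip ch s =>
    have hmaps : MapsTo (Γ.param (.lip ch s)) S ((Γ.lip ch s).toFun '' Ioo 0 1) :=
      fun t ht => ⟨t, ht.1, rfl⟩
    have hmaps' : MapsTo (Γ.param (.lip ch s)) S Γ.conductorsᶜ := fun t ht =>
      hΓ.lip_notMem_conductors (ch := ch) (s := s)
        (image_mono Ioo_subset_Icc_self (hmaps ht))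
    refine ContinuousOn.congr ?_ fun t ht => errorJump_lip hΓ n (hmaps ht)
    exact ((hN.analytic.continuousOn.comp hpar hmaps').mul
      ((hJS.lip_continuous n ch s).comp hpar hmaps)).mul (hN.continuousOn_inv.comp hpar hmaps')

end Jump

end ContourData

section NormTopology

attribute [local instance] matNormTopology

namespace ContourData

variable {Γ : ContourData}

/-! ### Solvability for small jumps -/

/-- If the Cauchy operator has norm at most one half, the singular integral equation and the error
problem are uniquely solvable, and the density of the solution is controlled by the jump. -/
lemma IsCauchyOperator.exists_solution (hΓ : Γ.IsRegular) {J : ℂ → Mat3} {ε : ℝ} (hε : 0 ≤ ε)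
    (hJm : AEStronglyMeasurable (fun z => J z - 1) Γ.arcLength)
    (hJ : ∀ᵐ z ∂Γ.arcLength, ‖J z - 1‖ ≤ ε)
    {T : Lp Mat3 2 Γ.arcLength →L[ℂ] Lp Mat3 2 Γ.arcLength}
    (hT : Γ.IsCauchyOperator (fun z => J z - 1) T) (hT1 : ‖T‖ ≤ 1 / 2)
    {e : Lp Mat3 2 Γ.arcLength} (he : e =ᵐ[Γ.arcLength] fun _ => (1 : Mat3)) :
    ∃ u : Lp Mat3 2 Γ.arcLength, HasSum (fun k : ℕ => (T ^ k) e) u ∧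
      Γ.SolvesSingularEquation (fun z => J z - 1) u ∧
      (∀ v : ℂ → Mat3, Γ.SolvesSingularEquation (fun z => J z - 1) v → v =ᵐ[Γ.arcLength] u) ∧
      Γ.IsErrorSolution J (fun z => 1 + Γ.cauchy (fun s => u s * (J s - 1)) z) ∧
      (∀ R : ℂ → Mat3, Γ.IsErrorSolution J R → Γ.IsMinusValue R u ∧
        ∀ z ∉ Γ.sigmaR, R z = 1 + Γ.cauchy (fun s => u s * (J s - 1)) z) ∧
      MemLp (fun s => u s * (J s - 1)) 2 Γ.arcLength ∧
      (eLpNorm (fun s => u s * (J s - 1)) 2 Γ.arcLength).toReal ≤ ε * (2 * ‖e‖) := by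
  obtain ⟨u, hsum, hfix, hnorm⟩ := exists_neumann_series T hT1 e
  have hiff := hT.solvesSingularEquation_iff hΓ he
  have hu : Γ.SolvesSingularEquation (fun z => J z - 1) u := (hiff u).2 ((hfix u).2 rfl)
  have huniq : ∀ v : ℂ → Mat3, Γ.SolvesSingularEquation (fun z => J z - 1) v →
      v =ᵐ[Γ.arcLength] u := fun v hv => by
    have hv' := hv.memLp.coeFn_toLp
    rw [← (hfix _).1 ((hiff _).1 (hv.congr hΓ hv'.symm))]
    exact hv'.symm
  obtain ⟨hmem, hle⟩ := memLp_mul_of_bound hJm hJ (Lp.memLp u)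
  refine ⟨u, hsum, hu, huniq, hu.isErrorSolution hΓ hmem, fun R hR => ?_, hmem, ?_⟩
  · obtain ⟨v, hv, hRv, hRc⟩ := hR.exists_singular hΓ
    have hvu := huniq v hv
    refine ⟨hRv.map_congr hΓ continuous_id (fun _ _ => rfl) hvu, fun z hz => ?_⟩
    rw [hRc z hz]
    congr 1
    refine cauchy_congr hΓ ?_ z
    filter_upwards [hvu] with s hs
    rw [hs]
  · have h1 := ENNReal.toReal_mono
      (ENNReal.mul_ne_top ENNReal.ofReal_ne_top (Lp.memLp u).eLpNorm_ne_top) hle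
    rw [ENNReal.toReal_mul, ENNReal.toReal_ofReal hε, ← Lp.norm_def] at h1
    exact h1.trans (mul_le_mul_of_nonneg_left hnorm hε)

/-- Small-norm theorem for a sequence of jump matrices that tends uniformly to the identity at rate
`1 / n`. -/
lemma IsRegular.small_norm (hΓ : Γ.IsRegular) {J : ℕ → ℂ → Mat3} {C : ℝ} (hC : 0 ≤ C)
    (hJm : ∀ n, AEStronglyMeasurable (fun z => J n z - 1) Γ.arcLength)
    (hJ : ∀ᶠ n : ℕ in atTop, ∀ᵐ z ∂Γ.arcLength, ‖J n z - 1‖ ≤ C / n) :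
    ∃ (M : ℝ) (e : Lp Mat3 2 Γ.arcLength), (e =ᵐ[Γ.arcLength] fun _ => (1 : Mat3)) ∧
      ∀ᶠ n : ℕ in atTop, ∃ (T : Lp Mat3 2 Γ.arcLength →L[ℂ] Lp Mat3 2 Γ.arcLength)
        (u : Lp Mat3 2 Γ.arcLength),
      Γ.IsCauchyOperator (fun z => J n z - 1) T ∧ ‖T‖ ≤ M / n ∧
      HasSum (fun k : ℕ => (T ^ k) e) u ∧
      Γ.SolvesSingularEquation (fun z => J n z - 1) u ∧
      (∀ v : ℂ → Mat3, Γ.SolvesSingularEquation (fun z => J n z - 1) v →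
        v =ᵐ[Γ.arcLength] u) ∧
      Γ.IsErrorSolution (J n) (fun z => 1 + Γ.cauchy (fun s => u s * (J n s - 1)) z) ∧
      (∀ R : ℂ → Mat3, Γ.IsErrorSolution (J n) R → Γ.IsMinusValue R u ∧
        ∀ z ∉ Γ.sigmaR, R z = 1 + Γ.cauchy (fun s => u s * (J n s - 1)) z) ∧
      MemLp (fun s => u s * (J n s - 1)) 2 Γ.arcLength ∧
      (eLpNorm (fun s => u s * (J n s - 1)) 2 Γ.arcLength).toReal ≤ C / n * (2 * ‖e‖) := by
  obtain ⟨K, hK⟩ := hΓ.exists_isCauchyOperator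
  have hfin := hΓ.isFiniteMeasure_arcLength
  have hone : MemLp (fun _ : ℂ => (1 : Mat3)) 2 Γ.arcLength := memLp_const 1
  refine ⟨K * C, hone.toLp, hone.coeFn_toLp, ?_⟩
  have hsmall : ∀ᶠ n : ℕ in atTop, K * C / n ≤ 1 / 2 :=
    (tendsto_const_div_atTop_nhds_zero_nat (K * C)).eventually_le_const (by norm_num)
  filter_upwards [hJ, hsmall] with n hn hn'
  have hε : 0 ≤ C / n := by positivity
  obtain ⟨T, hT, hTn⟩ := hK _ _ hε (hJm n) hn
  have hTn' : ‖T‖ ≤ K * C / n := hTn.trans_eq (by ring)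
  obtain ⟨u, hu⟩ := hT.exists_solution hΓ hε (hJm n) hn (hTn'.trans hn') hone.coeFn_toLp
  exact ⟨T, u, hT, hTn', hu⟩

end ContourData

end NormTopology

theorem proposition7p1
    (Γ : ContourData) (hΓ : Γ.IsRegular)
    (φ : Channel → ℂ → ℂ) (hφ : Γ.IsPhase φ)
    (JS : ℕ → ℂ → Mat3) (hJS : Γ.IsPostLensJump φ JS)
    (N : ℂ → Mat3) (hN : Γ.IsOuterParametrix N)
    (P₀ P₁ : ℕ → ℂ → Mat3)
    (hP₀ : Γ.IsLocalParametrix JS N 0 Γ.r₀ P₀)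
    (hP₁ : Γ.IsLocalParametrix JS N Γ.x₀ Γ.r₁ P₁)
    (JR : ℕ → ℂ → Mat3) (hJR : JR = Γ.errorJump JS N P₀ P₁) :
    -- the jumps on the circles and on the lens lips
    (∃ C c : ℝ, 0 < c ∧ ∀ᶠ n : ℕ in atTop,
      (∀ z ∈ (Metric.sphere (0 : ℂ) Γ.r₀ ∪ Metric.sphere (Γ.x₀ : ℂ) Γ.r₁) \ Γ.sigmaS,
        ‖JR n z - 1‖ ≤ C / n) ∧
      (∀ ch s, ∀ z ∈ (Γ.lip ch s).toFun '' Ioo 0 1,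
        ‖JR n z - 1‖ ≤ C * Real.exp (-(c * n)))) ∧
    -- unique solvability for large n, by a Neumann series
    (∃ M : ℝ, ∀ᶠ n : ℕ in atTop,
      (∃ R : ℂ → Mat3, Γ.IsErrorSolution (JR n) R ∧
        ∀ R' : ℂ → Mat3, Γ.IsErrorSolution (JR n) R' → EqOn R' R Γ.sigmaRᶜ) ∧
      ∃ (T : Lp Mat3 2 Γ.arcLength →L[ℂ] Lp Mat3 2 Γ.arcLength)
        (e u : Lp Mat3 2 Γ.arcLength),
        Γ.IsCauchyOperator (fun z => JR n z - 1) T ∧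
        ‖T‖ ≤ M / n ∧
        (e =ᵐ[Γ.arcLength] fun _ => (1 : Mat3)) ∧
        HasSum (fun k : ℕ => (T ^ k) e) u ∧
        Γ.SolvesSingularEquation (fun z => JR n z - 1) u ∧
        (∀ v : ℂ → Mat3, Γ.SolvesSingularEquation (fun z => JR n z - 1) v →
          v =ᵐ[Γ.arcLength] u) ∧
        (∀ R : ℂ → Mat3, Γ.IsErrorSolution (JR n) R →
          Γ.IsMinusValue R u ∧
          ∀ z ∉ Γ.sigmaR, R z = 1 + Γ.cauchy (fun s => u s * (JR n s - 1)) z)) ∧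
    -- the estimate on compact sets
    (∀ K : Set ℂ, IsCompact K → K ⊆ Γ.sigmaRᶜ →
      ∃ C : ℝ, ∀ᶠ n : ℕ in atTop, ∀ R : ℂ → Mat3, Γ.IsErrorSolution (JR n) R →
        ∀ z ∈ K, ‖R z - 1‖ ≤ C / n) := by
  subst hJR
  obtain ⟨C₁, c, -, hc, hbounds⟩ :=
    ContourData.exists_errorJump_bounds hΓ hφ hJS hN hP₀ hP₁
  obtain ⟨C, hC, hae⟩ := ContourData.exists_ae_errorJump_bound hΓ hφ hJS hN hP₀ hP₁
  obtain ⟨M, e, he, hsol⟩ := hΓ.small_norm hC (fun n =>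
    (ContourData.aestronglyMeasurable_errorJump hΓ hJS hN hP₀ hP₁ n).sub aestronglyMeasurable_const) hae
  refine ⟨⟨C₁, c, hc, hbounds⟩, ⟨M, ?_⟩, fun K hK hKR => ?_⟩
  · filter_upwards [hsol] with n hn
    obtain ⟨T, u, hT, hTn, hsum, hu, huniq, hR, hRu, -, -⟩ := hn
    exact ⟨⟨_, hR, fun R' hR' z hz => (hRu R' hR').2 z hz⟩,
      T, e, u, hT, hTn, he, hsum, hu, huniq, hRu⟩
  · obtain ⟨D, hD0, hD⟩ := hΓ.exists_norm_cauchy_le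
    obtain ⟨d, hd, hdisj⟩ := (disjoint_left.2 fun z hz => hKR hz).exists_thickenings hK
      hΓ.isCompact_sigmaR.isClosed
    refine ⟨D / d * (C * (2 * ‖e‖)), ?_⟩
    filter_upwards [hsol] with n hn R hR z hz
    obtain ⟨T, u, -, -, -, -, -, -, hRu, hmem, hle⟩ := hn
    rw [(hRu R hR).2 z (hKR hz), add_sub_cancel_left]
    have hdist : ∀ s ∈ Γ.sigmaR, d ≤ ‖s - z‖ := fun s hs => by
      by_contra! hlt
      exact disjoint_left.1 hdisj (Metric.self_subset_thickening hd K hz)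
        (Metric.mem_thickening_iff.2 ⟨s, hs, by rwa [dist_comm, dist_eq_norm]⟩)
    calc _ ≤ D / d * _ := hD _ hmem z d hd hdist
      _ ≤ D / d * (C / n * (2 * ‖e‖)) := mul_le_mul_of_nonneg_left hle (by positivity)
      _ = _ := by ring
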